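/- Let $A$ be a ribbon quasi-Hopf algebra over a field $K$, that is: a unital associative algebra with algebra homomorphisms $\epsilon:A\to K$, $\Delta:A\to A\otimes A$, an invertible $\Phi=\sum X\otimes Y\otimes Z\in A^{\otimes 3}$ with $\Phi^{-1}=\sum\bar X\otimes\bar Y\otimes\bar Z$, an algebra anti-homomorphism $S$ and elements $\alpha,\beta\in A$ such that $(1\otimes\Delta)\Delta(a)=\Phi^{-1}(\Delta\otimes1)\Delta(a)\,\Phi$, $\;(\Delta\otimes1\otimes1)\Phi\cdot(1\otimes1\otimes\Delta)\Phi=(\Phi\otimes1)\cdot(1\otimes\Delta\otimes1)\Phi\cdot(1\otimes\Phi)$, $\;(\epsilon\otimes1)\Delta=1=(1\otimes\epsilon)\Delta$, $\;(1\otimes\epsilon\otimes1)\Phi=1$, $\;\sum S(a_{(1)})\alpha a_{(2)}=\epsilon(a)\alpha$, $\;\sum a_{(1)}\beta S(a_{(2)})=\epsilon(a)\beta$, $\;\sum\bar X\beta S(\bar Y)\alpha\bar Z=1=\sum S(X)\alpha Y\beta S(Z)$; an invertible $\mathcal R=\sum a_\nu\otimes b_\nu\in A\otimes A$ with $\Delta^T(a)\mathcal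 R=\mathcal R\Delta(a)$, $\;(\Delta\otimes1)\mathcal R=\Phi^{-1}_{231}\mathcal R_{13}\Phi_{132}\mathcal R_{23}\Phi^{-1}_{123}$, $\;(1\otimes\Delta)\mathcal R=\Phi_{312}\mathcal R_{13}\Phi^{-1}_{213}\mathcal R_{12}\Phi_{123}$, where $T$ is the flip, $\Delta^T=T\Delta$, $\Phi_{132}=(1\otimes T)\Phi$, $\Phi_{312}=(T\otimes1)(1\otimes T)\Phi$, $\Phi_{213}=(T\otimes1)\Phi$, $\Phi_{231}=(1\otimes T)(T\otimes1)\Phi$; and an invertible central $v\in A$ with $v^2=uS(u)$, $S(v)=v$, $\epsilon(v)=1$, $\Delta(uv^{-1})=\mathcal F^{-1}(S\otimes S)\mathcal F_{21}\cdot(uv^{-1}\otimes uv^{-1})$. Here $u=\sum S(Y\beta S(Z))S(b_\nu)\alpha a_\nu X$ and $\mathcal F=\sum(S\otimes S)\Delta^T(X)\cdot\gamma\cdot\Delta(Y\beta S(Z))$ is the Drinfeld twist, with $\gamma=\sum S(B)\alpha C\otimes S(A)\alpha D$ for $\sum A\otimes B\otimes C\otimes D=(\Phi^{-1}\otimes1)\cdot(\Delta\otimes1\otimes1)\Phi$.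 Let $\Delta^{(0)}=\mathrm{id}$ and $\Delta^{(n)}=(\Delta\otimes1^{\otimes(n-1)})\Delta^{(n-1)}:A\to A^{\otimes(n+1)}$. Let $V$ be a finite-dimensional irreducible $A$-module, with representation $\pi$ (suppressed below), $\check R=P\,(\pi\otimes\pi)(\mathcal R)$ where $P$ is the flip of $V\otimes V$, and define on $V^{\otimes(n+1)}$ the operators $\sigma_1=\check R_{12}$ and $\sigma_i=\Phi_i\check R_{i(i+1)}\Phi_i^{-1}$, $\Phi_i=(\Delta^{(i-2)}\otimes1\otimes1)\Phi$, for $2\le i\le n$. Let $B_n$ be the braid group with generators $\sigma_1,\dots,\sigma_n$ (braids on $n+1$ strands). Then, for every $n\ge0$, these operators define a representation of $B_n$ on $V^{\otimes(n+1)}$, and $$\theta_n(\Psi)=\mathrm{tr}\left(\Psi\,\Delta^{(n)}(\beta S(\alpha)uv^{-1})\right)$$ is a Markov trace: 1. $\theta_n(\Psi_1\Psi_2)=\theta_n(\Psi_2\Psi_1)$ for all words $\Psi_1,\Psi_2$ in $\sigma_1^{\pm1},\dots,\sigma_n^{\pm1}$; 2. $\theta_n(\Psi\sigma_n^{\pm1})=z^{\pm}\theta_{n-1}(\Psi)$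 for all $n\ge1$ and all words $\Psi$ in $\sigma_1^{\pm1},\dots,\sigma_{n-1}^{\pm1}$, where $z^{\pm}\in K$ is the eigenvalue of $v^{\mp1}$ on $V$ (if $K$ is algebraically closed then $v^{\mp1}$ has exactly one eigenvalue on $V$; over a general field it is assumed that there is one). Hence it yields an ambient isotopy invariant of oriented links: with $e(\Psi)$ the exponent sum of $\Psi$, and for every choice of the square roots with $(z^+z^-)^{1/2}(z^- /z^+)^{1/2}=z^-$, the function $$L(\hat\Psi)=(z^+z^-)^{n/2}\left(\frac{z^-}{z^+}\right)^{e(\Psi)/2}\theta_n(\Psi),\qquad\Psi\in B_n,$$ satisfies $L(\widehat{\Psi_1\Psi_2})=L(\widehat{\Psi_2\Psi_1})$ for $\Psi_1,\Psi_2\in B_n$ and $L(\widehat{\Psi\sigma_n^{\pm1}})=L(\hat\Psi)$ for $\Psi\in B_{n-1}$, and there is a function of oriented link diagrams, invariant under ambient isotopy (planar isotopy and the Reidemeister moves), whose value on the closure $\hat\Psi$ of every braid word $\Psi$ is $L(\hat\Psi)$. -/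

import Mathlib

open scoped TensorProduct

noncomputable section

namespace RibbonQuasi

universe u v w

/-! ### Algebra maps between tensor powers (all bracketed to the left) -/

section Legs

variable (K : Type v) [Field K] (A : Type u) [Ring A] [Algebra K A]

/-- The flip `T : x ⊗ y ↦ y ⊗ x`. -/
def flip : A ⊗[K] A →ₐ[K] A ⊗[K] A :=
  (Algebra.TensorProduct.comm K A A).toAlgHom

/-- Reassociation `x ⊗ (y ⊗ z) ↦ (x ⊗ y) ⊗ z`, for arbitrary algebras. -/
def unassoc (B C D : Type*) [Ring B] [Ring C] [Ring D] [Algebra K B] [Algebra K C] [Algebra K D] :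
    B ⊗[K] (C ⊗[K] D) →ₐ[K] (B ⊗[K] C) ⊗[K] D :=
  (Algebra.TensorProduct.assoc K K K B C D).symm.toAlgHom

/-- `T ⊗ 1 : x ⊗ y ⊗ z ↦ y ⊗ x ⊗ z`. -/
def T12 : (A ⊗[K] A) ⊗[K] A →ₐ[K] (A ⊗[K] A) ⊗[K] A :=
  Algebra.TensorProduct.map (flip K A) (AlgHom.id K A)

/-- `1 ⊗ T : x ⊗ y ⊗ z ↦ x ⊗ z ⊗ y`. -/
def T23 : (A ⊗[K] A) ⊗[K] A →ₐ[K] (A ⊗[K] A) ⊗[K] A :=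
  ((unassoc K A A A).comp (Algebra.TensorProduct.map (AlgHom.id K A) (flip K A))).comp
    (Algebra.TensorProduct.assoc K K K A A A).toAlgHom

/-- `x ⊗ y ↦ x ⊗ y ⊗ 1`. -/
def leg12 : A ⊗[K] A →ₐ[K] (A ⊗[K] A) ⊗[K] A :=
  Algebra.TensorProduct.includeLeft

/-- `x ⊗ y ↦ x ⊗ 1 ⊗ y`. -/
def leg13 : A ⊗[K] A →ₐ[K] (A ⊗[K] A) ⊗[K] A :=
  Algebra.TensorProduct.map Algebra.TensorProduct.includeLeft (AlgHom.id K A)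

/-- `x ⊗ y ↦ 1 ⊗ x ⊗ y`. -/
def leg23 : A ⊗[K] A →ₐ[K] (A ⊗[K] A) ⊗[K] A :=
  Algebra.TensorProduct.map Algebra.TensorProduct.includeRight (AlgHom.id K A)

/-- `x ⊗ y ⊗ z ↦ x ⊗ y ⊗ z ⊗ 1`. -/
def leg123 : (A ⊗[K] A) ⊗[K] A →ₐ[K] ((A ⊗[K] A) ⊗[K] A) ⊗[K] A :=
  Algebra.TensorProduct.includeLeft

/-- `x ⊗ y ⊗ z ↦ 1 ⊗ x ⊗ y ⊗ z`. -/
def leg234 : (A ⊗[K] A) ⊗[K] A →ₐ[K] ((A ⊗[K] A) ⊗[K] A) ⊗[K] A :=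
  Algebra.TensorProduct.map (leg23 K A) (AlgHom.id K A)

variable {K A} (Δ : A →ₐ[K] A ⊗[K] A)

/-- `Δ ⊗ 1`. -/
def comul12 : A ⊗[K] A →ₐ[K] (A ⊗[K] A) ⊗[K] A :=
  Algebra.TensorProduct.map Δ (AlgHom.id K A)

/-- `1 ⊗ Δ`. -/
def comul23 : A ⊗[K] A →ₐ[K] (A ⊗[K] A) ⊗[K] A :=
  (unassoc K A A A).comp (Algebra.TensorProduct.map (AlgHom.id K A) Δ)

/-- `Δ ⊗ 1 ⊗ 1`. -/
def comul1_3 : (A ⊗[K] A) ⊗[K] A →ₐ[K] ((A ⊗[K] A) ⊗[K] A) ⊗[K] A :=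
  Algebra.TensorProduct.map (comul12 Δ) (AlgHom.id K A)

/-- `1 ⊗ Δ ⊗ 1`. -/
def comul2_3 : (A ⊗[K] A) ⊗[K] A →ₐ[K] ((A ⊗[K] A) ⊗[K] A) ⊗[K] A :=
  Algebra.TensorProduct.map (comul23 Δ) (AlgHom.id K A)

/-- `1 ⊗ 1 ⊗ Δ`. -/
def comul3_3 : (A ⊗[K] A) ⊗[K] A →ₐ[K] ((A ⊗[K] A) ⊗[K] A) ⊗[K] A :=
  (unassoc K (A ⊗[K] A) A A).comp (Algebra.TensorProduct.map (AlgHom.id K (A ⊗[K] A)) Δ)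

variable (ε : A →ₐ[K] K)

/-- `ε ⊗ 1 : A ⊗ A → A`. -/
def counitLeft : A ⊗[K] A →ₐ[K] A :=
  (Algebra.TensorProduct.lid K A).toAlgHom.comp (Algebra.TensorProduct.map ε (AlgHom.id K A))

/-- `1 ⊗ ε : A ⊗ A → A`. -/
def counitRight : A ⊗[K] A →ₐ[K] A :=
  (Algebra.TensorProduct.rid K K A).toAlgHom.comp (Algebra.TensorProduct.map (AlgHom.id K A) ε)

/-- `1 ⊗ ε ⊗ 1 : A ⊗ A ⊗ A → A ⊗ A`. -/
def counitMiddle : (A ⊗[K] A) ⊗[K] A →ₐ[K] A ⊗[K] A :=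
  Algebra.TensorProduct.map (counitRight ε) (AlgHom.id K A)

variable (S : A →ₗ[K] A)

/-- `x ⊗ y ↦ S(x) c y`. -/
def antiLeft (c : A) : A ⊗[K] A →ₗ[K] A :=
  LinearMap.mul' K A ∘ₗ TensorProduct.map S (LinearMap.mulLeft K c)

/-- `x ⊗ y ↦ x c S(y)`. -/
def antiRight (c : A) : A ⊗[K] A →ₗ[K] A :=
  LinearMap.mul' K A ∘ₗ TensorProduct.map LinearMap.id (LinearMap.mulLeft K c ∘ₗ S)

end Legs

/-! ### Quasi-Hopf, quasi-triangular and ribbon quasi-Hopf algebras -/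

/-- A quasi-Hopf algebra structure on the unital associative `K`-algebra `A`. The convention is
`Φ (1 ⊗ Δ)Δ(a) = (Δ ⊗ 1)Δ(a) Φ`, so `Φ` is the inverse of the associator in the other common
convention. -/
structure QuasiHopfAlgebra (K : Type v) [Field K] (A : Type u) [Ring A] [Algebra K A] where
  /-- co-unit -/
  ε : A →ₐ[K] K
  /-- co-product -/
  Δ : A →ₐ[K] A ⊗[K] A
  /-- co-associator -/
  Φ : ((A ⊗[K] A) ⊗[K] A)ˣ
  /-- antipode -/
  S : A →ₗ[K] A
  /-- canonical elements -/
  α : A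
  β : A
  S_one : S 1 = 1
  S_mul : ∀ a b, S (a * b) = S b * S a
  coassoc : ∀ a, comul23 Δ (Δ a) = (↑Φ⁻¹ : (A ⊗[K] A) ⊗[K] A) * comul12 Δ (Δ a) * ↑Φ
  pentagon : comul1_3 Δ ↑Φ * comul3_3 Δ ↑Φ = leg123 K A ↑Φ * comul2_3 Δ ↑Φ * leg234 K A ↑Φ
  counit_left : ∀ a, counitLeft ε (Δ a) = a
  counit_right : ∀ a, counitRight ε (Δ a) = a
  counit_middle : counitMiddle ε ↑Φ = 1
  antipode_left : ∀ a, antiLeft S α (Δ a) = ε a • α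
  antipode_right : ∀ a, antiRight S β (Δ a) = ε a • β
  /-- `∑ X̄ β S(Ȳ) α Z̄ = 1` for `Φ⁻¹ = ∑ X̄ ⊗ Ȳ ⊗ Z̄` -/
  antipode_assoc_inv : (LinearMap.mul' K A ∘ₗ
    TensorProduct.map (antiRight S β) (LinearMap.mulLeft K α))
      (↑Φ⁻¹ : (A ⊗[K] A) ⊗[K] A) = 1
  /-- `∑ S(X) α Y β S(Z) = 1` for `Φ = ∑ X ⊗ Y ⊗ Z` -/
  antipode_assoc : (LinearMap.mul' K A ∘ₗ
    TensorProduct.map (antiLeft S α) (LinearMap.mulLeft K β ∘ₗ S))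
      (↑Φ : (A ⊗[K] A) ⊗[K] A) = 1

/-- A quasi-triangular quasi-Hopf algebra, with universal R-matrix `R`. Here
`Φ₂₃₁ = (1 ⊗ T)(T ⊗ 1)Φ`, `Φ₁₃₂ = (1 ⊗ T)Φ`, `Φ₃₁₂ = (T ⊗ 1)(1 ⊗ T)Φ`, `Φ₂₁₃ = (T ⊗ 1)Φ`. -/
structure QuasiTriangularQuasiHopfAlgebra (K : Type v) [Field K] (A : Type u) [Ring A]
    [Algebra K A] extends QuasiHopfAlgebra K A where
  R : (A ⊗[K] A)ˣ
  R_comul : ∀ a, flip K A (Δ a) * ↑R = ↑R * Δ a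
  comul_R_left : comul12 Δ ↑R =
    T23 K A (T12 K A ↑Φ⁻¹) * leg13 K A ↑R * T23 K A ↑Φ * leg23 K A ↑R * ↑Φ⁻¹
  comul_R_right : comul23 Δ ↑R =
    T12 K A (T23 K A ↑Φ) * leg13 K A ↑R * T12 K A ↑Φ⁻¹ * leg12 K A ↑R * ↑Φ

section DrinfeldElements

variable {K : Type v} [Field K] {A : Type u} [Ring A] [Algebra K A]

/-- `γ = ∑ S(B) α C ⊗ S(A) α D`, where `∑ A ⊗ B ⊗ C ⊗ D = (Φ⁻¹ ⊗ 1) (Δ ⊗ 1 ⊗ 1)Φ`. -/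
def QuasiHopfAlgebra.gamma (H : QuasiHopfAlgebra K A) : A ⊗[K] A :=
  -- `((a ⊗ b) ⊗ c) ⊗ d ↦ (b ⊗ c) ⊗ (a ⊗ d) ↦ S(b) α c ⊗ S(a) α d`
  (TensorProduct.map (antiLeft H.S H.α) (antiLeft H.S H.α) ∘ₗ
    (TensorProduct.assoc K (A ⊗[K] A) A A).toLinearMap ∘ₗ
    TensorProduct.map (TensorProduct.comm K A (A ⊗[K] A)).toLinearMap LinearMap.id ∘ₗ
    TensorProduct.map (TensorProduct.assoc K A A A).toLinearMap LinearMap.id)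
      (leg123 K A (↑H.Φ⁻¹ : (A ⊗[K] A) ⊗[K] A) * comul1_3 H.Δ ↑H.Φ)

/-- The Drinfeld twist `𝓕 = ∑ (S ⊗ S)Δᵀ(X) · γ · Δ(Y β S(Z))`, where `Φ = ∑ X ⊗ Y ⊗ Z`. -/
def QuasiHopfAlgebra.drinfeldTwist (H : QuasiHopfAlgebra K A) : A ⊗[K] A :=
  (LinearMap.mul' K (A ⊗[K] A) ∘ₗ
    TensorProduct.map
      (LinearMap.mulRight K H.gamma ∘ₗ TensorProduct.map H.S H.S ∘ₗ
        (flip K A).toLinearMap ∘ₗ H.Δ.toLinearMap)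
      (H.Δ.toLinearMap ∘ₗ antiRight H.S H.β) ∘ₗ
    (TensorProduct.assoc K A A A).toLinearMap) ↑H.Φ

/-- `u = ∑ S(Y β S(Z)) S(b) α a X`, where `Φ = ∑ X ⊗ Y ⊗ Z` and `R = ∑ a ⊗ b`. -/
def QuasiTriangularQuasiHopfAlgebra.u (H : QuasiTriangularQuasiHopfAlgebra K A) : A :=
  -- `X ⊗ (Y ⊗ Z) ↦ (Y ⊗ Z) ⊗ X ↦ S(Y β S(Z)) r X` with `r = ∑ S(b) α a`
  (LinearMap.mul' K A ∘ₗ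
    TensorProduct.map
      (LinearMap.mulRight K (antiLeft H.S H.α (flip K A ↑H.R)) ∘ₗ H.S ∘ₗ antiRight H.S H.β)
      LinearMap.id ∘ₗ
    (TensorProduct.comm K A (A ⊗[K] A)).toLinearMap ∘ₗ
    (TensorProduct.assoc K A A A).toLinearMap) ↑H.Φ

end DrinfeldElements

/-- A ribbon quasi-Hopf algebra, with (invertible) ribbon element `v`. The last condition is
`Δ(u v⁻¹) = 𝓕⁻¹ · (S ⊗ S)(𝓕₂₁) · (u v⁻¹ ⊗ u v⁻¹)` with the factor `𝓕⁻¹` of the Drinfeld twist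
(which is always invertible) moved to the other side. -/
structure RibbonQuasiHopfAlgebra (K : Type v) [Field K] (A : Type u) [Ring A]
    [Algebra K A] extends QuasiTriangularQuasiHopfAlgebra K A where
  v : Aˣ
  v_central : ∀ a : A, ↑v * a = a * ↑v
  v_sq : (↑v : A) ^ 2 = toQuasiTriangularQuasiHopfAlgebra.u *
    S toQuasiTriangularQuasiHopfAlgebra.u
  S_v : S ↑v = ↑v
  ε_v : ε ↑v = 1
  comul_uv : toQuasiHopfAlgebra.drinfeldTwist *
      Δ (toQuasiTriangularQuasiHopfAlgebra.u * ↑v⁻¹) =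
    TensorProduct.map S S (flip K A toQuasiHopfAlgebra.drinfeldTwist) *
      ((toQuasiTriangularQuasiHopfAlgebra.u * ↑v⁻¹) ⊗ₜ[K]
        (toQuasiTriangularQuasiHopfAlgebra.u * ↑v⁻¹))

/-! ### Tensor powers and iterated co-products -/

section Powers

variable (K : Type v) [Field K] (A : Type u) [Ring A] [Algebra K A]

/-- The algebra `A^{⊗(n+1)}`, bracketed to the left. -/
def algPow : ℕ → AlgCat.{u} K
  | 0 => AlgCat.of K A
  | n + 1 => AlgCat.of K (algPow n ⊗[K] A)

/-- The space `V^{⊗(n+1)}`, bracketed to the left. -/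
def modPow (V : Type w) [AddCommGroup V] [Module K V] : ℕ → ModuleCat.{w} K
  | 0 => ModuleCat.of K V
  | n + 1 => ModuleCat.of K (modPow V n ⊗[K] V)

variable {K A}

/-- `Δ_L : A^{⊗(n+1)} → A^{⊗(n+2)}`, `a ⊗ b ⊗ ⋯ ⊗ c ↦ Δ(a) ⊗ b ⊗ ⋯ ⊗ c`. -/
def comulL (Δ : A →ₐ[K] A ⊗[K] A) : (n : ℕ) → (algPow K A n →ₐ[K] algPow K A (n + 1))
  | 0 => Δ
  | n + 1 => Algebra.TensorProduct.map (comulL Δ n) (AlgHom.id K A)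

/-- The iterated co-product `Δ^{(n)} = Δ_L ∘ Δ^{(n-1)} : A → A^{⊗(n+1)}`, `Δ^{(0)} = id`. -/
def iterComul (Δ : A →ₐ[K] A ⊗[K] A) : (n : ℕ) → (A →ₐ[K] algPow K A n)
  | 0 => AlgHom.id K A
  | n + 1 => (comulL Δ n).comp (iterComul Δ n)

variable (K A) (V : Type w) [AddCommGroup V] [Module K V] [Module A V] [IsScalarTower K A V]

/-- The representation `π : A → End V`. -/
def rep : A →ₐ[K] Module.End K V := Algebra.lsmul K K V

/-- The representation `π^{⊗(n+1)}` of `A^{⊗(n+1)}` on `V^{⊗(n+1)}`. -/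
def repPow : (n : ℕ) → (algPow K A n →ₐ[K] Module.End K (modPow K V n))
  | 0 => rep K A V
  | n + 1 => (Module.endTensorEndAlgHom (R := K) (S := K) (A := K)
      (M := modPow K V n) (N := V)).comp (Algebra.TensorProduct.map (repPow n) (rep K A V))

end Powers

/-! ### Braid generators -/

section Braids

variable {K : Type v} [Field K] {A : Type u} [Ring A] [Algebra K A]
  (H : QuasiTriangularQuasiHopfAlgebra K A)
  (V : Type w) [AddCommGroup V] [Module K V] [Module A V] [IsScalarTower K A V]

/-- `Ř = P (π ⊗ π)(R)` on `V ⊗ V`. -/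
def checkR : (Module.End K (V ⊗[K] V))ˣ :=
  LinearMap.GeneralLinearGroup.ofLinearEquiv (TensorProduct.comm K V V) *
    Units.map ((Module.endTensorEndAlgHom (R := K) (S := K) (A := K) (M := V) (N := V)).comp
      (Algebra.TensorProduct.map (rep K A V) (rep K A V))).toMonoidHom H.R

/-- `1 ⊗ Ř`, acting on the last two factors of `V^{⊗(k+3)} = (V^{⊗(k+1)} ⊗ V) ⊗ V`. -/
def checkRLast (k : ℕ) : (Module.End K (modPow K V (k + 2)))ˣ :=
  Units.map
    (((TensorProduct.assoc K (modPow K V k) V V).symm.conjAlgEquiv K).toAlgHom.comp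
      (Module.End.lTensorAlgHom K (V ⊗[K] V) (modPow K V k))).toMonoidHom (checkR H V)

/-- The operator `Φ_{k+2} = (Δ^{(k)} ⊗ 1 ⊗ 1)Φ` on `V^{⊗(k+3)}`. -/
def PhiOp (k : ℕ) : (Module.End K (modPow K V (k + 2)))ˣ :=
  Units.map ((repPow K A V (k + 2)).comp
    (show (A ⊗[K] A) ⊗[K] A →ₐ[K] algPow K A (k + 2) from
      Algebra.TensorProduct.map (Algebra.TensorProduct.map (iterComul H.Δ k) (AlgHom.id K A))
        (AlgHom.id K A))).toMonoidHom H.Φ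

/-- The braid generator acting on the last two factors of `V^{⊗(n+2)}`: `Ř` if there are only two
factors, and `Φ_i Ř_{i,i+1} Φ_i⁻¹` with `i = n + 1` otherwise. -/
def sigmaLast : (n : ℕ) → (Module.End K (modPow K V (n + 1)))ˣ
  | 0 => checkR H V
  | k + 1 => PhiOp H V k * checkRLast H V k * (PhiOp H V k)⁻¹

/-- The braid generators `σ_1, …, σ_n` on `V^{⊗(n+1)}`; `i : Fin n` stands for `σ_{i+1}`, which
is the generator on the last two of the first `i + 2` factors, extended by the identity. -/
def sigma : (n : ℕ) → Fin n → (Module.End K (modPow K V n))ˣ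
  | 0 => Fin.elim0
  | n + 1 => Fin.lastCases (sigmaLast H V n) fun i =>
      Units.map (Module.End.rTensorAlgHom K (modPow K V n) V).toMonoidHom (sigma n i)

end Braids

/-- Relators of the braid group with `n` generators. -/
def braidRels (n : ℕ) : Set (FreeGroup (Fin n)) :=
  {r | ∃ i j : Fin n, (i : ℕ) + 1 < j ∧
      r = .of i * .of j * (.of j * .of i)⁻¹} ∪
  {r | ∃ i j : Fin n, (i : ℕ) + 1 = j ∧
      r = .of i * .of j * .of i * (.of j * .of i * .of j)⁻¹}

/-- The braid group `B_n` with generators `σ_1, …, σ_n` (braids on `n + 1` strands). -/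
abbrev BraidGroup (n : ℕ) : Type := PresentedGroup (braidRels n)

/-- Words in `σ_1^{±1}, …, σ_n^{±1}`: the letter `(i, true)` is `σ_{i+1}` and `(i, false)` is its
inverse. -/
abbrev BraidWord (n : ℕ) : Type := List (Fin n × Bool)

/-- The inclusion of words given by `B_n ⊂ B_{n+1}`. -/
def BraidWord.incl {n : ℕ} (Ψ : BraidWord n) : BraidWord (n + 1) :=
  Ψ.map fun x => (x.1.castSucc, x.2)

/-- The exponent sum of a word. -/
def BraidWord.exponentSum {n : ℕ} (Ψ : BraidWord n) : ℤ :=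
  (Ψ.map fun x => if x.2 then (1 : ℤ) else -1).sum

section Trace

variable {K : Type v} [Field K] {A : Type u} [Ring A] [Algebra K A]
  (H : RibbonQuasiHopfAlgebra K A)
  (V : Type w) [AddCommGroup V] [Module K V] [Module A V] [IsScalarTower K A V]

/-- The operator on `V^{⊗(n+1)}` given by a word in the braid generators. -/
def wordOp {n : ℕ} (Ψ : BraidWord n) : (Module.End K (modPow K V n))ˣ :=
  FreeGroup.lift (sigma H.toQuasiTriangularQuasiHopfAlgebra V n) (FreeGroup.mk Ψ)

/-- `θ_n(Ψ) = tr (Ψ Δ^{(n)}(β S(α) u v⁻¹))` on `V^{⊗(n+1)}`. -/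
def theta {n : ℕ} (Ψ : BraidWord n) : K :=
  LinearMap.trace K (modPow K V n)
    ((wordOp H V Ψ : Module.End K (modPow K V n)) *
      repPow K A V n (iterComul H.Δ n (H.β * H.S H.α * H.u * ↑H.v⁻¹)))

/-- `s^n t^{e(Ψ)} θ_n(Ψ)`; here `s` and `t` stand for `(z⁺z⁻)^{1/2}` and `(z⁻/z⁺)^{1/2}`. -/
def linkPoly (s t : K) {n : ℕ} (Ψ : BraidWord n) : K :=
  s ^ n * t ^ Ψ.exponentSum * theta H V Ψ

end Trace

/-! ### Oriented link diagrams and their ambient isotopy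

A link diagram in generic position with respect to the height function is cut by horizontal lines
into slices, each of which holds one maximum, one minimum or one crossing between vertical strands.
A strand is recorded by its orientation, `true` for upwards. -/

/-- The pieces of diagrams. -/
inductive Piece : Type
  /-- a minimum; the left end has orientation `b` -/
  | cup (b : Bool)
  /-- a maximum; the left end has orientation `b` -/
  | cap (b : Bool)
  /-- a crossing of strands that are, at the bottom, `a` on the left and `b` on the right;
  `o = true` if the strand from bottom left to top right passes over -/
  | cross (a b o : Bool)

/-- Strands at the bottom of a piece, from left to right. -/
def Piece.src : Piece → List Bool
  | cup _ => []
  | cap b => [b, !b]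
  | cross a b _ => [a, b]

/-- Strands at the top of a piece, from left to right. -/
def Piece.tgt : Piece → List Bool
  | cup b => [b, !b]
  | cap _ => []
  | cross a b _ => [b, a]

/-- A slice: a piece with vertical strands to its left and to its right. -/
structure Slice : Type where
  left : List Bool
  piece : Piece
  right : List Bool

def Slice.src (x : Slice) : List Bool := x.left ++ x.piece.src ++ x.right

def Slice.tgt (x : Slice) : List Bool := x.left ++ x.piece.tgt ++ x.right

/-- `IsTangle p D q`: the slices `D`, from bottom to top, fit together to a diagram with strands
`p` at the bottom and `q` at the top. -/
def IsTangle : List Bool → List Slice → List Bool → Prop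
  | p, [], q => p = q
  | p, x :: D, q => p = x.src ∧ IsTangle x.tgt D q

/-- Oriented link diagrams. -/
def LinkDiagram : Type := {D : List Slice // IsTangle [] D []}

/-- The local moves: planar isotopies (`exchange`, `zigzag`, `slide`) and the Reidemeister moves,
for all orientations of the strands. Slices are listed from bottom to top. -/
inductive Move : List Slice → List Slice → Prop
  /-- changing the order of the heights of two pieces that are side by side -/
  | exchange (l m r : List Bool) (e f : Piece) :
      Move [⟨l, e, m ++ f.src ++ r⟩, ⟨l ++ e.tgt ++ m, f, r⟩]
        [⟨l ++ e.src ++ m, f, r⟩, ⟨l, e, m ++ f.tgt ++ r⟩]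
  /-- straightening a strand, in both directions -/
  | zigzag_left (l r : List Bool) (b : Bool) :
      Move [⟨l, .cup b, b :: r⟩, ⟨l ++ [b], .cap (!b), r⟩] []
  | zigzag_right (l r : List Bool) (b : Bool) :
      Move [⟨l ++ [b], .cup (!b), r⟩, ⟨l, .cap b, b :: r⟩] []
  /-- moving a strand that passes over or under a maximum from one side of it to the other -/
  | slide_cap (l r : List Bool) (x b o : Bool) :
      Move [⟨l ++ [b], .cross x (!b) o, r⟩, ⟨l, .cap b, x :: r⟩]
        [⟨l, .cross b x (!o), (!b) :: r⟩, ⟨l ++ [x], .cap b, r⟩]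
  /-- the same for a minimum -/
  | slide_cup (l r : List Bool) (x b o : Bool) :
      Move [⟨l, .cup b, x :: r⟩, ⟨l ++ [b], .cross (!b) x o, r⟩]
        [⟨l ++ [x], .cup b, r⟩, ⟨l, .cross x b (!o), (!b) :: r⟩]
  /-- first Reidemeister move, at a maximum and at a minimum -/
  | reidemeister1_cap (l r : List Bool) (b o : Bool) :
      Move [⟨l, .cross b (!b) o, r⟩, ⟨l, .cap (!b), r⟩] [⟨l, .cap b, r⟩]
  | reidemeister1_cup (l r : List Bool) (b o : Bool) :
      Move [⟨l, .cup b, r⟩, ⟨l, .cross b (!b) o, r⟩] [⟨l, .cup (!b), r⟩]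
  /-- second Reidemeister move -/
  | reidemeister2 (l r : List Bool) (a b o : Bool) :
      Move [⟨l, .cross a b o, r⟩, ⟨l, .cross b a (!o), r⟩] []
  /-- third Reidemeister move -/
  | reidemeister3 (l r : List Bool) (a b c o : Bool) :
      Move [⟨l, .cross a b o, c :: r⟩, ⟨l ++ [b], .cross a c o, r⟩, ⟨l, .cross b c o, a :: r⟩]
        [⟨l ++ [a], .cross b c o, r⟩, ⟨l, .cross a c o, b :: r⟩, ⟨l ++ [c], .cross a b o, r⟩]

/-- Two link diagrams differ by one local move. -/
def LinkDiagram.Step (D D' : LinkDiagram) : Prop :=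
  ∃ x a b y : List Slice, Move a b ∧ D.1 = x ++ a ++ y ∧ D'.1 = x ++ b ++ y

/-- Ambient isotopy of oriented link diagrams: the equivalence relation generated by planar
isotopy and the Reidemeister moves. -/
def LinkDiagram.AmbientIsotopic : LinkDiagram → LinkDiagram → Prop :=
  Relation.EqvGen LinkDiagram.Step

section Closure

open List in
/-- `k` nested minima, opening `k` upward strands followed by `k` downward strands. -/
def cups (k : ℕ) : List Slice :=
  (range k).map fun j => ⟨replicate j true, .cup true, replicate j false⟩

open List in
/-- `k` nested maxima, closing `k` upward strands followed by `k` downward strands. -/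
def caps (k : ℕ) : List Slice :=
  ((range k).map fun j => ⟨replicate j true, .cap true, replicate j false⟩).reverse

open List in
/-- The crossing for a letter of a braid word with `n + 1` upward strands, to the right of which
there are `n + 1` downward strands. -/
def letterSlice {n : ℕ} (x : Fin n × Bool) : Slice :=
  ⟨replicate x.1 true, .cross true true x.2,
    replicate (n - 1 - x.1) true ++ replicate (n + 1) false⟩

theorem IsTangle.append {p q r : List Bool} {D E : List Slice} (hD : IsTangle p D q)
    (hE : IsTangle q E r) : IsTangle p (D ++ E) r := by
  induction D generalizing p with
  | nil => cases hD; exact hE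
  | cons x D ih => exact ⟨hD.1, ih hD.2⟩

open List in
theorem isTangle_cups (k : ℕ) :
    IsTangle [] (cups k) (replicate k true ++ replicate k false) := by
  induction k with
  | zero => rfl
  | succ k ih =>
    have h : cups (k + 1) =
        cups k ++ [⟨replicate k true, .cup true, replicate k false⟩] := by
      simp [cups, range_succ]
    rw [h]
    refine ih.append ⟨by simp [Slice.src, Piece.src], ?_⟩
    simp [IsTangle, Slice.tgt, Piece.tgt, replicate_succ' (a := true), replicate_succ (a := false)]

open List in
theorem isTangle_caps (k : ℕ) :
    IsTangle (replicate k true ++ replicate k false) (caps k) [] := by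
  induction k with
  | zero => rfl
  | succ k ih =>
    have h : caps (k + 1) =
        ⟨replicate k true, .cap true, replicate k false⟩ :: caps k := by
      simp [caps, range_succ]
    rw [h]
    refine ⟨?_, by simpa [Slice.tgt, Piece.tgt] using ih⟩
    simp [Slice.src, Piece.src, replicate_succ' (a := true), replicate_succ (a := false)]

open List in
theorem isTangle_letters {n : ℕ} (Ψ : BraidWord n) :
    IsTangle (replicate (n + 1) true ++ replicate (n + 1) false) (Ψ.map letterSlice)
      (replicate (n + 1) true ++ replicate (n + 1) false) := by
  induction Ψ with
  | nil => rfl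
  | cons x Ψ ih =>
    have h : (replicate (n + 1) true : List Bool) =
        replicate x.1 true ++ [true, true] ++ replicate (n - 1 - x.1) true := by
      have h2 : [true, true] = replicate 2 true := rfl
      have := x.1.isLt
      rw [h2, ← replicate_add, ← replicate_add]
      congr 1
      omega
    refine ⟨?_, ?_⟩
    · rw [h]; simp [letterSlice, Slice.src, Piece.src]
    · have h3 : (letterSlice x).tgt =
          replicate (n + 1) true ++ replicate (n + 1) false := by
        rw [h]; simp [letterSlice, Slice.tgt, Piece.tgt]
      rw [h3]; exact ih

/-- The closure of a braid word, as an oriented link diagram: all strands of the braid go upwards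
and are closed on the right. The product of braids is read from top to bottom, so that it
corresponds to the composition of operators. -/
def closure {n : ℕ} (Ψ : BraidWord n) : LinkDiagram :=
  ⟨cups (n + 1) ++ Ψ.reverse.map letterSlice ++ caps (n + 1),
    ((isTangle_cups _).append (isTangle_letters _)).append (isTangle_caps _)⟩

end Closure

end RibbonQuasi

end

/-! The theorem is an instance of the Reshetikhin–Turaev construction. The finite-dimensional
representations of `H` form a `K`-linear braided monoidal category `RepCat H` with duals. The
associator is the action of `Φ⁻¹` followed by the plain reassociation, the braiding is `R` followed
by the flip, and the evaluation `φ ⊗ x ↦ φ(α x)` and the coevaluation `∑ β eᵢ ⊗ eⁱ` satisfy the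
zigzag identities by the antipode axioms. If `V^{⊗(n+1)}` is read as the object `((1 ⊗ V) ⊗ V) ⊗ ⋯`,
then `σ_i` is the braiding of two neighbouring strands conjugated by an associator
(`transport_genAut`). The braid relations are therefore the Yang–Baxter equation and naturality
(`genAut_braid`, `genAut_comm`).

The elements `u` and `𝓕` are mates of pairings. The map `X → X**` that corresponds to the pairing
"braid, then evaluate" is the action of `u` (`lin_toBidual`), and the comparison map `V* ⊗ W* → (W ⊗
V)*` is the action of `𝓕` (`lin_dualTensor`). The axiom on `Δ(u v⁻¹)` thus says that the maps `X →
X**` given by `u v⁻¹` respect tensor products. Consequently the pairing `evRight` that closes a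
strand on the right does so too (`whiskerLeft_dualTensor_evRight`), and the quantum trace over `W ⊗
V` may be taken by closing `V` first (`qtr_tens`). This quantum trace is `tr(f β S(α) u v⁻¹)`
(`qtr_eq_trace`), so `θ_n` is the quantum trace of a braid (`theta_eq_qtr`).

The first Markov property is the cyclicity of the trace. For the second, closing only the last
strand of `σ_n` gives a scalar: the partial trace of the braiding against "braid, then evaluate" is
the identity, and `v⁻¹` contributes `z⁺`. For `σ_n⁻¹`, the identity `v² = u S(u)` exchanges the
braiding in the pairing for its inverse at the cost of `(z⁻)²`, which leaves `z⁺(z⁻)² = z⁻`, since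
`z⁺z⁻ = 1`.

The link invariant is constructed on all sliced diagrams, not only on closed braids. Each slice
gives a morphism, and each local move is an identity of morphisms (`op_eq_of_ambientIsotopic`). Here
`s² = z⁺z⁻ = 1`, and a crossing is weighted by `s z⁻` or its inverse according to its sign, which
removes the scalars produced by curls. On a closed braid the construction is an iterated partial
trace (`op_closure`), hence `θ_n` up to the stated normalisation. -/

noncomputable section

namespace RibbonQuasi

open CategoryTheory MonoidalCategory

universe u v w

/-! ### Exterior tensor products of representations -/

section TensRep

variable {K : Type*} [Field K]
  {B B' C C' D D' : Type*} [Ring B] [Ring B'] [Ring C] [Ring C'] [Ring D] [Ring D']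
  [Algebra K B] [Algebra K B'] [Algebra K C] [Algebra K C'] [Algebra K D] [Algebra K D']
  {M M' N N' P : Type*} [AddCommGroup M] [AddCommGroup M'] [AddCommGroup N] [AddCommGroup N']
  [AddCommGroup P] [Module K M] [Module K M'] [Module K N] [Module K N'] [Module K P]

/-- The exterior tensor product of representations of `B` and `C`. -/
def tensRep (ρ : B →ₐ[K] Module.End K M) (σ : C →ₐ[K] Module.End K N) :
    B ⊗[K] C →ₐ[K] Module.End K (M ⊗[K] N) :=
  (Module.endTensorEndAlgHom (R := K) (S := K) (A := K) (M := M) (N := N)).comp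
    (Algebra.TensorProduct.map ρ σ)

@[simp]
theorem tensRep_tmul (ρ : B →ₐ[K] Module.End K M) (σ : C →ₐ[K] Module.End K N) (b : B) (c : C) :
    tensRep ρ σ (b ⊗ₜ c) = TensorProduct.map (ρ b) (σ c) := rfl

/-- The algebra maps `φ`, `ψ` are carried along so that one lemma covers intertwiners (where they
are identities) as well as maps that change the acting algebra, such as flips, reassociations,
counits and iterated co-products. -/
theorem map_tensRep {ρ : B →ₐ[K] Module.End K M} {σ : C →ₐ[K] Module.End K N}
    {ρ' : B' →ₐ[K] Module.End K M'} {σ' : C' →ₐ[K] Module.End K N'}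
    (f : M →ₗ[K] M') (g : N →ₗ[K] N') (φ : B →ₐ[K] B') (ψ : C →ₐ[K] C')
    (hf : ∀ b x, f (ρ b x) = ρ' (φ b) (f x)) (hg : ∀ c x, g (σ c x) = σ' (ψ c) (g x))
    (t : B ⊗[K] C) (x : M ⊗[K] N) :
    TensorProduct.map f g (tensRep ρ σ t x) =
      tensRep ρ' σ' (Algebra.TensorProduct.map φ ψ t) (TensorProduct.map f g x) := by
  induction t with
  | zero => simp
  | add s t hs ht => simp only [map_add, LinearMap.add_apply, hs, ht]
  | tmul b c =>
    induction x with
    | zero => simp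
    | add x y hx hy => simp only [map_add, hx, hy]
    | tmul m n => simp [hf, hg]

theorem tensRep_comp (ρ : B' →ₐ[K] Module.End K M) (σ : C' →ₐ[K] Module.End K N)
    (φ : B →ₐ[K] B') (ψ : C →ₐ[K] C') (t : B ⊗[K] C) :
    tensRep (ρ.comp φ) (σ.comp ψ) t = tensRep ρ σ (Algebra.TensorProduct.map φ ψ t) := by
  induction t with
  | zero => simp
  | add s t hs ht => simp only [map_add, hs, ht]
  | tmul b c => simp

theorem assoc_tensRep (ρ : B →ₐ[K] Module.End K M) (σ : C →ₐ[K] Module.End K N)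
    (τ : D →ₐ[K] Module.End K P) (t : (B ⊗[K] C) ⊗[K] D) (x : (M ⊗[K] N) ⊗[K] P) :
    TensorProduct.assoc K M N P (tensRep (tensRep ρ σ) τ t x) =
      tensRep ρ (tensRep σ τ) (Algebra.TensorProduct.assoc K K K B C D t)
        (TensorProduct.assoc K M N P x) := by
  induction t with
  | zero => simp
  | add s t hs ht => simp only [map_add, LinearMap.add_apply, hs, ht]
  | tmul b d =>
    induction b with
    | zero => simp
    | add s t hs ht => simp only [TensorProduct.add_tmul, map_add, LinearMap.add_apply, hs, ht]
    | tmul b c =>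
      induction x with
      | zero => simp
      | add x y hx hy => simp only [map_add, hx, hy]
      | tmul m p =>
        induction m with
        | zero => simp
        | add x y hx hy => simp only [TensorProduct.add_tmul, map_add, hx, hy]
        | tmul m n => simp

theorem assoc_symm_tensRep (ρ : B →ₐ[K] Module.End K M) (σ : C →ₐ[K] Module.End K N)
    (τ : D →ₐ[K] Module.End K P) (t : B ⊗[K] (C ⊗[K] D)) (x : M ⊗[K] (N ⊗[K] P)) :
    (TensorProduct.assoc K M N P).symm (tensRep ρ (tensRep σ τ) t x) =
      tensRep (tensRep ρ σ) τ (unassoc K B C D t) ((TensorProduct.assoc K M N P).symm x) := by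
  rw [LinearEquiv.symm_apply_eq, assoc_tensRep]
  simp [unassoc]

theorem comm_tensRep (ρ : B →ₐ[K] Module.End K M) (σ : C →ₐ[K] Module.End K N)
    (t : B ⊗[K] C) (x : M ⊗[K] N) :
    TensorProduct.comm K M N (tensRep ρ σ t x) =
      tensRep σ ρ (Algebra.TensorProduct.comm K B C t) (TensorProduct.comm K M N x) := by
  induction t with
  | zero => simp
  | add s t hs ht => simp only [map_add, LinearMap.add_apply, hs, ht]
  | tmul b c =>
    induction x with
    | zero => simp
    | add x y hx hy => simp only [map_add, hx, hy]
    | tmul m n => simp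

theorem lid_tensRep (ε : B →ₐ[K] K) (ρ : B →ₐ[K] Module.End K M) (t : B ⊗[K] B) (x : K ⊗[K] M) :
    TensorProduct.lid K M (tensRep ((Algebra.lsmul K K K).comp ε) ρ t x) =
      ρ (counitLeft ε t) (TensorProduct.lid K M x) := by
  induction t with
  | zero => simp
  | add s t hs ht => simp only [map_add, LinearMap.add_apply, hs, ht]
  | tmul b c =>
    induction x with
    | zero => simp
    | add x y hx hy => simp only [map_add, hx, hy]
    | tmul m n => simpa [counitLeft, mul_smul] using smul_comm _ _ _

theorem rid_tensRep (ε : B →ₐ[K] K) (ρ : B →ₐ[K] Module.End K M) (t : B ⊗[K] B) (x : M ⊗[K] K) :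
    TensorProduct.rid K M (tensRep ρ ((Algebra.lsmul K K K).comp ε) t x) =
      ρ (counitRight ε t) (TensorProduct.rid K M x) := by
  induction t with
  | zero => simp
  | add s t hs ht => simp only [map_add, LinearMap.add_apply, hs, ht]
  | tmul b c =>
    induction x with
    | zero => simp
    | add x y hx hy => simp only [map_add, hx, hy]
    | tmul m n => simpa [counitRight, mul_smul] using smul_comm _ _ _

end TensRep

/-! ### The category of finite-dimensional representations -/

section Category

variable {K : Type v} [Field K] {A : Type u} [Ring A] [Algebra K A]

/-- A finite-dimensional representation of the quasi-triangular quasi-Hopf algebra `H`. -/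
structure RepCat (H : QuasiTriangularQuasiHopfAlgebra K A) : Type (max u (v + 1)) where
  carrier : Type v
  [addCommGroup : AddCommGroup carrier]
  [module : Module K carrier]
  [finite : FiniteDimensional K carrier]
  ρ : A →ₐ[K] Module.End K carrier

variable {H : QuasiTriangularQuasiHopfAlgebra K A}

namespace RepCat

instance : CoeSort (RepCat H) (Type v) := ⟨RepCat.carrier⟩

attribute [instance] RepCat.addCommGroup RepCat.module RepCat.finite

/-- The intertwiners between two representations. -/
def intertwiners (X Y : RepCat H) : Submodule K (X →ₗ[K] Y) where
  carrier := {f | ∀ a x, f (X.ρ a x) = Y.ρ a (f x)}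
  add_mem' hf hg a x := by simp [hf a x, hg a x]
  zero_mem' a x := by simp
  smul_mem' c f hf a x := by simp [hf a x]

instance : Category (RepCat H) where
  Hom X Y := intertwiners X Y
  id X := ⟨LinearMap.id, fun _ _ => rfl⟩
  comp f g := ⟨g.1 ∘ₗ f.1, fun a x => by simp [f.2 a x, g.2 a]⟩

instance (X Y : RepCat H) : AddCommGroup (X ⟶ Y) := inferInstanceAs (AddCommGroup (intertwiners X Y))

instance (X Y : RepCat H) : Module K (X ⟶ Y) := inferInstanceAs (Module K (intertwiners X Y))

/-- The linear map underlying a morphism. -/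
def lin {X Y : RepCat H} (f : X ⟶ Y) : X →ₗ[K] Y := f.1

theorem lin_ρ {X Y : RepCat H} (f : X ⟶ Y) (a : A) (x : X) :
    lin f (X.ρ a x) = Y.ρ a (lin f x) := f.2 a x

/-- A morphism from an equivariant linear map. -/
def ofLin {X Y : RepCat H} (f : X →ₗ[K] Y) (hf : ∀ a x, f (X.ρ a x) = Y.ρ a (f x)) : X ⟶ Y :=
  ⟨f, hf⟩

@[simp] theorem lin_ofLin {X Y : RepCat H} (f : X →ₗ[K] Y)
    (hf : ∀ a x, f (X.ρ a x) = Y.ρ a (f x)) : lin (ofLin f hf) = f := rfl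

@[ext] theorem hom_ext {X Y : RepCat H} {f g : X ⟶ Y} (h : ∀ x, lin f x = lin g x) : f = g :=
  Subtype.ext (LinearMap.ext h)

@[simp] theorem lin_id (X : RepCat H) : lin (𝟙 X) = LinearMap.id := rfl

@[simp] theorem lin_comp {X Y Z : RepCat H} (f : X ⟶ Y) (g : Y ⟶ Z) :
    lin (f ≫ g) = lin g ∘ₗ lin f := rfl

@[simp] theorem lin_add {X Y : RepCat H} (f g : X ⟶ Y) : lin (f + g) = lin f + lin g := rfl

@[simp] theorem lin_zero {X Y : RepCat H} : lin (0 : X ⟶ Y) = 0 := rfl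

@[simp] theorem lin_smul {X Y : RepCat H} (c : K) (f : X ⟶ Y) : lin (c • f) = c • lin f := rfl

instance : Preadditive (RepCat H) where
  add_comp _ _ _ f g h := by ext x; simp
  comp_add _ _ _ f g h := by ext x; simp

instance : Linear K (RepCat H) where
  smul_comp _ _ _ c f g := by ext x; simp
  comp_smul _ _ _ f c g := by ext x; simp

/-- An isomorphism from an equivariant linear equivalence. -/
def mkIso {X Y : RepCat H} (e : X ≃ₗ[K] Y) (he : ∀ a x, e (X.ρ a x) = Y.ρ a (e x)) : X ≅ Y where
  hom := ofLin e.toLinearMap he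
  inv := ofLin e.symm.toLinearMap fun a y => by
    simp [LinearEquiv.symm_apply_eq, he]
  hom_inv_id := by ext x; simp
  inv_hom_id := by ext x; simp

@[simp] theorem lin_mkIso_hom {X Y : RepCat H} (e : X ≃ₗ[K] Y)
    (he : ∀ a x, e (X.ρ a x) = Y.ρ a (e x)) : lin (mkIso e he).hom = e.toLinearMap := rfl

@[simp] theorem lin_mkIso_inv {X Y : RepCat H} (e : X ≃ₗ[K] Y)
    (he : ∀ a x, e (X.ρ a x) = Y.ρ a (e x)) : lin (mkIso e he).inv = e.symm.toLinearMap := rfl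

/-- The underlying linear equivalence of an isomorphism. -/
def linEquiv {X Y : RepCat H} (i : X ≅ Y) : X ≃ₗ[K] Y :=
  LinearEquiv.ofLinearMap (lin i.hom) (lin i.inv) (by rw [← lin_comp, i.inv_hom_id, lin_id])
    (by rw [← lin_comp, i.hom_inv_id, lin_id])

/-- Invertible elements act by invertible operators. -/
def unitAct {B : Type*} [Ring B] [Algebra K B] {M : Type*} [AddCommGroup M] [Module K M]
    (ρ : B →ₐ[K] Module.End K M) (t : Bˣ) : M ≃ₗ[K] M :=
  LinearEquiv.ofLinearMap (ρ t) (ρ ↑t⁻¹)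
    (by rw [← Module.End.mul_eq_comp, ← map_mul, Units.mul_inv, map_one]; rfl)
    (by rw [← Module.End.mul_eq_comp, ← map_mul, Units.inv_mul, map_one]; rfl)

@[simp] theorem unitAct_apply {B : Type*} [Ring B] [Algebra K B] {M : Type*} [AddCommGroup M]
    [Module K M] (ρ : B →ₐ[K] Module.End K M) (t : Bˣ) (x : M) : unitAct ρ t x = ρ t x := rfl

@[simp] theorem unitAct_symm_apply {B : Type*} [Ring B] [Algebra K B] {M : Type*} [AddCommGroup M]
    [Module K M] (ρ : B →ₐ[K] Module.End K M) (t : Bˣ) (x : M) :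
    (unitAct ρ t).symm x = ρ ↑t⁻¹ x := rfl

/-- The tensor product of representations. -/
abbrev tens (X Y : RepCat H) : RepCat H where
  carrier := X ⊗[K] Y
  ρ := (tensRep X.ρ Y.ρ).comp H.Δ

theorem tens_ρ (X Y : RepCat H) (a : A) (x : X ⊗[K] Y) :
    (tens X Y).ρ a x = tensRep X.ρ Y.ρ (H.Δ a) x := rfl

/-- The trivial representation. -/
abbrev unitRep : RepCat H where
  carrier := K
  ρ := (Algebra.lsmul K K K).comp H.ε

@[simp] theorem unitRep_ρ (a : A) (x : K) : (unitRep (H := H)).ρ a x = H.ε a * x := rfl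

/-- The three-fold tensor product of representations, as a representation of `A ⊗ A ⊗ A`. -/
abbrev tensRep₃ (X Y Z : RepCat H) :
    (A ⊗[K] A) ⊗[K] A →ₐ[K] Module.End K ((X ⊗[K] Y) ⊗[K] Z) :=
  tensRep (tensRep X.ρ Y.ρ) Z.ρ

theorem tens_tens_ρ (X Y Z : RepCat H) (a : A) (x : (X ⊗[K] Y) ⊗[K] Z) :
    (tens (tens X Y) Z).ρ a x = tensRep₃ X Y Z (comul12 H.Δ (H.Δ a)) x := by
  change tensRep ((tensRep X.ρ Y.ρ).comp H.Δ) (Z.ρ.comp (AlgHom.id K A)) (H.Δ a) x = _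
  rw [tensRep_comp]; rfl

theorem assoc_symm_tens_ρ (X Y Z : RepCat H) (a : A) (x : X ⊗[K] (Y ⊗[K] Z)) :
    (TensorProduct.assoc K X Y Z).symm ((tens X (tens Y Z)).ρ a x) =
      tensRep₃ X Y Z (comul23 H.Δ (H.Δ a)) ((TensorProduct.assoc K X Y Z).symm x) := by
  change (TensorProduct.assoc K X Y Z).symm
    (tensRep (X.ρ.comp (AlgHom.id K A)) ((tensRep Y.ρ Z.ρ).comp H.Δ) (H.Δ a) x) = _
  rw [tensRep_comp, assoc_symm_tensRep]; rfl

/-- The associator, given by the inverse of the co-associator. -/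
def assocIso (X Y Z : RepCat H) : tens (tens X Y) Z ≅ tens X (tens Y Z) :=
  -- By `coassoc`, `Φ⁻¹` intertwines `(Δ ⊗ 1)Δ` with `(1 ⊗ Δ)Δ`, hence `Φ⁻¹` and not `Φ` precedes
  -- the plain reassociation.
  mkIso (((unitAct (tensRep₃ X Y Z) H.Φ).symm).trans (TensorProduct.assoc K X Y Z)) fun a x => by
    rw [LinearEquiv.trans_apply, ← LinearEquiv.eq_symm_apply, assoc_symm_tens_ρ]
    rw [tens_tens_ρ, LinearEquiv.trans_apply, LinearEquiv.symm_apply_apply, unitAct_symm_apply,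
      unitAct_symm_apply, ← Module.End.mul_apply, ← Module.End.mul_apply, ← map_mul, ← map_mul,
      H.coassoc, mul_assoc, Units.mul_inv, mul_one]

/-- The left unitor. -/
def lidIso (X : RepCat H) : tens unitRep X ≅ X :=
  mkIso (TensorProduct.lid K X) fun a x => by
    rw [tens_ρ]; exact (lid_tensRep H.ε X.ρ _ x).trans (by rw [H.counit_left])

/-- The right unitor. -/
def ridIso (X : RepCat H) : tens X unitRep ≅ X :=
  mkIso (TensorProduct.rid K X) fun a x => by
    rw [tens_ρ]; exact (rid_tensRep H.ε X.ρ _ x).trans (by rw [H.counit_right])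

/-- The tensor product of morphisms. -/
def tensHom {X X' Y Y' : RepCat H} (f : X ⟶ X') (g : Y ⟶ Y') : tens X Y ⟶ tens X' Y' :=
  ofLin (TensorProduct.map (lin f) (lin g)) fun a x => by
    rw [tens_ρ, tens_ρ]
    refine (map_tensRep (lin f) (lin g) (AlgHom.id K A) (AlgHom.id K A) (lin_ρ f) (lin_ρ g)
      (H.Δ a) x).trans ?_
    simp

instance : MonoidalCategoryStruct (RepCat H) where
  tensorObj := tens
  whiskerLeft X _ _ f := tensHom (𝟙 X) f
  whiskerRight f Y := tensHom f (𝟙 Y)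
  tensorHom f g := tensHom f g
  tensorUnit := unitRep
  associator := assocIso
  leftUnitor := lidIso
  rightUnitor := ridIso

theorem lin_whiskerLeft (X : RepCat H) {Y Y' : RepCat H} (f : Y ⟶ Y') :
    lin (X ◁ f) = TensorProduct.map LinearMap.id (lin f) := rfl

theorem lin_associator_hom (X Y Z : RepCat H) (x : (X ⊗[K] Y) ⊗[K] Z) :
    lin (α_ X Y Z).hom x = TensorProduct.assoc K X Y Z (tensRep₃ X Y Z ↑H.Φ⁻¹ x) := rfl

theorem lin_associator_inv (X Y Z : RepCat H) (x : X ⊗[K] (Y ⊗[K] Z)) :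
    lin (α_ X Y Z).inv x = tensRep₃ X Y Z ↑H.Φ ((TensorProduct.assoc K X Y Z).symm x) := rfl

end RepCat

end Category

end RibbonQuasi
end

/-! ### Monoidal structure: pentagon and triangle -/

noncomputable section

namespace RibbonQuasi

open CategoryTheory MonoidalCategory

universe u v w

namespace RepCat

section Monoidal

variable {K : Type v} [Field K] {A : Type u} [Ring A] [Algebra K A]
  {H : QuasiTriangularQuasiHopfAlgebra K A}

/-- The associator acts by `Φ⁻¹`, so the categorical pentagon needs the axiom inverted in the group
of units of `A^{⊗4}`. -/
theorem pentagon_inv (H : QuasiTriangularQuasiHopfAlgebra K A) :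
    leg234 K A ↑H.Φ⁻¹ * comul2_3 H.Δ ↑H.Φ⁻¹ * leg123 K A ↑H.Φ⁻¹ =
      comul3_3 H.Δ ↑H.Φ⁻¹ * comul1_3 H.Δ ↑H.Φ⁻¹ := by
  have h : Units.map (comul1_3 H.Δ).toMonoidHom H.Φ * Units.map (comul3_3 H.Δ).toMonoidHom H.Φ =
      Units.map (leg123 K A).toMonoidHom H.Φ * Units.map (comul2_3 H.Δ).toMonoidHom H.Φ *
        Units.map (leg234 K A).toMonoidHom H.Φ := Units.ext H.pentagon
  have h' := congrArg (fun t => ((t⁻¹ : Units _) : ((A ⊗[K] A) ⊗[K] A) ⊗[K] A)) h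
  simp only [mul_inv_rev, ← map_inv] at h'
  exact (mul_assoc _ _ _).trans h'.symm

theorem counitMiddle_inv (H : QuasiTriangularQuasiHopfAlgebra K A) :
    counitMiddle H.ε ↑H.Φ⁻¹ = 1 := by
  have h : Units.map (counitMiddle H.ε).toMonoidHom H.Φ = 1 := Units.ext H.counit_middle
  have h' := congrArg (fun t => ((t⁻¹ : Units _) : A ⊗[K] A)) h
  simp only [← map_inv, inv_one] at h'
  exact h'

section Plain

variable {M N P Q M' N' P' : Type*} [AddCommGroup M] [AddCommGroup N] [AddCommGroup P]
  [AddCommGroup Q] [AddCommGroup M'] [AddCommGroup N'] [AddCommGroup P']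
  [Module K M] [Module K N] [Module K P] [Module K Q] [Module K M'] [Module K N'] [Module K P']

theorem lid_map (f : M →ₗ[K] N) (x : K ⊗[K] M) :
    TensorProduct.lid K N (TensorProduct.map LinearMap.id f x) = f (TensorProduct.lid K M x) := by
  induction x with
  | zero => simp only [map_zero]
  | add x y hx hy => simp only [map_add, hx, hy]
  | tmul a x => simp

theorem rid_map (f : M →ₗ[K] N) (x : M ⊗[K] K) :
    TensorProduct.rid K N (TensorProduct.map f LinearMap.id x) = f (TensorProduct.rid K M x) := by
  induction x with
  | zero => simp only [map_zero]
  | add x y hx hy => simp only [map_add, hx, hy]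
  | tmul a x => simp

theorem assoc_map (f : M →ₗ[K] M') (g : N →ₗ[K] N') (h : P →ₗ[K] P') (x : (M ⊗[K] N) ⊗[K] P) :
    TensorProduct.map f (TensorProduct.map g h) (TensorProduct.assoc K M N P x) =
      TensorProduct.assoc K M' N' P' (TensorProduct.map (TensorProduct.map f g) h x) :=
  LinearMap.congr_fun (TensorProduct.map_map_comp_assoc_eq f g h) x

theorem assoc_triangle (x : (M ⊗[K] K) ⊗[K] N) :
    TensorProduct.map LinearMap.id (TensorProduct.lid K N).toLinearMap
      (TensorProduct.assoc K M K N x) =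
        TensorProduct.map (TensorProduct.rid K M).toLinearMap LinearMap.id x := by
  have h : TensorProduct.map LinearMap.id (TensorProduct.lid K N).toLinearMap ∘ₗ
      (TensorProduct.assoc K M K N).toLinearMap =
        TensorProduct.map (TensorProduct.rid K M).toLinearMap LinearMap.id := by
    apply TensorProduct.ext_threefold
    intro m c n
    simp [TensorProduct.smul_tmul]
  exact LinearMap.congr_fun h x

theorem map_map_tensRep {B C D : Type*} [Ring B] [Ring C] [Ring D] [Algebra K B] [Algebra K C]
    [Algebra K D] {ρ : B →ₐ[K] Module.End K M} {σ : C →ₐ[K] Module.End K N}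
    {τ : D →ₐ[K] Module.End K P} {ρ' : B →ₐ[K] Module.End K M'} {σ' : C →ₐ[K] Module.End K N'}
    {τ' : D →ₐ[K] Module.End K P'} (f : M →ₗ[K] M') (g : N →ₗ[K] N') (h : P →ₗ[K] P')
    (hf : ∀ b x, f (ρ b x) = ρ' b (f x)) (hg : ∀ c x, g (σ c x) = σ' c (g x))
    (hh : ∀ d x, h (τ d x) = τ' d (h x)) (t : (B ⊗[K] C) ⊗[K] D) (x : (M ⊗[K] N) ⊗[K] P) :
    TensorProduct.map (TensorProduct.map f g) h (tensRep (tensRep ρ σ) τ t x) =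
      tensRep (tensRep ρ' σ') τ' t (TensorProduct.map (TensorProduct.map f g) h x) := by
  rw [map_tensRep (ρ' := tensRep ρ' σ') (σ' := τ') (TensorProduct.map f g) h (AlgHom.id K _)
    (AlgHom.id K D) _ hh]
  · rw [Algebra.TensorProduct.map_id]; rfl
  · intro t x
    rw [map_tensRep (ρ' := ρ') (σ' := σ') f g (AlgHom.id K _) (AlgHom.id K _) hf hg,
      Algebra.TensorProduct.map_id]

/-- The plain five-fold reassociation identity. -/
theorem assoc_pentagon
    (x : ((M ⊗[K] N) ⊗[K] P) ⊗[K] Q) :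
    TensorProduct.map LinearMap.id (TensorProduct.assoc K N P Q).toLinearMap
      (TensorProduct.assoc K M (N ⊗[K] P) Q
        (TensorProduct.map (TensorProduct.assoc K M N P).toLinearMap LinearMap.id x)) =
    TensorProduct.assoc K M N (P ⊗[K] Q) (TensorProduct.assoc K (M ⊗[K] N) P Q x) := by
  have h : (TensorProduct.map LinearMap.id (TensorProduct.assoc K N P Q).toLinearMap) ∘ₗ
      (TensorProduct.assoc K M (N ⊗[K] P) Q).toLinearMap ∘ₗ
        (TensorProduct.map (TensorProduct.assoc K M N P).toLinearMap LinearMap.id) =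
    (TensorProduct.assoc K M N (P ⊗[K] Q)).toLinearMap ∘ₗ
      (TensorProduct.assoc K (M ⊗[K] N) P Q).toLinearMap := by
    apply TensorProduct.ext_fourfold
    intro m n p q
    rfl
  exact LinearMap.congr_fun h x

theorem tensor₃_induction {M N P : Type*} [AddCommGroup M] [AddCommGroup N]
    [AddCommGroup P] [Module K M] [Module K N] [Module K P]
    {p : (M ⊗[K] N) ⊗[K] P → Prop} (zero : p 0)
    (tmul : ∀ m n q, p ((m ⊗ₜ n) ⊗ₜ q)) (add : ∀ x y, p x → p y → p (x + y))
    (t : (M ⊗[K] N) ⊗[K] P) : p t := by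
  induction t with
  | zero => exact zero
  | add s t hs ht => exact add _ _ hs ht
  | tmul s q =>
    induction s with
    | zero => rw [TensorProduct.zero_tmul]; exact zero
    | add s t hs ht => rw [TensorProduct.add_tmul]; exact add _ _ hs ht
    | tmul m n => exact tmul m n q

end Plain

/-- The four-fold tensor product of representations. -/
abbrev tensRep₄ (W X Y Z : RepCat H) :
    ((A ⊗[K] A) ⊗[K] A) ⊗[K] A →ₐ[K] Module.End K (((W ⊗[K] X) ⊗[K] Y) ⊗[K] Z) :=
  tensRep (tensRep (tensRep W.ρ X.ρ) Y.ρ) Z.ρ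

variable (W X Y Z : RepCat H)

/-- This lemma and the four that follow bring each edge of the pentagon to a normal form in which an
element of `A^{⊗4}` acts first and the plain reassociations come last. The pentagon then splits into
`assoc_pentagon` for vector spaces and `pentagon_inv` for algebra elements. -/
theorem associator_whiskerRight_apply (x : ((W ⊗[K] X) ⊗[K] Y) ⊗[K] Z) :
    lin ((α_ W X Y).hom ▷ Z) x =
      TensorProduct.map (TensorProduct.assoc K W X Y).toLinearMap LinearMap.id
        (tensRep₄ W X Y Z (leg123 K A ↑H.Φ⁻¹) x) := by
  change TensorProduct.map ((TensorProduct.assoc K W X Y).toLinearMap ∘ₗ tensRep₃ W X Y ↑H.Φ⁻¹)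
    (LinearMap.id ∘ₗ LinearMap.id) x = TensorProduct.map _ _
      (TensorProduct.map (tensRep₃ W X Y ↑H.Φ⁻¹) (Z.ρ 1) x)
  rw [TensorProduct.map_comp, map_one]
  rfl

theorem associator_middle_apply (x : ((W ⊗[K] X) ⊗[K] Y) ⊗[K] Z) :
    lin (α_ W (X ⊗ Y) Z).hom
      (TensorProduct.map (TensorProduct.assoc K W X Y).toLinearMap LinearMap.id x) =
      TensorProduct.assoc K W (X ⊗[K] Y) Z
        (TensorProduct.map (TensorProduct.assoc K W X Y).toLinearMap LinearMap.id
          (tensRep₄ W X Y Z (comul2_3 H.Δ ↑H.Φ⁻¹) x)) := by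
  rw [lin_associator_hom, map_tensRep (ρ' := tensRep W.ρ (tensRep X.ρ Y.ρ)) (σ' := Z.ρ)
    (TensorProduct.assoc K W X Y).toLinearMap LinearMap.id
    (Algebra.TensorProduct.assoc K K K A A A).toAlgHom (AlgHom.id K A)
    (assoc_tensRep W.ρ X.ρ Y.ρ) (fun _ _ => rfl)]
  congr 2
  generalize (↑H.Φ⁻¹ : (A ⊗[K] A) ⊗[K] A) = t
  change tensRep (tensRep W.ρ ((tensRep X.ρ Y.ρ).comp H.Δ)) Z.ρ t = _
  induction t using tensor₃_induction with
  | zero => simp only [map_zero]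
  | add s t hs ht => simp only [map_add, hs, ht]
  | tmul a b c => simp [comul2_3, comul23, unassoc]

theorem whiskerLeft_associator_apply (x : ((W ⊗[K] X) ⊗[K] Y) ⊗[K] Z) :
    lin (W ◁ (α_ X Y Z).hom) (TensorProduct.assoc K W (X ⊗[K] Y) Z
        (TensorProduct.map (TensorProduct.assoc K W X Y).toLinearMap LinearMap.id x)) =
      TensorProduct.map LinearMap.id (TensorProduct.assoc K X Y Z).toLinearMap
       (TensorProduct.assoc K W (X ⊗[K] Y) Z
        (TensorProduct.map (TensorProduct.assoc K W X Y).toLinearMap LinearMap.id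
          (tensRep₄ W X Y Z (leg234 K A ↑H.Φ⁻¹) x))) := by
  rw [lin_whiskerLeft, map_tensRep (ρ' := tensRep W.ρ (tensRep X.ρ Y.ρ)) (σ' := Z.ρ)
    (TensorProduct.assoc K W X Y).toLinearMap LinearMap.id
    (Algebra.TensorProduct.assoc K K K A A A).toAlgHom (AlgHom.id K A)
    (assoc_tensRep W.ρ X.ρ Y.ρ) (fun _ _ => rfl), assoc_tensRep]
  have h : ∀ t : (A ⊗[K] A) ⊗[K] A, Algebra.TensorProduct.assoc K K K A (A ⊗[K] A) A
      (Algebra.TensorProduct.map (Algebra.TensorProduct.assoc K K K A A A).toAlgHom (AlgHom.id K A)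
        (leg234 K A t)) = 1 ⊗ₜ t := by
    intro t
    induction t using tensor₃_induction with
    | zero => simp only [map_zero, TensorProduct.tmul_zero]
    | add s t hs ht => simp only [map_add, hs, ht, TensorProduct.tmul_add]
    | tmul a b c => simp [leg234, leg23]
  rw [h, tensRep_tmul, map_one, ← LinearMap.comp_apply, Module.End.one_eq_id,
    ← TensorProduct.map_comp]
  rfl

theorem associator_left_apply (x : ((W ⊗[K] X) ⊗[K] Y) ⊗[K] Z) :
    lin (α_ (W ⊗ X) Y Z).hom x = TensorProduct.assoc K (W ⊗[K] X) Y Z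
      (tensRep₄ W X Y Z (comul1_3 H.Δ ↑H.Φ⁻¹) x) := by
  rw [lin_associator_hom]
  congr 2
  generalize (↑H.Φ⁻¹ : (A ⊗[K] A) ⊗[K] A) = t
  change tensRep (tensRep ((tensRep W.ρ X.ρ).comp H.Δ) Y.ρ) Z.ρ t = _
  induction t using tensor₃_induction with
  | zero => simp only [map_zero]
  | add s t hs ht => simp only [map_add, hs, ht]
  | tmul a b c => simp [comul1_3, comul12]

theorem associator_right_apply (x : ((W ⊗[K] X) ⊗[K] Y) ⊗[K] Z) :
    lin (α_ W X (Y ⊗ Z)).hom (TensorProduct.assoc K (W ⊗[K] X) Y Z x) =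
      TensorProduct.assoc K W X (Y ⊗[K] Z) (TensorProduct.assoc K (W ⊗[K] X) Y Z
        (tensRep₄ W X Y Z (comul3_3 H.Δ ↑H.Φ⁻¹) x)) := by
  rw [lin_associator_hom, assoc_tensRep (tensRep W.ρ X.ρ) Y.ρ Z.ρ]
  refine congrArg (TensorProduct.assoc K W.carrier X.carrier (Y.carrier ⊗[K] Z.carrier)) ?_
  change tensRep ((tensRep W.ρ X.ρ).comp (AlgHom.id K _)) ((tensRep Y.ρ Z.ρ).comp H.Δ) _ _ = _
  rw [tensRep_comp]
  congr 2
  simp [comul3_3, unassoc]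

instance : MonoidalCategory (RepCat H) where
  tensorHom_def f g := by
    ext x
    exact LinearMap.congr_fun (TensorProduct.map_comp LinearMap.id (lin g) (lin f) LinearMap.id) x
  id_tensorHom_id X Y := by
    ext x; exact LinearMap.congr_fun (TensorProduct.map_id (R := K) (M := X) (N := Y)) x
  tensorHom_comp_tensorHom f₁ f₂ g₁ g₂ := by
    ext x
    exact (LinearMap.congr_fun (TensorProduct.map_comp (lin g₁) (lin g₂) (lin f₁) (lin f₂)) x).symm
  whiskerLeft_id X Y := by
    ext x; exact LinearMap.congr_fun (TensorProduct.map_id (R := K) (M := X) (N := Y)) x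
  id_whiskerRight X Y := by
    ext x; exact LinearMap.congr_fun (TensorProduct.map_id (R := K) (M := X) (N := Y)) x
  associator_naturality {X₁ X₂ X₃ Y₁ Y₂ Y₃} f₁ f₂ f₃ := by
    ext x
    change TensorProduct.assoc K Y₁ Y₂ Y₃ (tensRep₃ Y₁ Y₂ Y₃ ↑H.Φ⁻¹
        (TensorProduct.map (TensorProduct.map (lin f₁) (lin f₂)) (lin f₃) x)) =
      TensorProduct.map (lin f₁) (TensorProduct.map (lin f₂) (lin f₃))
        (TensorProduct.assoc K X₁ X₂ X₃ (tensRep₃ X₁ X₂ X₃ ↑H.Φ⁻¹ x))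
    rw [assoc_map, map_map_tensRep (lin f₁) (lin f₂) (lin f₃) (lin_ρ f₁) (lin_ρ f₂) (lin_ρ f₃)]
  leftUnitor_naturality {X Y} f := by
    ext x
    change TensorProduct.lid K Y (TensorProduct.map LinearMap.id (lin f) x) =
      lin f (TensorProduct.lid K X x)
    exact lid_map (lin f) x
  rightUnitor_naturality {X Y} f := by
    ext x
    change TensorProduct.rid K Y (TensorProduct.map (lin f) LinearMap.id x) =
      lin f (TensorProduct.rid K X x)
    exact rid_map (lin f) x
  pentagon W X Y Z := by
    ext x
    change lin (W ◁ (α_ X Y Z).hom) (lin (α_ W (tensorObj X Y) Z).hom (lin ((α_ W X Y).hom ▷ Z) x)) =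
      lin (α_ W X (tensorObj Y Z)).hom (lin (α_ (tensorObj W X) Y Z).hom x)
    rw [associator_left_apply, associator_right_apply, associator_whiskerRight_apply,
      associator_middle_apply, whiskerLeft_associator_apply, assoc_pentagon,
      ← Module.End.mul_apply, ← Module.End.mul_apply, ← map_mul, ← map_mul,
      ← Module.End.mul_apply, ← map_mul, pentagon_inv]
  triangle X Y := by
    ext x
    change TensorProduct.map LinearMap.id (TensorProduct.lid K Y).toLinearMap
      (TensorProduct.assoc K X K Y (tensRep₃ X unitRep Y ↑H.Φ⁻¹ x)) =
        TensorProduct.map (TensorProduct.rid K X).toLinearMap LinearMap.id x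
    rw [assoc_triangle, map_tensRep (ρ' := X.ρ) (σ' := Y.ρ) (TensorProduct.rid K X).toLinearMap
      LinearMap.id (counitRight H.ε) (AlgHom.id K A) (rid_tensRep H.ε X.ρ) (fun _ _ => rfl)]
    change tensRep X.ρ Y.ρ (counitMiddle H.ε ↑H.Φ⁻¹) _ = _
    rw [counitMiddle_inv, map_one, Module.End.one_apply]

end Monoidal

end RepCat

end RibbonQuasi
end

/-! ### Linear structure and braiding: the hexagons -/

noncomputable section

namespace RibbonQuasi

open CategoryTheory MonoidalCategory

universe u v w

namespace RepCat

section Braided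

variable {K : Type v} [Field K] {A : Type u} [Ring A] [Algebra K A]
  {H : QuasiTriangularQuasiHopfAlgebra K A}

instance : MonoidalPreadditive (RepCat H) where
  whiskerLeft_zero {X Y Z} := by
    ext x; exact LinearMap.congr_fun (TensorProduct.map_zero_right (LinearMap.id : X.carrier →ₗ[K] _)) x
  zero_whiskerRight {X Y Z} := by
    ext x; exact LinearMap.congr_fun (TensorProduct.map_zero_left (LinearMap.id : X.carrier →ₗ[K] _)) x
  whiskerLeft_add {X Y Z} f g := by
    ext x
    exact LinearMap.congr_fun (TensorProduct.map_add_right LinearMap.id (lin f) (lin g)) x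
  add_whiskerRight {X Y Z} f g := by
    ext x
    exact LinearMap.congr_fun (TensorProduct.map_add_left (lin f) (lin g) LinearMap.id) x

instance : MonoidalLinear K (RepCat H) where
  whiskerLeft_smul X {Y Z} r f := by
    ext x
    exact LinearMap.congr_fun (TensorProduct.map_smul_right r LinearMap.id (lin f)) x
  smul_whiskerRight r {Y Z} f X := by
    ext x
    exact LinearMap.congr_fun (TensorProduct.map_smul_left r (lin f) LinearMap.id) x

/-- The braiding, given by the R-matrix followed by the flip. -/
def braidIso (X Y : RepCat H) : tens X Y ≅ tens Y X :=
  mkIso ((unitAct (tensRep X.ρ Y.ρ) H.R).trans (TensorProduct.comm K X.carrier Y.carrier))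
    fun a x => by
      rw [LinearEquiv.trans_apply, LinearEquiv.trans_apply, unitAct_apply, unitAct_apply, tens_ρ,
        ← Module.End.mul_apply, ← map_mul, ← H.R_comul, map_mul, Module.End.mul_apply,
        comm_tensRep]
      refine congrArg (fun t => tensRep Y.ρ X.ρ t _) ?_
      exact (Algebra.TensorProduct.comm K A A).right_inv _

theorem braidIso_hom_apply (X Y : RepCat H) (x : X.carrier ⊗[K] Y.carrier) :
    lin (braidIso X Y).hom x = TensorProduct.comm K X.carrier Y.carrier (tensRep X.ρ Y.ρ ↑H.R x) :=
  rfl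

variable (X Y Z : RepCat H)

theorem braid_tens_right_apply (x : (X.carrier ⊗[K] Y.carrier) ⊗[K] Z.carrier) :
    lin (braidIso X (tens Y Z)).hom (TensorProduct.assoc K X.carrier Y.carrier Z.carrier x) =
      TensorProduct.comm K X.carrier (Y.carrier ⊗[K] Z.carrier)
        (TensorProduct.assoc K X.carrier Y.carrier Z.carrier
          (tensRep₃ X Y Z (comul23 H.Δ ↑H.R) x)) := by
  rw [braidIso_hom_apply, assoc_tensRep]
  change TensorProduct.comm K X.carrier (Y.carrier ⊗[K] Z.carrier)
    (tensRep (X.ρ.comp (AlgHom.id K A)) ((tensRep Y.ρ Z.ρ).comp H.Δ) _ _) = _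
  rw [tensRep_comp]
  congr 3
  simp [comul23, unassoc]

theorem braid_tens_left_apply (x : (X.carrier ⊗[K] Y.carrier) ⊗[K] Z.carrier) :
    lin (braidIso (tens X Y) Z).hom x =
      TensorProduct.comm K (X.carrier ⊗[K] Y.carrier) Z.carrier
          (tensRep₃ X Y Z (comul12 H.Δ ↑H.R) x) := by
  rw [braidIso_hom_apply]
  change TensorProduct.comm K (X.carrier ⊗[K] Y.carrier) Z.carrier
    (tensRep ((tensRep X.ρ Y.ρ).comp H.Δ) (Z.ρ.comp (AlgHom.id K A)) _ _) = _
  rw [tensRep_comp]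
  rfl

/-- Moving an element of `A^{⊗3}` past a permutation of the tensor factors permutes its legs. This
and the next three lemmas produce the permuted co-associators that occur in the axioms for `R`. -/
theorem comm_assoc_tensRep₃ (t : (A ⊗[K] A) ⊗[K] A)
    (x : (X.carrier ⊗[K] Y.carrier) ⊗[K] Z.carrier) :
    tensRep₃ Y Z X t (TensorProduct.comm K X.carrier (Y.carrier ⊗[K] Z.carrier)
        (TensorProduct.assoc K X.carrier Y.carrier Z.carrier x)) =
      TensorProduct.comm K X.carrier (Y.carrier ⊗[K] Z.carrier)
        (TensorProduct.assoc K X.carrier Y.carrier Z.carrier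
          (tensRep₃ X Y Z (T12 K A (T23 K A t)) x)) := by
  rw [assoc_tensRep, comm_tensRep]
  congr 2
  induction t using tensor₃_induction with
  | zero => simp only [map_zero]
  | add s t hs ht => simp only [map_add, ← hs, ← ht]
  | tmul a b c => simp [T12, T23, unassoc, flip]

theorem assoc_symm_comm_tensRep₃ (t : (A ⊗[K] A) ⊗[K] A)
    (x : (X.carrier ⊗[K] Y.carrier) ⊗[K] Z.carrier) :
    tensRep₃ Z X Y t ((TensorProduct.assoc K Z.carrier X.carrier Y.carrier).symm
        (TensorProduct.comm K (X.carrier ⊗[K] Y.carrier) Z.carrier x)) =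
      (TensorProduct.assoc K Z.carrier X.carrier Y.carrier).symm
        (TensorProduct.comm K (X.carrier ⊗[K] Y.carrier) Z.carrier
          (tensRep₃ X Y Z (T23 K A (T12 K A t)) x)) := by
  rw [comm_tensRep, assoc_symm_tensRep]
  congr 2
  induction t using tensor₃_induction with
  | zero => simp only [map_zero]
  | add s t hs ht => simp only [map_add, ← hs, ← ht]
  | tmul a b c => simp [T12, T23, unassoc, flip]

theorem comm_left_tensRep₃ (t : (A ⊗[K] A) ⊗[K] A)
    (x : (X.carrier ⊗[K] Y.carrier) ⊗[K] Z.carrier) :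
    tensRep₃ Y X Z t (TensorProduct.map (TensorProduct.comm K X.carrier Y.carrier).toLinearMap
      LinearMap.id x) =
      TensorProduct.map (TensorProduct.comm K X.carrier Y.carrier).toLinearMap LinearMap.id
          (tensRep₃ X Y Z (T12 K A t) x) := by
  rw [map_tensRep (ρ' := tensRep Y.ρ X.ρ) (σ' := Z.ρ)
    (TensorProduct.comm K X.carrier Y.carrier).toLinearMap LinearMap.id
    (Algebra.TensorProduct.comm K A A).toAlgHom (AlgHom.id K A)
    (comm_tensRep X.ρ Y.ρ) (fun _ _ => rfl)]
  congr 2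
  induction t using tensor₃_induction with
  | zero => simp only [map_zero]
  | add s t hs ht => simp only [map_add, ← hs, ← ht]
  | tmul a b c => simp [T12, flip]

theorem comm_right_tensRep₃ (t : (A ⊗[K] A) ⊗[K] A)
    (x : (X.carrier ⊗[K] Y.carrier) ⊗[K] Z.carrier) :
    tensRep₃ X Z Y t ((TensorProduct.assoc K X.carrier Z.carrier Y.carrier).symm
      (TensorProduct.map LinearMap.id (TensorProduct.comm K Y.carrier Z.carrier).toLinearMap
        (TensorProduct.assoc K X.carrier Y.carrier Z.carrier x))) =
      (TensorProduct.assoc K X.carrier Z.carrier Y.carrier).symm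
      (TensorProduct.map LinearMap.id (TensorProduct.comm K Y.carrier Z.carrier).toLinearMap
        (TensorProduct.assoc K X.carrier Y.carrier Z.carrier
          (tensRep₃ X Y Z (T23 K A t) x))) := by
  rw [assoc_tensRep, map_tensRep (ρ' := X.ρ) (σ' := tensRep Z.ρ Y.ρ) LinearMap.id
    (TensorProduct.comm K Y.carrier Z.carrier).toLinearMap (AlgHom.id K A)
    (Algebra.TensorProduct.comm K A A).toAlgHom (fun _ _ => rfl)
    (comm_tensRep Y.ρ Z.ρ), assoc_symm_tensRep]
  congr 2
  induction t using tensor₃_induction with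
  | zero => simp only [map_zero]
  | add s t hs ht => simp only [map_add, ← hs, ← ht]
  | tmul a b c => simp [T23, unassoc, flip]

theorem braid_whiskerRight_apply (x : (X.carrier ⊗[K] Y.carrier) ⊗[K] Z.carrier) :
    lin ((braidIso X Y).hom ▷ Z) x =
      TensorProduct.map (TensorProduct.comm K X.carrier Y.carrier).toLinearMap LinearMap.id
        (tensRep₃ X Y Z (leg12 K A ↑H.R) x) := by
  change TensorProduct.map ((TensorProduct.comm K X.carrier Y.carrier).toLinearMap ∘ₗ
    tensRep X.ρ Y.ρ ↑H.R) (LinearMap.id ∘ₗ LinearMap.id) x = TensorProduct.map _ _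
      (TensorProduct.map (tensRep X.ρ Y.ρ ↑H.R) (Z.ρ 1) x)
  rw [TensorProduct.map_comp, map_one]
  rfl

theorem braid_whiskerLeft_apply (x : (X.carrier ⊗[K] Y.carrier) ⊗[K] Z.carrier) :
    lin (X ◁ (braidIso Y Z).hom) (TensorProduct.assoc K X.carrier Y.carrier Z.carrier x) =
      TensorProduct.map LinearMap.id (TensorProduct.comm K Y.carrier Z.carrier).toLinearMap
        (TensorProduct.assoc K X.carrier Y.carrier Z.carrier
          (tensRep₃ X Y Z (leg23 K A ↑H.R) x)) := by
  rw [assoc_tensRep]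
  have h : ∀ t : A ⊗[K] A, Algebra.TensorProduct.assoc K K K A A A (leg23 K A t) = 1 ⊗ₜ t := by
    intro t
    induction t with
    | zero => simp only [map_zero, TensorProduct.tmul_zero]
    | add s t hs ht => simp only [map_add, hs, ht, TensorProduct.tmul_add]
    | tmul a b => simp [leg23]
  rw [h, tensRep_tmul, map_one, ← LinearMap.comp_apply, Module.End.one_eq_id,
    ← TensorProduct.map_comp]
  rfl

theorem T12_leg23 (t : A ⊗[K] A) : T12 K A (leg23 K A t) = leg13 K A t := by
  induction t with
  | zero => simp only [map_zero]
  | add s t hs ht => simp only [map_add, hs, ht]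
  | tmul a b => simp [leg23, leg13, T12, flip]

theorem T23_leg12 (t : A ⊗[K] A) : T23 K A (leg12 K A t) = leg13 K A t := by
  induction t with
  | zero => simp only [map_zero]
  | add s t hs ht => simp only [map_add, hs, ht]
  | tmul a b => simp [leg12, leg13, T23, flip, unassoc]

theorem comm_hexagon {M N P : Type*} [AddCommGroup M] [AddCommGroup N] [AddCommGroup P]
    [Module K M] [Module K N] [Module K P] (x : (M ⊗[K] N) ⊗[K] P) :
    TensorProduct.map LinearMap.id (TensorProduct.comm K M P).toLinearMap
      (TensorProduct.assoc K N M P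
        (TensorProduct.map (TensorProduct.comm K M N).toLinearMap LinearMap.id x)) =
    TensorProduct.assoc K N P M (TensorProduct.comm K M (N ⊗[K] P)
      (TensorProduct.assoc K M N P x)) := by
  induction x using tensor₃_induction with
  | zero => simp only [map_zero]
  | add s t hs ht => simp only [map_add, hs, ht]
  | tmul a b c => simp

theorem comm_hexagon_symm {M N P : Type*} [AddCommGroup M] [AddCommGroup N] [AddCommGroup P]
    [Module K M] [Module K N] [Module K P] (x : (M ⊗[K] N) ⊗[K] P) :
    TensorProduct.map (TensorProduct.comm K M P).toLinearMap LinearMap.id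
      ((TensorProduct.assoc K M P N).symm
        (TensorProduct.map LinearMap.id (TensorProduct.comm K N P).toLinearMap
          (TensorProduct.assoc K M N P x))) =
    (TensorProduct.assoc K P M N).symm (TensorProduct.comm K (M ⊗[K] N) P x) := by
  induction x using tensor₃_induction with
  | zero => simp only [map_zero]
  | add s t hs ht => simp only [map_add, hs, ht]
  | tmul a b c => simp

instance : BraidedCategory (RepCat H) where
  braiding := braidIso
  braiding_naturality_right X {Y Z} f := by
    ext x
    change TensorProduct.comm K X.carrier Z.carrier (tensRep X.ρ Z.ρ ↑H.R
      (TensorProduct.map LinearMap.id (lin f) x)) = TensorProduct.map (lin f) LinearMap.id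
        (TensorProduct.comm K X.carrier Y.carrier (tensRep X.ρ Y.ρ ↑H.R x))
    rw [TensorProduct.map_comm, map_tensRep (ρ' := X.ρ) (σ' := Z.ρ) LinearMap.id (lin f)
      (AlgHom.id K A) (AlgHom.id K A) (fun _ _ => rfl) (lin_ρ f), Algebra.TensorProduct.map_id]
    rfl
  braiding_naturality_left {X Y} f Z := by
    ext x
    change TensorProduct.comm K Y.carrier Z.carrier (tensRep Y.ρ Z.ρ ↑H.R
      (TensorProduct.map (lin f) LinearMap.id x)) = TensorProduct.map LinearMap.id (lin f)
        (TensorProduct.comm K X.carrier Z.carrier (tensRep X.ρ Z.ρ ↑H.R x))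
    rw [TensorProduct.map_comm, map_tensRep (ρ' := Y.ρ) (σ' := Z.ρ) (lin f) LinearMap.id
      (AlgHom.id K A) (AlgHom.id K A) (lin_ρ f) (fun _ _ => rfl), Algebra.TensorProduct.map_id]
    rfl
  hexagon_forward X Y Z := by
    ext x
    change lin (α_ Y Z X).hom (lin (braidIso X (tens Y Z)).hom (lin (α_ X Y Z).hom x)) =
      lin (Y ◁ (braidIso X Z).hom) (lin (α_ Y X Z).hom (lin ((braidIso X Y).hom ▷ Z) x))
    rw [lin_associator_hom X Y Z, braid_tens_right_apply, lin_associator_hom Y Z X, comm_assoc_tensRep₃,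
      braid_whiskerRight_apply, lin_associator_hom Y X Z, comm_left_tensRep₃, braid_whiskerLeft_apply,
      comm_left_tensRep₃, comm_hexagon, T12_leg23]
    congr 3
    rw [← Module.End.mul_apply, ← Module.End.mul_apply, ← Module.End.mul_apply,
      ← Module.End.mul_apply, ← map_mul, ← map_mul, ← map_mul, ← map_mul]
    -- The outer factors `Φ₃₁₂` and `Φ` of the axiom cancel against the two associators on the
    -- left-hand side of the hexagon. In the second hexagon `Φ₂₃₁⁻¹` and `Φ⁻¹` of `comul_R_left`
    -- cancel in the same way.
    rw [H.comul_R_right]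
    refine congrArg (fun t => tensRep₃ X Y Z t x) ?_
    simp only [mul_assoc, Units.mul_inv, mul_one]
    rw [← mul_assoc, ← map_mul, ← map_mul, Units.inv_mul, map_one, map_one, one_mul]
  hexagon_reverse X Y Z := by
    ext x
    obtain ⟨x, rfl⟩ := (TensorProduct.assoc K X.carrier Y.carrier Z.carrier).surjective x
    change lin (α_ Z X Y).inv (lin (braidIso (tens X Y) Z).hom (lin (α_ X Y Z).inv
      (TensorProduct.assoc K X.carrier Y.carrier Z.carrier x))) =
      lin ((braidIso X Z).hom ▷ Y) (lin (α_ X Z Y).inv (lin (X ◁ (braidIso Y Z).hom)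
        (TensorProduct.assoc K X.carrier Y.carrier Z.carrier x)))
    rw [lin_associator_inv X Y Z, LinearEquiv.symm_apply_apply, braid_tens_left_apply,
      lin_associator_inv Z X Y, assoc_symm_comm_tensRep₃, braid_whiskerLeft_apply, lin_associator_inv X Z Y,
      comm_right_tensRep₃, braid_whiskerRight_apply, comm_right_tensRep₃, comm_hexagon_symm,
      T23_leg12]
    refine congrArg (fun y => (TensorProduct.assoc K Z.carrier X.carrier Y.carrier).symm
      (TensorProduct.comm K (X.carrier ⊗[K] Y.carrier) Z.carrier y)) ?_
    rw [← Module.End.mul_apply, ← Module.End.mul_apply, ← Module.End.mul_apply,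
      ← Module.End.mul_apply, ← map_mul, ← map_mul, ← map_mul, ← map_mul]
    rw [H.comul_R_left]
    refine congrArg (fun t => tensRep₃ X Y Z t x) ?_
    simp only [mul_assoc, Units.inv_mul, mul_one]
    rw [← mul_assoc, ← map_mul, ← map_mul, Units.mul_inv, map_one, map_one, one_mul]

end Braided

end RepCat

end RibbonQuasi
end

/-! ### Dual representations -/

noncomputable section

namespace RibbonQuasi

open CategoryTheory MonoidalCategory

universe u v w

namespace RepCat

section Dual

variable {K : Type v} [Field K] {A : Type u} [Ring A] [Algebra K A]
  {H : QuasiTriangularQuasiHopfAlgebra K A}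

/-- The action of `A` on the dual of a representation. -/
def dualRep (X : RepCat H) : A →ₐ[K] Module.End K (Module.Dual K X.carrier) :=
  AlgHom.ofLinearMap
    (Module.Dual.transpose ∘ₗ X.ρ.toLinearMap ∘ₗ H.S :
      A →ₗ[K] Module.End K (Module.Dual K X.carrier))
    (by ext φ x; simp [H.S_one, Module.Dual.transpose_apply])
    (by intro a b; ext φ x; simp [H.S_mul, Module.Dual.transpose_apply])

theorem dualRep_apply (X : RepCat H) (a : A) (φ : Module.Dual K X.carrier) :
    dualRep X a φ = φ ∘ₗ X.ρ (H.S a) := rfl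

@[simp]
theorem dualRep_apply_apply (X : RepCat H) (a : A) (φ : Module.Dual K X.carrier) (x : X.carrier) :
    dualRep X a φ x = φ (X.ρ (H.S a) x) := rfl

/-- The dual representation. -/
abbrev dual (X : RepCat H) : RepCat H where
  carrier := Module.Dual K X.carrier
  ρ := dualRep X

/-- `φ ⊗ x ↦ φ(α x)` -/
def evLin (X : RepCat H) : Module.Dual K X.carrier ⊗[K] X.carrier →ₗ[K] K :=
  contractLeft K X.carrier ∘ₗ TensorProduct.map LinearMap.id (X.ρ H.α)

@[simp]
theorem evLin_tmul (X : RepCat H) (φ : Module.Dual K X.carrier) (x : X.carrier) :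
    evLin X (φ ⊗ₜ x) = φ (X.ρ H.α x) := rfl

theorem evLin_tensRep (X : RepCat H) (t : A ⊗[K] A) (φ : Module.Dual K X.carrier) (x : X.carrier) :
    evLin X (tensRep (dualRep X) X.ρ t (φ ⊗ₜ x)) = φ (X.ρ (antiLeft H.S H.α t) x) := by
  induction t with
  | zero => simp
  | add s t hs ht => simp only [map_add, LinearMap.add_apply, hs, ht]
  | tmul a b => simp [antiLeft]

/-- The canonical basis-free element `∑ β eᵢ ⊗ eⁱ`. -/
def coevElt (X : RepCat H) : X.carrier ⊗[K] Module.Dual K X.carrier :=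
  ∑ i, X.ρ H.β (Module.finBasis K X.carrier i) ⊗ₜ (Module.finBasis K X.carrier).coord i

/-- The evaluation. -/
def ev (X : RepCat H) : dual X ⊗ X ⟶ 𝟙_ (RepCat H) :=
  ofLin (X := tens (dual X) X) (Y := unitRep) (evLin X) fun a x => by
    induction x using TensorProduct.induction_on with
    | zero => simp
    | add x y hx hy => simp only [map_add, hx, hy]
    | tmul φ x =>
      rw [tens_ρ]
      refine (evLin_tensRep X (H.Δ a) φ x).trans ?_
      rw [H.antipode_left]
      simp

theorem sum_coord (X : RepCat H) (x : X.carrier) :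
    ∑ i, (Module.finBasis K X.carrier).coord i x • Module.finBasis K X.carrier i = x :=
  (Module.finBasis K X.carrier).sum_repr x

theorem sum_apply_coord (X : RepCat H) (φ : Module.Dual K X.carrier) :
    ∑ i, φ (Module.finBasis K X.carrier i) • (Module.finBasis K X.carrier).coord i = φ := by
  ext x
  conv_rhs => rw [← sum_coord X x]
  simp

/-- Both sides are the tensor that represents `f` under `X ⊗ X* ≅ End X`. The identity moves an
operator from one leg of the canonical element to the other. -/
theorem sum_coord_end (X : RepCat H) (f : Module.End K X.carrier) :
    ∑ i, f (Module.finBasis K X.carrier i) ⊗ₜ[K] (Module.finBasis K X.carrier).coord i =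
      ∑ i, Module.finBasis K X.carrier i ⊗ₜ[K] ((Module.finBasis K X.carrier).coord i ∘ₗ f) := by
  have h1 : ∀ i, f (Module.finBasis K X.carrier i) ⊗ₜ[K] (Module.finBasis K X.carrier).coord i =
      ∑ j, (Module.finBasis K X.carrier).coord j (f (Module.finBasis K X.carrier i)) •
        Module.finBasis K X.carrier j ⊗ₜ[K] (Module.finBasis K X.carrier).coord i := by
    intro i
    conv_lhs => rw [← sum_coord X (f _), TensorProduct.sum_tmul]
    rfl
  rw [Finset.sum_congr rfl fun i _ => h1 i, Finset.sum_comm]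
  refine Finset.sum_congr rfl fun j _ => ?_
  conv_rhs => rw [← sum_apply_coord X (_ ∘ₗ f), TensorProduct.tmul_sum]
  refine Finset.sum_congr rfl fun i _ => ?_
  rw [TensorProduct.tmul_smul]
  rfl

/-- The second leg `b` acts on the dual by precomposition with `S(b)`, which `sum_coord_end` moves
to the first leg, to the right of `β`. Invariance of the coevaluation thereby becomes the axiom for
`∑ a₍₁₎ β S(a₍₂₎)`. -/
theorem coevElt_tensRep (X : RepCat H) (t : A ⊗[K] A) :
    tensRep X.ρ (dualRep X) t (coevElt X) =
      ∑ i, X.ρ (antiRight H.S H.β t) (Module.finBasis K X.carrier i) ⊗ₜ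
        (Module.finBasis K X.carrier).coord i := by
  induction t with
  | zero => simp
  | add s t hs ht =>
    simp only [map_add, LinearMap.add_apply, hs, ht, TensorProduct.add_tmul,
      Finset.sum_add_distrib]
  | tmul a b =>
    have h : antiRight H.S H.β (a ⊗ₜ[K] b) = (a * H.β) * H.S b := by simp [antiRight, mul_assoc]
    rw [h, coevElt, map_sum]
    have h2 := congrArg (TensorProduct.map (X.ρ (a * H.β)) LinearMap.id)
      (sum_coord_end X (X.ρ (H.S b)))
    rw [map_sum, map_sum] at h2
    refine Eq.trans ?_ (Eq.trans h2.symm ?_)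
    · refine Finset.sum_congr rfl fun i _ => ?_
      simp [dualRep_apply]
    · refine Finset.sum_congr rfl fun i _ => ?_
      simp

/-- The coevaluation. -/
def coev (X : RepCat H) : 𝟙_ (RepCat H) ⟶ X ⊗ dual X :=
  ofLin (X := unitRep) (Y := tens X (dual X)) (LinearMap.toSpanSingleton K _ (coevElt X))
    fun a c => by
      rw [tens_ρ, LinearMap.toSpanSingleton_apply, LinearMap.toSpanSingleton_apply, map_smul,
        coevElt_tensRep, H.antipode_right, coevElt, unitRep_ρ, mul_comm, mul_smul,
        Finset.smul_sum (s := Finset.univ) (r := H.ε a)]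
      simp [TensorProduct.smul_tmul']

/-- Stated for arbitrary `t`, where linearity reduces it to pure tensors. At `t = Φ⁻¹`, which enters
through the associator, the coefficient is `∑ X̄ β S(Ȳ) α Z̄`. -/
theorem zigzag_right_aux (X : RepCat H) (t : (A ⊗[K] A) ⊗[K] A) (x : X.carrier) :
    TensorProduct.map LinearMap.id (evLin X) (TensorProduct.assoc K X.carrier _ X.carrier
      (tensRep₃ X (dual X) X t (coevElt X ⊗ₜ x))) =
    X.ρ ((LinearMap.mul' K A ∘ₗ
      TensorProduct.map (antiRight H.S H.β) (LinearMap.mulLeft K H.α)) t) x ⊗ₜ 1 := by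
  induction t using tensor₃_induction with
  | zero => simp
  | add s t hs ht =>
    simp only [map_add, LinearMap.add_apply, hs, ht, TensorProduct.add_tmul]
  | tmul a b c =>
    simp only [coevElt, TensorProduct.sum_tmul, map_sum, tensRep_tmul, TensorProduct.map_tmul,
      TensorProduct.assoc_tmul, evLin_tmul, dualRep_apply_apply, LinearMap.id_apply]
    have h : ∀ i, X.ρ a (X.ρ H.β (Module.finBasis K X.carrier i)) ⊗ₜ[K]
        (Module.finBasis K X.carrier).coord i (X.ρ (H.S b) (X.ρ H.α (X.ρ c x))) =
        X.ρ (a * H.β) ((Module.finBasis K X.carrier).coord i (X.ρ (H.S b * (H.α * c)) x) •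
          Module.finBasis K X.carrier i) ⊗ₜ[K] (1 : K) := by
      intro i
      rw [map_smul, TensorProduct.smul_tmul]
      simp
    rw [Finset.sum_congr rfl fun i _ => h i, ← TensorProduct.sum_tmul, ← map_sum, sum_coord]
    simp [antiRight, mul_assoc]

/-- The companion for the other zigzag. That one contains the inverse associator, so `t = Φ`, and
the coefficient is `∑ S(X) α Y β S(Z)`. -/
theorem zigzag_left_aux (X : RepCat H) (t : (A ⊗[K] A) ⊗[K] A) (φ : Module.Dual K X.carrier) :
    TensorProduct.map (evLin X) LinearMap.id
      (tensRep₃ (dual X) X (dual X) t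
        ((TensorProduct.assoc K _ X.carrier _).symm (φ ⊗ₜ coevElt X))) =
    1 ⊗ₜ (φ ∘ₗ X.ρ ((LinearMap.mul' K A ∘ₗ
      TensorProduct.map (antiLeft H.S H.α) (LinearMap.mulLeft K H.β ∘ₗ H.S)) t)) := by
  induction t using tensor₃_induction with
  | zero => simp
  | add s t hs ht =>
    simp only [map_add, LinearMap.add_apply, hs, ht, TensorProduct.tmul_add, LinearMap.comp_add]
  | tmul a b c =>
    simp only [coevElt, TensorProduct.tmul_sum, map_sum, tensRep_tmul, TensorProduct.map_tmul,
      TensorProduct.assoc_symm_tmul, evLin_tmul, dualRep_apply_apply, LinearMap.id_apply]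
    have h : ∀ i, φ (X.ρ (H.S a) (X.ρ H.α (X.ρ b (X.ρ H.β (Module.finBasis K X.carrier i)))))
          ⊗ₜ[K] (dualRep X) c ((Module.finBasis K X.carrier).coord i) =
        (1 : K) ⊗ₜ[K] (dualRep X) c (((φ ∘ₗ X.ρ (H.S a * (H.α * b) * H.β))
          (Module.finBasis K X.carrier i)) • (Module.finBasis K X.carrier).coord i) := by
      intro i
      rw [map_smul, ← TensorProduct.smul_tmul]
      simp
    rw [Finset.sum_congr rfl fun i _ => h i, ← TensorProduct.tmul_sum, ← map_sum, sum_apply_coord]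
    congr 1
    ext x
    simp [antiLeft, mul_assoc]

instance exactPairing (X : RepCat H) : ExactPairing X (no_index (dual X)) where
  coevaluation' := coev X
  evaluation' := ev X
  coevaluation_evaluation' := by
    ext x
    induction x using TensorProduct.induction_on with
    | zero => simp only [map_zero]
    | add x y hx hy => simp only [map_add, hx, hy]
    | tmul φ c =>
      change TensorProduct.map (evLin X) LinearMap.id
        (tensRep₃ (dual X) X (dual X) ↑H.Φ
          ((TensorProduct.assoc K _ X.carrier _).symm (φ ⊗ₜ (c • coevElt X)))) =
        (1 : K) ⊗ₜ (c • φ)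
      rw [TensorProduct.tmul_smul, map_smul, map_smul, map_smul, zigzag_left_aux, H.antipode_assoc,
        map_one, TensorProduct.tmul_smul]
      rfl
  evaluation_coevaluation' := by
    ext x
    induction x using TensorProduct.induction_on with
    | zero => simp only [map_zero]
    | add x y hx hy => simp only [map_add, hx, hy]
    | tmul c x =>
      change TensorProduct.map LinearMap.id (evLin X) (TensorProduct.assoc K X.carrier _ X.carrier
        (tensRep₃ X (dual X) X ↑H.Φ⁻¹ ((c • coevElt X) ⊗ₜ x))) = (c • x) ⊗ₜ (1 : K)
      rw [← TensorProduct.smul_tmul', map_smul, map_smul, map_smul, zigzag_right_aux,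
        H.antipode_assoc_inv, map_one, ← TensorProduct.smul_tmul']
      rfl

end Dual

end RepCat

end RibbonQuasi
end

/-! ### Pairings, mates and partial traces in a monoidal category -/

noncomputable section

namespace RibbonQuasi

open CategoryTheory MonoidalCategory

universe u v w

section Pairings

variable {C : Type u} [Category.{v} C] [MonoidalCategory C]

/-- The morphism to a dual that corresponds to a pairing. -/
def mate {P Q : C} (Q' : C) [ExactPairing Q Q'] (h : P ⊗ Q ⟶ 𝟙_ C) : P ⟶ Q' :=
  (ρ_ P).inv ≫ P ◁ η_ Q Q' ≫ (α_ _ _ _).inv ≫ h ▷ Q' ≫ (λ_ Q').hom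

/-- The exchange law moves `h` past the evaluation. What remains on `Q` is a zigzag, which
straightens. -/
theorem mate_whiskerRight_evaluation {P Q : C} (Q' : C) [ExactPairing Q Q'] (h : P ⊗ Q ⟶ 𝟙_ C) :
    mate Q' h ▷ Q ≫ ε_ Q Q' = h := by
  calc
    _ = 𝟙 _ ⊗≫ P ◁ η_ Q Q' ▷ Q ⊗≫ (h ▷ (Q' ⊗ Q) ≫ 𝟙_ C ◁ ε_ Q Q') ⊗≫ 𝟙 _ := by
      simp only [mate]; monoidal
    _ = 𝟙 _ ⊗≫ P ◁ (η_ Q Q' ▷ Q ⊗≫ Q ◁ ε_ Q Q') ⊗≫ h := by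
      rw [← whisker_exchange]; monoidal
    _ = h := by
      rw [ExactPairing.evaluation_coevaluation'']; monoidal

/-- An evaluation determines its coevaluation: insert the zigzag of `p'`, use `hf` to replace one
evaluation by the other, and remove the zigzag of `p`. It serves to compare the nested pairing of a
tensor product with its own dual, and, with `f = 𝟙`, to compare two pairings of the same objects. -/
theorem coevaluation_whiskerLeft {X Y Y' : C} (p : ExactPairing X Y) (p' : ExactPairing X Y')
    (f : Y ⟶ Y') (hf : f ▷ X ≫ p'.evaluation' = p.evaluation') :
    p.coevaluation' ≫ X ◁ f = p'.coevaluation' := by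
  have h1 := @ExactPairing.coevaluation_evaluation'' _ _ _ X Y' p'
  have h2 := @ExactPairing.evaluation_coevaluation'' _ _ _ X Y p
  simp only [ExactPairing.evaluation, ExactPairing.coevaluation] at h1 h2
  calc
    _ = p.coevaluation' ⊗≫ X ◁ f ⊗≫ X ◁ (⊗𝟙.hom : Y' ⊗ 𝟙_ C ⟶ 𝟙_ C ⊗ Y') ⊗≫ 𝟙 _ := by
      monoidal
    _ = p.coevaluation' ⊗≫ X ◁ (f ▷ 𝟙_ C ≫ Y' ◁ p'.coevaluation') ⊗≫
        X ◁ p'.evaluation' ▷ Y' ⊗≫ 𝟙 _ := by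
      rw [← h1]; monoidal
    _ = 𝟙 _ ⊗≫ (p.coevaluation' ▷ 𝟙_ C ≫ (X ⊗ Y) ◁ p'.coevaluation') ⊗≫
        X ◁ (f ▷ X ≫ p'.evaluation') ▷ Y' ⊗≫ 𝟙 _ := by
      rw [← whisker_exchange]; monoidal
    _ = p'.coevaluation' ⊗≫
        (p.coevaluation' ▷ X ⊗≫ X ◁ p.evaluation') ▷ Y' ⊗≫ 𝟙 _ := by
      rw [← whisker_exchange, hf]; monoidal
    _ = _ := by
      rw [h2]; monoidal

/-- The partial trace of an endomorphism of `W ⊗ V`, with respect to `d : 𝟙 ⟶ V ⊗ V'` and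
`e : V ⊗ V' ⟶ 𝟙`. -/
def partialTrace {W V V' : C} (d : 𝟙_ C ⟶ V ⊗ V') (e : V ⊗ V' ⟶ 𝟙_ C) (f : W ⊗ V ⟶ W ⊗ V) :
    W ⟶ W :=
  𝟙 _ ⊗≫ W ◁ d ⊗≫ f ▷ V' ⊗≫ W ◁ e ⊗≫ 𝟙 _

/-- Closing `V` and then `W` is closing `W ⊗ V` with nested minima and maxima. Both sides are the
same diagram up to coherence. -/
theorem trace_partialTrace {W V V' W' : C} (d : 𝟙_ C ⟶ V ⊗ V') (e : V ⊗ V' ⟶ 𝟙_ C)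
    (d' : 𝟙_ C ⟶ W ⊗ W') (e' : W ⊗ W' ⟶ 𝟙_ C) (f : W ⊗ V ⟶ W ⊗ V) :
    d' ≫ partialTrace d e f ▷ W' ≫ e' =
      (d' ⊗≫ (W ◁ d) ▷ W' ⊗≫ 𝟙 _) ≫ f ▷ (V' ⊗ W') ≫ (𝟙 _ ⊗≫ (W ◁ e) ▷ W' ⊗≫ e') := by
  simp only [partialTrace]
  monoidal

theorem partialTrace_whiskerRight_comp {W V V' : C} (d : 𝟙_ C ⟶ V ⊗ V') (e : V ⊗ V' ⟶ 𝟙_ C)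
    (g : W ⟶ W) (f : W ⊗ V ⟶ W ⊗ V) :
    partialTrace d e (f ≫ g ▷ V) = partialTrace d e f ≫ g := by
  calc
    _ = 𝟙 _ ⊗≫ W ◁ d ⊗≫ f ▷ V' ⊗≫ (g ▷ (V ⊗ V') ≫ W ◁ e) ⊗≫ 𝟙 _ := by
      simp only [partialTrace]; monoidal
    _ = _ := by
      rw [← whisker_exchange]; simp only [partialTrace]; monoidal

end Pairings

/-! ### Strands over an object -/

section Tangles

variable (C : Type u) [Category.{v} C] [MonoidalCategory C]

/-- Morphisms of a monoidal category that satisfy the relations of oriented tangles. The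
orientations of the ends of `cup b c` and `cap b c` are `b` and `c`, only the case `b ≠ c`
matters. -/
structure TangleData where
  obj : Bool → C
  cup (b c : Bool) : 𝟙_ C ⟶ obj b ⊗ obj c
  cap (b c : Bool) : obj b ⊗ obj c ⟶ 𝟙_ C
  cross (a b o : Bool) : obj a ⊗ obj b ⟶ obj b ⊗ obj a
  zigzag_left (b c : Bool) (h : b ≠ c) : cup b c ▷ obj b ⊗≫ obj b ◁ cap c b = ⊗𝟙.hom
  zigzag_right (b c : Bool) (h : b ≠ c) : obj b ◁ cup c b ⊗≫ cap b c ▷ obj b = ⊗𝟙.hom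
  slide_cap (x b c o : Bool) (h : b ≠ c) :
    obj b ◁ cross x c o ⊗≫ cap b c ▷ obj x ⊗≫ 𝟙 (obj x) =
      𝟙 _ ⊗≫ cross b x (!o) ▷ obj c ⊗≫ obj x ◁ cap b c ⊗≫ 𝟙 (obj x)
  slide_cup (x b c o : Bool) (h : b ≠ c) :
    𝟙 (obj x) ⊗≫ cup b c ▷ obj x ⊗≫ obj b ◁ cross c x o =
      𝟙 (obj x) ⊗≫ obj x ◁ cup b c ⊗≫ cross x b (!o) ▷ obj c ⊗≫ 𝟙 _
  cross_cap (b c o : Bool) (h : b ≠ c) : cross b c o ≫ cap c b = cap b c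
  cup_cross (b c o : Bool) (h : b ≠ c) : cup b c ≫ cross b c o = cup c b
  cross_cross (a b o : Bool) : cross a b o ≫ cross b a (!o) = 𝟙 _
  yang_baxter (a b c o : Bool) :
    cross a b o ▷ obj c ⊗≫ obj b ◁ cross a c o ⊗≫ cross b c o ▷ obj a =
      𝟙 _ ⊗≫ obj a ◁ cross b c o ⊗≫ cross a c o ▷ obj b ⊗≫ obj c ◁ cross a b o ⊗≫ 𝟙 _

namespace TangleData

variable {C} (T : TangleData C)

/-- The object `((X ⊗ V_{p₁}) ⊗ V_{p₂}) ⊗ ⋯`. -/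
def act (X : C) : List Bool → C
  | [] => X
  | b :: p => act (X ⊗ T.obj b) p

/-- Functoriality of `act`. -/
def actMap : {X Y : C} → (X ⟶ Y) → (p : List Bool) → (T.act X p ⟶ T.act Y p)
  | _, _, f, [] => f
  | _, _, f, b :: p => actMap (f ▷ T.obj b) p

theorem actMap_id (X : C) (p : List Bool) : T.actMap (𝟙 X) p = 𝟙 _ := by
  induction p generalizing X with
  | nil => rfl
  | cons b p ih => rw [actMap, id_whiskerRight]; exact ih _

theorem actMap_comp {X Y Z : C} (f : X ⟶ Y) (g : Y ⟶ Z) (p : List Bool) :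
    T.actMap (f ≫ g) p = T.actMap f p ≫ T.actMap g p := by
  induction p generalizing X Y Z with
  | nil => rfl
  | cons b p ih => rw [actMap, comp_whiskerRight]; exact ih _ _

/-- The morphism of a minimum to the right of `X`. -/
def cupAt (X : C) (b c : Bool) : X ⟶ (X ⊗ T.obj b) ⊗ T.obj c :=
  (ρ_ X).inv ≫ X ◁ T.cup b c ≫ (α_ _ _ _).inv

/-- The morphism of a maximum to the right of `X`. -/
def capAt (X : C) (b c : Bool) : (X ⊗ T.obj b) ⊗ T.obj c ⟶ X :=
  (α_ _ _ _).hom ≫ X ◁ T.cap b c ≫ (ρ_ X).hom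

/-- The morphism of a crossing to the right of `X`. -/
def crossAt (X : C) (a b o : Bool) : (X ⊗ T.obj a) ⊗ T.obj b ⟶ (X ⊗ T.obj b) ⊗ T.obj a :=
  (α_ _ _ _).hom ≫ X ◁ T.cross a b o ≫ (α_ _ _ _).inv

/-- The naturality of the pieces in the object on their left is the exchange law. It is what makes
the exchange of heights of distant pieces hold. -/
theorem cupAt_naturality {X Y : C} (f : X ⟶ Y) (b c : Bool) :
    T.cupAt X b c ≫ (f ▷ T.obj b) ▷ T.obj c = f ≫ T.cupAt Y b c := by
  calc
    _ = 𝟙 _ ⊗≫ (X ◁ T.cup b c ≫ f ▷ (T.obj b ⊗ T.obj c)) ⊗≫ 𝟙 _ := by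
      simp only [cupAt]; monoidal
    _ = _ := by rw [whisker_exchange]; simp only [cupAt]; monoidal

theorem capAt_naturality {X Y : C} (f : X ⟶ Y) (b c : Bool) :
    T.capAt X b c ≫ f = (f ▷ T.obj b) ▷ T.obj c ≫ T.capAt Y b c := by
  calc
    _ = 𝟙 _ ⊗≫ (X ◁ T.cap b c ≫ f ▷ 𝟙_ C) ⊗≫ 𝟙 _ := by
      simp only [capAt]; monoidal
    _ = _ := by rw [whisker_exchange]; simp only [capAt]; monoidal

theorem crossAt_naturality {X Y : C} (f : X ⟶ Y) (a b o : Bool) :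
    T.crossAt X a b o ≫ (f ▷ T.obj b) ▷ T.obj a =
      (f ▷ T.obj a) ▷ T.obj b ≫ T.crossAt Y a b o := by
  calc
    _ = 𝟙 _ ⊗≫ (X ◁ T.cross a b o ≫ f ▷ (T.obj b ⊗ T.obj a)) ⊗≫ 𝟙 _ := by
      simp only [crossAt]; monoidal
    _ = _ := by rw [whisker_exchange]; simp only [crossAt]; monoidal

theorem zigzagAt_left (X : C) {b c : Bool} (h : b ≠ c) :
    T.cupAt X b c ▷ T.obj b ≫ T.capAt (X ⊗ T.obj b) c b = 𝟙 _ := by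
  calc
    _ = 𝟙 _ ⊗≫ X ◁ (T.cup b c ▷ T.obj b ⊗≫ T.obj b ◁ T.cap c b) ⊗≫ 𝟙 _ := by
      simp only [cupAt, capAt]; monoidal
    _ = _ := by rw [T.zigzag_left b c h]; monoidal

theorem zigzagAt_right (X : C) {b c : Bool} (h : b ≠ c) :
    T.cupAt (X ⊗ T.obj b) c b ≫ T.capAt X b c ▷ T.obj b = 𝟙 _ := by
  calc
    _ = 𝟙 _ ⊗≫ X ◁ (T.obj b ◁ T.cup c b ⊗≫ T.cap b c ▷ T.obj b) ⊗≫ 𝟙 _ := by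
      simp only [cupAt, capAt]; monoidal
    _ = _ := by rw [T.zigzag_right b c h]; monoidal

theorem slideAt_cap (X : C) (x o : Bool) {b c : Bool} (h : b ≠ c) :
    T.crossAt (X ⊗ T.obj b) x c o ≫ T.capAt X b c ▷ T.obj x =
      T.crossAt X b x (!o) ▷ T.obj c ≫ T.capAt (X ⊗ T.obj x) b c := by
  calc
    _ = 𝟙 _ ⊗≫ X ◁ (T.obj b ◁ T.cross x c o ⊗≫ T.cap b c ▷ T.obj x ⊗≫ 𝟙 (T.obj x)) ⊗≫ 𝟙 _ := by
      simp only [crossAt, capAt]; monoidal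
    _ = _ := by rw [T.slide_cap x b c o h]; simp only [crossAt, capAt]; monoidal

theorem slideAt_cup (X : C) (x o : Bool) {b c : Bool} (h : b ≠ c) :
    T.cupAt X b c ▷ T.obj x ≫ T.crossAt (X ⊗ T.obj b) c x o =
      T.cupAt (X ⊗ T.obj x) b c ≫ T.crossAt X x b (!o) ▷ T.obj c := by
  calc
    _ = 𝟙 _ ⊗≫ X ◁ (𝟙 (T.obj x) ⊗≫ T.cup b c ▷ T.obj x ⊗≫ T.obj b ◁ T.cross c x o) ⊗≫ 𝟙 _ := by
      simp only [crossAt, cupAt]; monoidal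
    _ = _ := by rw [T.slide_cup x b c o h]; simp only [crossAt, cupAt]; monoidal

theorem crossAt_capAt (X : C) (o : Bool) {b c : Bool} (h : b ≠ c) :
    T.crossAt X b c o ≫ T.capAt X c b = T.capAt X b c := by
  calc
    _ = 𝟙 _ ⊗≫ X ◁ (T.cross b c o ≫ T.cap c b) ⊗≫ 𝟙 _ := by
      simp only [crossAt, capAt]; monoidal
    _ = _ := by rw [T.cross_cap b c o h]; simp only [capAt]; monoidal

theorem cupAt_crossAt (X : C) (o : Bool) {b c : Bool} (h : b ≠ c) :
    T.cupAt X b c ≫ T.crossAt X b c o = T.cupAt X c b := by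
  calc
    _ = 𝟙 _ ⊗≫ X ◁ (T.cup b c ≫ T.cross b c o) ⊗≫ 𝟙 _ := by
      simp only [crossAt, cupAt]; monoidal
    _ = _ := by rw [T.cup_cross b c o h]; simp only [cupAt]; monoidal

theorem crossAt_crossAt (X : C) (a b o : Bool) :
    T.crossAt X a b o ≫ T.crossAt X b a (!o) = 𝟙 _ := by
  calc
    _ = 𝟙 _ ⊗≫ X ◁ (T.cross a b o ≫ T.cross b a (!o)) ⊗≫ 𝟙 _ := by
      simp only [crossAt]; monoidal
    _ = _ := by rw [T.cross_cross]; monoidal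

theorem yangBaxterAt (X : C) (a b c o : Bool) :
    T.crossAt X a b o ▷ T.obj c ≫ T.crossAt (X ⊗ T.obj b) a c o ≫ T.crossAt X b c o ▷ T.obj a =
      T.crossAt (X ⊗ T.obj a) b c o ≫ T.crossAt X a c o ▷ T.obj b ≫
        T.crossAt (X ⊗ T.obj c) a b o := by
  calc
    _ = 𝟙 _ ⊗≫ X ◁ (T.cross a b o ▷ T.obj c ⊗≫ T.obj b ◁ T.cross a c o ⊗≫
        T.cross b c o ▷ T.obj a) ⊗≫ 𝟙 _ := by
      simp only [crossAt]; monoidal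
    _ = _ := by rw [T.yang_baxter]; simp only [crossAt]; monoidal

/-- The morphism of a piece in the middle of a diagram. -/
def sliceOp : (X : C) → (l : List Bool) → (e : Piece) → (r : List Bool) →
    (T.act X (l ++ e.src ++ r) ⟶ T.act X (l ++ e.tgt ++ r))
  | X, [], .cup b, r => T.actMap (T.cupAt X b (!b)) r
  | X, [], .cap b, r => T.actMap (T.capAt X b (!b)) r
  | X, [], .cross a b o, r => T.actMap (T.crossAt X a b o) r
  -- Strands on the left are absorbed into the object, so a piece always stands directly to the
  -- right of some object.
  | X, c :: l, e, r => sliceOp (X ⊗ T.obj c) l e r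

end TangleData

end Tangles

end RibbonQuasi
end

/-! ### Invariance of the morphism of a diagram under the local moves -/

noncomputable section

namespace RibbonQuasi

open CategoryTheory MonoidalCategory

universe u v w

section Invariance

variable {C : Type u} [Category.{v} C] [MonoidalCategory C]

namespace TangleData

variable (T : TangleData C)

theorem sliceOp_naturality {X Y : C} (f : X ⟶ Y) (l : List Bool) (e : Piece) (r : List Bool) :
    T.sliceOp X l e r ≫ T.actMap f (l ++ e.tgt ++ r) =
      T.actMap f (l ++ e.src ++ r) ≫ T.sliceOp Y l e r := by
  induction l generalizing X Y with
  | cons c l ih => exact ih _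
  | nil =>
    cases e with
    | cup b =>
      change T.actMap _ r ≫ T.actMap ((f ▷ T.obj b) ▷ T.obj (!b)) r = T.actMap f r ≫ T.actMap _ r
      rw [← actMap_comp, ← actMap_comp, cupAt_naturality]
    | cap b =>
      change T.actMap _ r ≫ T.actMap f r = T.actMap ((f ▷ T.obj b) ▷ T.obj (!b)) r ≫ T.actMap _ r
      rw [← actMap_comp, ← actMap_comp, capAt_naturality]
    | cross a b o =>
      change T.actMap _ r ≫ T.actMap ((f ▷ T.obj b) ▷ T.obj a) r =
        T.actMap ((f ▷ T.obj a) ▷ T.obj b) r ≫ T.actMap _ r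
      rw [← actMap_comp, ← actMap_comp, crossAt_naturality]

/-- The morphism of a slice of a diagram, to the right of `X`. -/
def sliceMor (X : C) (x : Slice) : T.act X x.src ⟶ T.act X x.tgt :=
  T.sliceOp X x.left x.piece x.right

/-- The morphism of a tangle diagram, to the right of `X`. -/
def op (X : C) : (D : List Slice) → (p q : List Bool) → IsTangle p D q → (T.act X p ⟶ T.act X q)
  | [], _, _, h => eqToHom (congrArg (T.act X) h)
  | x :: D, _, q, h => eqToHom (congrArg (T.act X) h.1) ≫ T.sliceMor X x ≫
      op X D x.tgt q h.2

theorem op_append (X : C) {D E : List Slice} {p q r : List Bool} (hD : IsTangle p D q)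
    (hE : IsTangle q E r) :
    T.op X (D ++ E) p r (hD.append hE) = T.op X D p q hD ≫ T.op X E q r hE := by
  induction D generalizing p with
  | nil => cases hD; exact (Category.id_comp _).symm
  | cons x D ih =>
    rw [op, Category.assoc, Category.assoc, ← ih]
    rfl

end TangleData

/-- A vertical strand to the left of a slice. -/
def Slice.addLeft (c : Bool) (x : Slice) : Slice := ⟨c :: x.left, x.piece, x.right⟩

theorem IsTangle.addLeft {p q : List Bool} {D : List Slice} (c : Bool) (h : IsTangle p D q) :
    IsTangle (c :: p) (D.map (Slice.addLeft c)) (c :: q) := by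
  induction D generalizing p with
  | nil => exact congrArg _ h
  | cons x D ih => exact ⟨congrArg _ h.1, ih h.2⟩

theorem IsTangle.exists_of_append {p r : List Bool} {D E : List Slice}
    (h : IsTangle p (D ++ E) r) : ∃ q, IsTangle p D q ∧ IsTangle q E r := by
  induction D generalizing p with
  | nil => exact ⟨p, rfl, h⟩
  | cons x D ih =>
    obtain ⟨q, h1, h2⟩ := ih h.2
    exact ⟨q, ⟨h.1, h1⟩, h2⟩

theorem IsTangle.tgt_unique {p q q' : List Bool} {D : List Slice} (h : IsTangle p D q)
    (h' : IsTangle p D q') : q = q' := by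
  induction D generalizing p with
  | nil => exact h.symm.trans h'
  | cons x D ih => exact ih h.2 h'.2

theorem IsTangle.src_unique {p p' q q' : List Bool} {D : List Slice} (hD : D ≠ [])
    (h : IsTangle p D q) (h' : IsTangle p' D q') : p = p' := by
  cases D with
  | nil => exact absurd rfl hD
  | cons x D => exact h.1.trans h'.1.symm

namespace TangleData

variable (T : TangleData C)

/-- An extra strand on the left only replaces `X` by `X ⊗ V_c`. Since `SameOp` quantifies over all
`X`, each move need only be checked with no strands on its left. -/
theorem op_addLeft (X : C) (c : Bool) {p q : List Bool} {D : List Slice} (h : IsTangle p D q) :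
    T.op X (D.map (Slice.addLeft c)) (c :: p) (c :: q) (h.addLeft c) =
      T.op (X ⊗ T.obj c) D p q h := by
  induction D generalizing p with
  | nil => rfl
  | cons x D ih =>
    have := ih h.2
    exact congrArg (fun f => eqToHom (congrArg (T.act (X ⊗ T.obj c)) h.1) ≫
      T.sliceMor (X ⊗ T.obj c) x ≫ f) this

/-- Two diagrams with the same ends have the same morphisms. -/
def SameOp (a b : List Slice) : Prop :=
  ∃ (p q : List Bool) (ha : IsTangle p a q) (hb : IsTangle p b q),
    ∀ X : C, T.op X a p q ha = T.op X b p q hb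

variable {T} in
theorem SameOp.addLeft {a b : List Slice} (c : Bool) (h : T.SameOp a b) :
    T.SameOp (a.map (Slice.addLeft c)) (b.map (Slice.addLeft c)) := by
  obtain ⟨p, q, ha, hb, h⟩ := h
  exact ⟨c :: p, c :: q, ha.addLeft c, hb.addLeft c, fun X => by
    rw [T.op_addLeft X c ha, T.op_addLeft X c hb, h]⟩

/-- With nothing to the left of `e`, its morphism is a map between objects on which the rest of the
diagram is built, and the claim is the naturality of `f` in that map. -/
theorem sameOp_exchange (l m r : List Bool) (e f : Piece) :
    T.SameOp [⟨l, e, m ++ f.src ++ r⟩, ⟨l ++ e.tgt ++ m, f, r⟩]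
        [⟨l ++ e.src ++ m, f, r⟩, ⟨l, e, m ++ f.tgt ++ r⟩] := by
  induction l with
  | cons c l ih => exact ih.addLeft c
  | nil =>
    cases e with
    | cup b =>
      refine ⟨m ++ f.src ++ r, b :: (!b) :: (m ++ f.tgt ++ r), ⟨rfl, rfl, rfl⟩, ⟨rfl, rfl, rfl⟩,
        fun X => ?_⟩
      change 𝟙 _ ≫ T.actMap _ (m ++ f.src ++ r) ≫ 𝟙 _ ≫ T.sliceOp _ m f r ≫ 𝟙 _ =
        𝟙 _ ≫ T.sliceOp _ m f r ≫ 𝟙 _ ≫ T.actMap _ (m ++ f.tgt ++ r) ≫ 𝟙 _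
      simp only [Category.comp_id, Category.id_comp, sliceOp_naturality]
    | cap b =>
      refine ⟨b :: (!b) :: (m ++ f.src ++ r), m ++ f.tgt ++ r, ⟨rfl, rfl, rfl⟩, ⟨rfl, rfl, rfl⟩,
        fun X => ?_⟩
      change 𝟙 _ ≫ T.actMap _ (m ++ f.src ++ r) ≫ 𝟙 _ ≫ T.sliceOp _ m f r ≫ 𝟙 _ =
        𝟙 _ ≫ T.sliceOp _ m f r ≫ 𝟙 _ ≫ T.actMap _ (m ++ f.tgt ++ r) ≫ 𝟙 _
      simp only [Category.comp_id, Category.id_comp, sliceOp_naturality]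
    | cross a b o =>
      refine ⟨a :: b :: (m ++ f.src ++ r), b :: a :: (m ++ f.tgt ++ r), ⟨rfl, rfl, rfl⟩,
        ⟨rfl, rfl, rfl⟩, fun X => ?_⟩
      change 𝟙 _ ≫ T.actMap _ (m ++ f.src ++ r) ≫ 𝟙 _ ≫ T.sliceOp _ m f r ≫ 𝟙 _ =
        𝟙 _ ≫ T.sliceOp _ m f r ≫ 𝟙 _ ≫ T.actMap _ (m ++ f.tgt ++ r) ≫ 𝟙 _
      simp only [Category.comp_id, Category.id_comp, sliceOp_naturality]

theorem sameOp_zigzag_left (l r : List Bool) (b : Bool) :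
    T.SameOp [⟨l, .cup b, b :: r⟩, ⟨l ++ [b], .cap (!b), r⟩] [] := by
  induction l with
  | cons c l ih => exact ih.addLeft c
  | nil =>
    cases b <;>
    · refine ⟨_, _, ⟨rfl, rfl, rfl⟩, rfl, fun X => ?_⟩
      change 𝟙 _ ≫ T.actMap (T.cupAt X _ _ ▷ T.obj _) r ≫ 𝟙 _ ≫
        T.actMap (T.capAt (X ⊗ T.obj _) _ _) r ≫ 𝟙 _ = 𝟙 (T.act (X ⊗ T.obj _) r)
      simp only [Category.comp_id, Category.id_comp, ← actMap_comp]
      exact (congrArg (fun f => T.actMap f r) (T.zigzagAt_left X (by decide))).trans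
        (T.actMap_id _ r)

theorem sameOp_zigzag_right (l r : List Bool) (b : Bool) :
    T.SameOp [⟨l ++ [b], .cup (!b), r⟩, ⟨l, .cap b, b :: r⟩] [] := by
  induction l with
  | cons c l ih => exact ih.addLeft c
  | nil =>
    cases b <;>
    · refine ⟨_, _, ⟨rfl, rfl, rfl⟩, rfl, fun X => ?_⟩
      change 𝟙 _ ≫ T.actMap (T.cupAt (X ⊗ T.obj _) _ _) r ≫ 𝟙 _ ≫
        T.actMap (T.capAt X _ _ ▷ T.obj _) r ≫ 𝟙 _ = 𝟙 (T.act (X ⊗ T.obj _) r)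
      simp only [Category.comp_id, Category.id_comp, ← actMap_comp]
      exact (congrArg (fun f => T.actMap f r) (T.zigzagAt_right X (by decide))).trans
        (T.actMap_id _ r)

theorem sameOp_slide_cap (l r : List Bool) (x b o : Bool) :
    T.SameOp [⟨l ++ [b], .cross x (!b) o, r⟩, ⟨l, .cap b, x :: r⟩]
        [⟨l, .cross b x (!o), (!b) :: r⟩, ⟨l ++ [x], .cap b, r⟩] := by
  induction l with
  | cons c l ih => exact ih.addLeft c
  | nil =>
    refine ⟨_, _, ⟨rfl, rfl, rfl⟩, ⟨rfl, rfl, rfl⟩, fun X => ?_⟩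
    change 𝟙 _ ≫ T.actMap (T.crossAt (X ⊗ T.obj b) x (!b) o) r ≫ 𝟙 _ ≫
        T.actMap (T.capAt X b (!b) ▷ T.obj x) r ≫ 𝟙 _ =
      𝟙 _ ≫ T.actMap (T.crossAt X b x (!o) ▷ T.obj (!b)) r ≫ 𝟙 _ ≫
        T.actMap (T.capAt (X ⊗ T.obj x) b (!b)) r ≫ 𝟙 _
    simp only [Category.comp_id, Category.id_comp, ← actMap_comp]
    rw [T.slideAt_cap X x o (by simp)]

theorem sameOp_slide_cup (l r : List Bool) (x b o : Bool) :
    T.SameOp [⟨l, .cup b, x :: r⟩, ⟨l ++ [b], .cross (!b) x o, r⟩]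
        [⟨l ++ [x], .cup b, r⟩, ⟨l, .cross x b (!o), (!b) :: r⟩] := by
  induction l with
  | cons c l ih => exact ih.addLeft c
  | nil =>
    refine ⟨_, _, ⟨rfl, rfl, rfl⟩, ⟨rfl, rfl, rfl⟩, fun X => ?_⟩
    change 𝟙 _ ≫ T.actMap (T.cupAt X b (!b) ▷ T.obj x) r ≫ 𝟙 _ ≫
        T.actMap (T.crossAt (X ⊗ T.obj b) (!b) x o) r ≫ 𝟙 _ =
      𝟙 _ ≫ T.actMap (T.cupAt (X ⊗ T.obj x) b (!b)) r ≫ 𝟙 _ ≫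
        T.actMap (T.crossAt X x b (!o) ▷ T.obj (!b)) r ≫ 𝟙 _
    simp only [Category.comp_id, Category.id_comp, ← actMap_comp]
    rw [T.slideAt_cup X x o (by simp)]

theorem sameOp_reidemeister1_cap (l r : List Bool) (b o : Bool) :
    T.SameOp [⟨l, .cross b (!b) o, r⟩, ⟨l, .cap (!b), r⟩] [⟨l, .cap b, r⟩] := by
  induction l with
  | cons c l ih => exact ih.addLeft c
  | nil =>
    cases b <;>
    · refine ⟨_, _, ⟨rfl, rfl, rfl⟩, ⟨rfl, rfl⟩, fun X => ?_⟩
      change 𝟙 _ ≫ T.actMap (T.crossAt X _ _ o) r ≫ 𝟙 _ ≫ T.actMap (T.capAt X _ _) r ≫ 𝟙 _ =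
        𝟙 _ ≫ T.actMap (T.capAt X _ _) r ≫ 𝟙 _
      simp only [Category.comp_id, Category.id_comp, ← actMap_comp]
      exact congrArg (fun f => T.actMap f r) (T.crossAt_capAt X o (by decide))

theorem sameOp_reidemeister1_cup (l r : List Bool) (b o : Bool) :
    T.SameOp [⟨l, .cup b, r⟩, ⟨l, .cross b (!b) o, r⟩] [⟨l, .cup (!b), r⟩] := by
  induction l with
  | cons c l ih => exact ih.addLeft c
  | nil =>
    cases b <;>
    · refine ⟨_, _, ⟨rfl, rfl, rfl⟩, ⟨rfl, rfl⟩, fun X => ?_⟩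
      change 𝟙 _ ≫ T.actMap (T.cupAt X _ _) r ≫ 𝟙 _ ≫ T.actMap (T.crossAt X _ _ o) r ≫ 𝟙 _ =
        𝟙 _ ≫ T.actMap (T.cupAt X _ _) r ≫ 𝟙 _
      simp only [Category.comp_id, Category.id_comp, ← actMap_comp]
      exact congrArg (fun f => T.actMap f r) (T.cupAt_crossAt X o (by decide))

theorem sameOp_reidemeister2 (l r : List Bool) (a b o : Bool) :
    T.SameOp [⟨l, .cross a b o, r⟩, ⟨l, .cross b a (!o), r⟩] [] := by
  induction l with
  | cons c l ih => exact ih.addLeft c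
  | nil =>
    refine ⟨_, _, ⟨rfl, rfl, rfl⟩, rfl, fun X => ?_⟩
    change 𝟙 _ ≫ T.actMap (T.crossAt X a b o) r ≫ 𝟙 _ ≫ T.actMap (T.crossAt X b a (!o)) r ≫ 𝟙 _ =
      𝟙 (T.act ((X ⊗ T.obj a) ⊗ T.obj b) r)
    simp only [Category.comp_id, Category.id_comp, ← actMap_comp]
    rw [crossAt_crossAt, actMap_id]

theorem sameOp_reidemeister3 (l r : List Bool) (a b c o : Bool) :
    T.SameOp
      [⟨l, .cross a b o, c :: r⟩, ⟨l ++ [b], .cross a c o, r⟩, ⟨l, .cross b c o, a :: r⟩]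
      [⟨l ++ [a], .cross b c o, r⟩, ⟨l, .cross a c o, b :: r⟩, ⟨l ++ [c], .cross a b o, r⟩] := by
  induction l with
  | cons c l ih => exact ih.addLeft c
  | nil =>
    refine ⟨_, _, ⟨rfl, rfl, rfl, rfl⟩, ⟨rfl, rfl, rfl, rfl⟩, fun X => ?_⟩
    change 𝟙 _ ≫ T.actMap (T.crossAt X a b o ▷ T.obj c) r ≫ 𝟙 _ ≫
        T.actMap (T.crossAt (X ⊗ T.obj b) a c o) r ≫ 𝟙 _ ≫
        T.actMap (T.crossAt X b c o ▷ T.obj a) r ≫ 𝟙 _ =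
      𝟙 _ ≫ T.actMap (T.crossAt (X ⊗ T.obj a) b c o) r ≫ 𝟙 _ ≫
        T.actMap (T.crossAt X a c o ▷ T.obj b) r ≫ 𝟙 _ ≫
        T.actMap (T.crossAt (X ⊗ T.obj c) a b o) r ≫ 𝟙 _
    simp only [Category.comp_id, Category.id_comp, ← actMap_comp]
    rw [yangBaxterAt]

theorem sameOp_of_move {a b : List Slice} (h : Move a b) : T.SameOp a b := by
  cases h with
  | exchange l m r e f => exact T.sameOp_exchange l m r e f
  | zigzag_left l r b => exact T.sameOp_zigzag_left l r b
  | zigzag_right l r b => exact T.sameOp_zigzag_right l r b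
  | slide_cap l r x b o => exact T.sameOp_slide_cap l r x b o
  | slide_cup l r x b o => exact T.sameOp_slide_cup l r x b o
  | reidemeister1_cap l r b o => exact T.sameOp_reidemeister1_cap l r b o
  | reidemeister1_cup l r b o => exact T.sameOp_reidemeister1_cup l r b o
  | reidemeister2 l r a b o => exact T.sameOp_reidemeister2 l r a b o
  | reidemeister3 l r a b c o => exact T.sameOp_reidemeister3 l r a b c o

theorem op_eq_of_step (X : C) {D D' : LinkDiagram} (h : D.Step D') :
    T.op X D.1 [] [] D.2 = T.op X D'.1 [] [] D'.2 := by
  obtain ⟨D, hD⟩ := D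
  obtain ⟨D', hD'⟩ := D'
  obtain ⟨x, a, b, y, hm, h1, h2⟩ := h
  dsimp only at h1 h2
  subst h1 h2
  obtain ⟨q, h1, h2⟩ := hD.exists_of_append
  obtain ⟨p, h3, h4⟩ := h1.exists_of_append
  obtain ⟨q', h1', h2'⟩ := hD'.exists_of_append
  obtain ⟨p', h3', h4'⟩ := h1'.exists_of_append
  obtain rfl := h3.tgt_unique h3'
  obtain ⟨p₀, q₀, ha, hb, hab⟩ := T.sameOp_of_move hm
  -- The first side of every move contains a slice, so its lower ends are determined. For an empty
  -- list any ends would be possible.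
  have hne : a ≠ [] := by rintro rfl; cases hm
  obtain rfl := IsTangle.src_unique hne h4 ha
  obtain rfl := h4.tgt_unique ha
  obtain rfl := h4'.tgt_unique hb
  dsimp only
  rw [T.op_append X h1 h2, T.op_append X h3 h4, T.op_append X h1' h2', T.op_append X h3 h4', hab]

theorem op_eq_of_ambientIsotopic (X : C) {D D' : LinkDiagram} (h : D.AmbientIsotopic D') :
    T.op X D.1 [] [] D.2 = T.op X D'.1 [] [] D'.2 := by
  induction h with
  | rel _ _ h => exact T.op_eq_of_step X h
  | refl => rfl
  | symm _ _ _ ih => exact ih.symm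
  | trans _ _ _ _ _ ih₁ ih₂ => exact ih₁.trans ih₂

end TangleData

end Invariance

end RibbonQuasi
end

/-! ### Tangle morphisms from a braiding, a dual and a ribbon scalar -/

noncomputable section

namespace RibbonQuasi

open CategoryTheory MonoidalCategory

universe u v w

section BraidedTangles

variable {C : Type u} [Category.{v} C] [MonoidalCategory C]

section Braided

variable [BraidedCategory C]

/-- Naturality slides `e` through the crossing of `x` with `b ⊗ c`. A hexagon splits that crossing
in two, and crossing the unit object is trivial. -/
theorem braiding_slide_cap {b c : C} (x : C) (e : b ⊗ c ⟶ 𝟙_ C) :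
    b ◁ (β_ x c).hom ⊗≫ e ▷ x ⊗≫ 𝟙 x = 𝟙 _ ⊗≫ (β_ x b).inv ▷ c ⊗≫ x ◁ e ⊗≫ 𝟙 x := by
  symm
  calc
    _ = 𝟙 _ ⊗≫ (β_ x b).inv ▷ c ⊗≫ (x ◁ e ≫ (β_ x (𝟙_ C)).hom) ⊗≫ 𝟙 x := by
      rw [braiding_tensorUnit_right]; monoidal
    _ = 𝟙 _ ⊗≫ ((β_ x b).inv ≫ (β_ x b).hom) ▷ c ⊗≫ b ◁ (β_ x c).hom ⊗≫ e ▷ x ⊗≫ 𝟙 x := by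
      rw [BraidedCategory.braiding_naturality_right, BraidedCategory.braiding_tensor_right_hom]
      monoidal
    _ = _ := by rw [Iso.inv_hom_id]; monoidal

theorem braiding_slide_cup {b c : C} (x : C) (d : 𝟙_ C ⟶ b ⊗ c) :
    𝟙 x ⊗≫ d ▷ x ⊗≫ b ◁ (β_ c x).hom = 𝟙 x ⊗≫ x ◁ d ⊗≫ (β_ b x).inv ▷ c ⊗≫ 𝟙 _ := by
  symm
  calc
    _ = 𝟙 x ⊗≫ ((β_ (𝟙_ C) x).hom ≫ x ◁ d) ⊗≫ (β_ b x).inv ▷ c ⊗≫ 𝟙 _ := by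
      rw [braiding_tensorUnit_left]; monoidal
    _ = 𝟙 x ⊗≫ d ▷ x ⊗≫ b ◁ (β_ c x).hom ⊗≫ ((β_ b x).hom ≫ (β_ b x).inv) ▷ c ⊗≫ 𝟙 _ := by
      rw [← BraidedCategory.braiding_naturality_left, BraidedCategory.braiding_tensor_left_hom]
      monoidal
    _ = _ := by rw [Iso.hom_inv_id]; monoidal

theorem braiding_yang_baxter (X Y Z : C) :
    (β_ X Y).hom ▷ Z ⊗≫ Y ◁ (β_ X Z).hom ⊗≫ (β_ Y Z).hom ▷ X =
      𝟙 _ ⊗≫ X ◁ (β_ Y Z).hom ⊗≫ (β_ X Z).hom ▷ Y ⊗≫ Z ◁ (β_ X Y).hom ⊗≫ 𝟙 _ := by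
  have h := BraidedCategory.yang_baxter X Y Z
  calc
    _ = 𝟙 _ ⊗≫ ((α_ X Y Z).inv ≫ (β_ X Y).hom ▷ Z ≫ (α_ Y X Z).hom ≫
        Y ◁ (β_ X Z).hom ≫ (α_ Y Z X).inv ≫ (β_ Y Z).hom ▷ X ≫ (α_ Z Y X).hom) ⊗≫ 𝟙 _ := by
      monoidal
    _ = _ := by rw [h]; monoidal

/-- The partial trace of a crossing is a vertical strand, if the strand is closed by the swapped
evaluation. -/
theorem partialTrace_braiding (V V' : C) [ExactPairing V V'] :
    partialTrace (η_ V V') ((β_ V V').hom ≫ ε_ V V') (β_ V V).hom = 𝟙 V := by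
  calc
    -- The crossing of `V` with `V` and the one hidden in the closing form the crossing of `V` with
    -- `V ⊗ V'`. The coevaluation slides through it and leaves a zigzag.
    _ = 𝟙 _ ⊗≫ (V ◁ η_ V V' ≫ (β_ V (V ⊗ V')).hom) ⊗≫ V ◁ ε_ V V' ⊗≫ 𝟙 _ := by
      rw [BraidedCategory.braiding_tensor_right_hom]; simp only [partialTrace]; monoidal
    _ = 𝟙 _ ⊗≫ (η_ V V' ▷ V ⊗≫ V ◁ ε_ V V') ⊗≫ 𝟙 _ := by
      rw [BraidedCategory.braiding_naturality_right, braiding_tensorUnit_right]; monoidal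
    _ = _ := by rw [ExactPairing.evaluation_coevaluation'']; monoidal

end Braided

theorem partialTrace_conj {V V' : C} (X : C) (d : 𝟙_ C ⟶ V ⊗ V') (e : V ⊗ V' ⟶ 𝟙_ C)
    (f : V ⊗ V ⟶ V ⊗ V) :
    partialTrace d e ((α_ X V V).hom ≫ X ◁ f ≫ (α_ X V V).inv) = X ◁ partialTrace d e f := by
  simp only [partialTrace]
  monoidal

section Linear

variable {K : Type w} [Field K] [Preadditive C] [Linear K C]

theorem smul_monoidalComp {W X Y Z : C} [MonoidalCoherence X Y] (c : K) (f : W ⟶ X) (g : Y ⟶ Z) :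
    (c • f) ⊗≫ g = c • (f ⊗≫ g) := by
  simp [monoidalComp]

theorem monoidalComp_smul {W X Y Z : C} [MonoidalCoherence X Y] (c : K) (f : W ⟶ X) (g : Y ⟶ Z) :
    f ⊗≫ (c • g) = c • (f ⊗≫ g) := by
  simp [monoidalComp]

variable [MonoidalPreadditive C] [MonoidalLinear K C]

/-- Rescaling of an exact pairing. -/
@[reducible]
def scalePairing {X Y : C} (p : ExactPairing X Y) (c c' : K) (h : c * c' = 1) :
    ExactPairing X Y where
  coevaluation' := c • p.coevaluation'
  evaluation' := c' • p.evaluation'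
  coevaluation_evaluation' := by
    simp [smul_smul, mul_comm c' c, h, p.coevaluation_evaluation']
  evaluation_coevaluation' := by
    simp [smul_smul, mul_comm c' c, h, p.evaluation_coevaluation']

theorem partialTrace_smul_left {W V V' : C} (d : 𝟙_ C ⟶ V ⊗ V') (e : V ⊗ V' ⟶ 𝟙_ C) (c : K)
    (f : W ⊗ V ⟶ W ⊗ V) : partialTrace d (c • e) f = c • partialTrace d e f := by
  simp [partialTrace, smul_monoidalComp, monoidalComp_smul]

variable [BraidedCategory C]

/-- An object with a dual on which the ribbon element acts by a scalar `k` with inverse `k'`. -/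
structure RibbonScalar (K : Type w) [Field K] [Linear K C] (V V' : C) [ExactPairing V V'] where
  k : K
  k' : K
  s : K
  mul_inv : k * k' = 1
  sign : s * s = 1
  double_braiding : (β_ V' V).hom ≫ (β_ V V').hom ≫ ε_ V V' = (k * k) • ε_ V V'

namespace RibbonScalar

variable {V V' : C} [ExactPairing V V'] (r : RibbonScalar K V V')

theorem braiding_evaluation :
    (β_ V V').hom ≫ ε_ V V' = (r.k * r.k) • (β_ V' V).inv ≫ ε_ V V' := by
  rw [← cancel_epi (β_ V' V).hom, r.double_braiding]
  simp

/-- The swapped pairing of `V'` and `V` formed with the braiding and the one formed with the reverse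
braiding have proportional evaluations by `braiding_evaluation`. After rescaling, the evaluations
agree, hence so do the coevaluations. -/
theorem coevaluation_braiding :
    η_ V V' ≫ (β_ V V').hom = (r.k * r.k) • η_ V V' ≫ (β_ V' V).inv := by
  have hk : (r.k' * r.k') * (r.k * r.k) = 1 := by
    have := r.mul_inv
    linear_combination (r.k * r.k' + 1) * this
  have h := coevaluation_whiskerLeft
    (scalePairing (@BraidedCategory.exactPairing_swap C _ _ (reverseBraiding C) V V' _) (r.k' * r.k') (r.k * r.k) hk)
    (BraidedCategory.exactPairing_swap V V') (𝟙 _) (by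
      rw [id_whiskerRight, Category.id_comp]
      exact r.braiding_evaluation)
  rw [whiskerLeft_id, Category.comp_id] at h
  change (r.k' * r.k') • (η_ V V' ≫ (β_ V V').hom) = η_ V V' ≫ (β_ V' V).inv at h
  rw [← h, smul_smul, mul_comm, hk, one_smul]

/-- The closing of a strand on its right. -/
def closing : V ⊗ V' ⟶ 𝟙_ C := r.k' • (β_ V V').hom ≫ ε_ V V'

/-- The closing has one form with the braiding and one with its inverse. The second makes the
partial trace of an inverse crossing the mirror image of `partialTrace_braiding`. -/
theorem closing_eq : r.closing = r.k • (β_ V' V).inv ≫ ε_ V V' := by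
  rw [closing, r.braiding_evaluation, smul_smul]
  congr 1
  have := r.mul_inv
  linear_combination r.k * this

theorem partialTrace_braiding_hom :
    partialTrace (η_ V V') r.closing (β_ V V).hom = r.k' • 𝟙 V := by
  rw [closing, partialTrace_smul_left, partialTrace_braiding]

theorem partialTrace_braiding_inv :
    partialTrace (η_ V V') r.closing (β_ V V).inv = r.k • 𝟙 V := by
  rw [closing_eq, partialTrace_smul_left]
  exact congrArg _ (@partialTrace_braiding C _ _ (reverseBraiding C) V V' _)

/-- The object of a strand. -/
def obj (V V' : C) : Bool → C
  | true => V
  | false => V'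

/-- The crossings. -/
def braid (V V' : C) (a b : Bool) : Bool → (obj V V' a ⊗ obj V V' b ⟶ obj V V' b ⊗ obj V V' a)
  | true => (β_ _ _).hom
  | false => (β_ _ _).inv

/-- The weight of a crossing. -/
def weight (a b o : Bool) : K := if o = (a == b) then r.s * r.k else r.s * r.k'

theorem weight_mul (a b o : Bool) : r.weight a b o * r.weight b a (!o) = 1 := by
  have h1 := r.mul_inv
  have h2 := r.sign
  cases a <;> cases b <;> cases o <;> simp [weight] <;> linear_combination r.k * r.k' * h2 + h1

/-- The weight depends only on the sign of the crossing, which is recorded by `o = (a == b)`.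
Sliding past an extremum reverses one orientation and also over and under, so the sign is unchanged.
-/
theorem weight_slide (x b c o : Bool) (h : b ≠ c) : r.weight x c o = r.weight b x (!o) := by
  revert h
  cases x <;> cases b <;> cases c <;> cases o <;> simp [weight]

theorem weight_slide' (x b c o : Bool) (h : b ≠ c) : r.weight c x o = r.weight x b (!o) := by
  revert h
  cases x <;> cases b <;> cases c <;> cases o <;> simp [weight]

/-- The minima. -/
def cup : (b c : Bool) → (𝟙_ C ⟶ obj V V' b ⊗ obj V V' c)
  | true, false => r.s • η_ V V'
  | false, true => r.k • η_ V V' ≫ (β_ V' V).inv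
  | true, true => 0
  | false, false => 0

/-- The maxima. -/
def cap : (b c : Bool) → (obj V V' b ⊗ obj V V' c ⟶ 𝟙_ C)
  | true, false => r.closing
  | false, true => r.s • ε_ V V'
  | true, true => 0
  | false, false => 0

/-- One orientation uses the duality of `V` and `V'` with the scalars `s`, `s`, the other the
swapped duality with `k`, `k'`. The scalars cancel because `s * s = 1` and `k * k' = 1`. -/
theorem zigzag_left (b c : Bool) (h : b ≠ c) :
    r.cup b c ▷ obj V V' b ⊗≫ obj V V' b ◁ r.cap c b = ⊗𝟙.hom := by
  cases b <;> cases c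
  · exact absurd rfl h
  · change (r.k • η_ V V' ≫ (β_ V' V).inv) ▷ V' ⊗≫ V' ◁ (r.k' • (β_ V V').hom ≫ ε_ V V') = ⊗𝟙.hom
    rw [MonoidalLinear.smul_whiskerRight, MonoidalLinear.whiskerLeft_smul,
      smul_monoidalComp, monoidalComp_smul, smul_smul, r.mul_inv, one_smul]
    exact @ExactPairing.evaluation_coevaluation'' _ _ _ V' V
      (BraidedCategory.exactPairing_swap V V')
  · change (r.s • η_ V V') ▷ V ⊗≫ V ◁ (r.s • ε_ V V') = ⊗𝟙.hom
    rw [MonoidalLinear.smul_whiskerRight, MonoidalLinear.whiskerLeft_smul,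
      smul_monoidalComp, monoidalComp_smul, smul_smul, r.sign, one_smul]
    exact ExactPairing.evaluation_coevaluation'' V V'
  · exact absurd rfl h

theorem zigzag_right (b c : Bool) (h : b ≠ c) :
    obj V V' b ◁ r.cup c b ⊗≫ r.cap b c ▷ obj V V' b = ⊗𝟙.hom := by
  cases b <;> cases c
  · exact absurd rfl h
  · change V' ◁ (r.s • η_ V V') ⊗≫ (r.s • ε_ V V') ▷ V' = ⊗𝟙.hom
    rw [MonoidalLinear.smul_whiskerRight, MonoidalLinear.whiskerLeft_smul,
      smul_monoidalComp, monoidalComp_smul, smul_smul, r.sign, one_smul]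
    exact ExactPairing.coevaluation_evaluation'' V V'
  · change V ◁ (r.k • η_ V V' ≫ (β_ V' V).inv) ⊗≫ (r.k' • (β_ V V').hom ≫ ε_ V V') ▷ V = ⊗𝟙.hom
    rw [MonoidalLinear.smul_whiskerRight, MonoidalLinear.whiskerLeft_smul,
      smul_monoidalComp, monoidalComp_smul, smul_smul, r.mul_inv, one_smul]
    exact @ExactPairing.coevaluation_evaluation'' _ _ _ V' V
      (BraidedCategory.exactPairing_swap V V')
  · exact absurd rfl h

/-- The weights are chosen for this move. Unweighted, the crossing changes a maximum into the
opposite one up to a power of `k`; the weight `s k` or `s k'` supplies the compensating power, and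
its `s` matches the scalar of one maximum. -/
theorem cross_cap (b c o : Bool) (h : b ≠ c) :
    (r.weight b c o • braid V V' b c o) ≫ r.cap c b = r.cap b c := by
  have h1 := r.mul_inv
  have h2 := r.sign
  cases b <;> cases c
  · exact absurd rfl h
  · cases o
    · change ((r.s * r.k) • (β_ V V').inv) ≫ (r.k' • (β_ V V').hom ≫ ε_ V V') = r.s • ε_ V V'
      rw [Linear.smul_comp, Linear.comp_smul, Iso.inv_hom_id_assoc, smul_smul]
      refine congrArg (· • _) ?_
      linear_combination r.s * h1
    · change ((r.s * r.k') • (β_ V' V).hom) ≫ (r.k' • (β_ V V').hom ≫ ε_ V V') = r.s • ε_ V V'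
      rw [Linear.smul_comp, Linear.comp_smul, r.double_braiding, smul_smul, smul_smul]
      refine congrArg (· • _) ?_
      linear_combination r.s * (r.k * r.k' + 1) * h1
  · cases o
    · change ((r.s * r.k) • (β_ V' V).inv) ≫ (r.s • ε_ V V') = r.closing
      rw [Linear.smul_comp, Linear.comp_smul, r.closing_eq, smul_smul]
      refine congrArg (· • _) ?_
      linear_combination r.k * h2
    · change ((r.s * r.k') • (β_ V V').hom) ≫ (r.s • ε_ V V') = r.k' • (β_ V V').hom ≫ ε_ V V'
      rw [Linear.smul_comp, Linear.comp_smul, smul_smul]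
      refine congrArg (· • _) ?_
      linear_combination r.k' * h2
  · exact absurd rfl h

/-- As for the maxima, with `coevaluation_braiding` in place of the double braiding axiom. -/
theorem cup_cross (b c o : Bool) (h : b ≠ c) :
    r.cup b c ≫ (r.weight b c o • braid V V' b c o) = r.cup c b := by
  have h1 := r.mul_inv
  have h2 := r.sign
  have h4 := r.coevaluation_braiding
  have h3 : (r.k * r.k) • (η_ V V' ≫ (β_ V' V).inv ≫ (β_ V V').inv) = η_ V V' := by
    have := congrArg (fun f => f ≫ (β_ V V').inv) h4
    simpa only [Category.assoc, Iso.hom_inv_id, Category.comp_id, Linear.smul_comp]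
      using this.symm
  cases b <;> cases c
  · exact absurd rfl h
  · cases o
    · change (r.k • η_ V V' ≫ (β_ V' V).inv) ≫ ((r.s * r.k) • (β_ V V').inv) = r.s • η_ V V'
      rw [Linear.smul_comp, Linear.comp_smul, smul_smul, Category.assoc]
      conv_rhs => rw [← h3, smul_smul]
      refine congrArg (· • _) ?_
      ring
    · change (r.k • η_ V V' ≫ (β_ V' V).inv) ≫ ((r.s * r.k') • (β_ V' V).hom) = r.s • η_ V V'
      rw [Linear.smul_comp, Linear.comp_smul, smul_smul, Category.assoc, Iso.inv_hom_id,
        Category.comp_id]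
      refine congrArg (· • _) ?_
      linear_combination r.s * h1
  · cases o
    · change (r.s • η_ V V') ≫ ((r.s * r.k) • (β_ V' V).inv) = r.k • η_ V V' ≫ (β_ V' V).inv
      rw [Linear.smul_comp, Linear.comp_smul, smul_smul]
      refine congrArg (· • _) ?_
      linear_combination r.k * h2
    · change (r.s • η_ V V') ≫ ((r.s * r.k') • (β_ V V').hom) = r.k • η_ V V' ≫ (β_ V' V).inv
      rw [Linear.smul_comp, Linear.comp_smul, smul_smul, h4, smul_smul]
      refine congrArg (· • _) ?_
      linear_combination r.k * r.k * r.k' * h2 + r.k * h1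
  · exact absurd rfl h

theorem yang_baxter (a b c o : Bool) :
    braid V V' a b o ▷ obj V V' c ⊗≫ obj V V' b ◁ braid V V' a c o ⊗≫
        braid V V' b c o ▷ obj V V' a =
      𝟙 _ ⊗≫ obj V V' a ◁ braid V V' b c o ⊗≫ braid V V' a c o ▷ obj V V' b ⊗≫
        obj V V' c ◁ braid V V' a b o ⊗≫ 𝟙 _ := by
  cases o
  · exact @braiding_yang_baxter C _ _ (reverseBraiding C) _ _ _
  · exact braiding_yang_baxter _ _ _

/-- The morphisms of oriented tangles. -/
def tangleData : TangleData C where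
  obj := obj V V'
  cup := r.cup
  cap := r.cap
  cross a b o := r.weight a b o • braid V V' a b o
  zigzag_left := r.zigzag_left
  zigzag_right := r.zigzag_right
  slide_cap x b c o h := by
    simp only [MonoidalLinear.smul_whiskerRight, MonoidalLinear.whiskerLeft_smul,
      smul_monoidalComp, monoidalComp_smul, r.weight_slide x b c o h]
    congr 1
    cases o
    · exact @braiding_slide_cap C _ _ (reverseBraiding C) _ _ _ _
    · exact braiding_slide_cap _ _
  slide_cup x b c o h := by
    simp only [MonoidalLinear.smul_whiskerRight, MonoidalLinear.whiskerLeft_smul,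
      smul_monoidalComp, monoidalComp_smul, r.weight_slide' x b c o h]
    congr 1
    cases o
    · exact @braiding_slide_cup C _ _ (reverseBraiding C) _ _ _ _
    · exact braiding_slide_cup _ _
  cross_cap := r.cross_cap
  cup_cross := r.cup_cross
  cross_cross a b o := by
    simp only [Linear.smul_comp, Linear.comp_smul, smul_smul, mul_comm, r.weight_mul]
    cases o <;> simp [braid]
  yang_baxter a b c o := by
    simp only [MonoidalLinear.smul_whiskerRight, MonoidalLinear.whiskerLeft_smul,
      smul_monoidalComp, monoidalComp_smul, smul_smul, yang_baxter]
    refine congrArg (· • _) ?_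
    ring

end RibbonScalar

end Linear

end BraidedTangles

end RibbonQuasi
end

/-! ### The element `u` and the Drinfeld twist as mates of pairings -/

noncomputable section

namespace RibbonQuasi

open CategoryTheory MonoidalCategory

universe u v w

namespace RepCat

section Mates

variable {K : Type v} [Field K] {A : Type u} [Ring A] [Algebra K A]
  {H : QuasiTriangularQuasiHopfAlgebra K A}

/-- `x ⊗ y ⊗ z ↦ x ⊗ y β S(z)` -/
def mateElt (H : QuasiTriangularQuasiHopfAlgebra K A) :
    (A ⊗[K] A) ⊗[K] A →ₗ[K] A ⊗[K] A :=
  TensorProduct.map LinearMap.id (antiRight H.S H.β) ∘ₗ (TensorProduct.assoc K A A A).toLinearMap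

@[simp]
theorem mateElt_tmul (a b c : A) :
    mateElt H ((a ⊗ₜ[K] b) ⊗ₜ[K] c) = a ⊗ₜ (b * (H.β * H.S c)) := rfl

theorem lid_map_coevElt (P Q : RepCat H) (h : P.carrier ⊗[K] Q.carrier →ₗ[K] K)
    (t : (A ⊗[K] A) ⊗[K] A) (p : P.carrier) (q : Q.carrier) :
    TensorProduct.lid K (Module.Dual K Q.carrier) (TensorProduct.map h LinearMap.id
      (tensRep₃ P Q (dual Q) t ((TensorProduct.assoc K P.carrier Q.carrier _).symm
        (p ⊗ₜ coevElt Q)))) q =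
      h (tensRep P.ρ Q.ρ (mateElt H t) (p ⊗ₜ q)) := by
  induction t using tensor₃_induction with
  | zero => simp only [map_zero, LinearMap.zero_apply]
  | add s t hs ht => simp only [map_add, LinearMap.add_apply, hs, ht]
  | tmul a b c =>
    simp only [coevElt, TensorProduct.tmul_sum, map_sum, tensRep_tmul, TensorProduct.map_tmul,
      TensorProduct.assoc_symm_tmul, LinearMap.id_apply, TensorProduct.lid_tmul, mateElt_tmul,
      LinearMap.sum_apply, LinearMap.smul_apply, dualRep_apply_apply]
    conv_rhs => rw [map_mul, map_mul, Module.End.mul_apply, Module.End.mul_apply,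
      ← sum_coord Q (Q.ρ (H.S c) q)]
    simp only [map_sum, map_smul, TensorProduct.tmul_sum, TensorProduct.tmul_smul, smul_eq_mul,
      mul_comm]

/-- The inverse associator in the mate contributes `Φ = ∑ X ⊗ Y ⊗ Z`. The leg `Z` acts on the dual
through `S`, and moving it across the coevaluation, which carries `β`, puts `Y β S(Z)` on `Q`. This
is the origin of that expression in both `u` and `𝓕`. -/
theorem lin_mate (P Q : RepCat H) (h : P ⊗ Q ⟶ 𝟙_ (RepCat H)) (p : P.carrier) (q : Q.carrier) :
    (lin (mate (dual Q) h) p : Module.Dual K Q.carrier) q =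
      lin h (tensRep P.ρ Q.ρ (mateElt H ↑H.Φ) (p ⊗ₜ q)) := by
  rw [← lid_map_coevElt P Q (lin h) ↑H.Φ p q]
  change TensorProduct.lid K (Module.Dual K Q.carrier) (TensorProduct.map (lin h) LinearMap.id
      (tensRep₃ P Q (dual Q) ↑H.Φ ((TensorProduct.assoc K P.carrier Q.carrier _).symm
        (p ⊗ₜ ((1 : K) • coevElt Q))))) q = _
  rw [one_smul]

/-- The pairing of `X` with its dual given by the braiding. -/
def braidEv (X : RepCat H) : X ⊗ dual X ⟶ 𝟙_ (RepCat H) := (β_ X (dual X)).hom ≫ ε_ X (dual X)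

theorem lin_braidEv_tensRep (X : RepCat H) (t : A ⊗[K] A) (x : X.carrier)
    (φ : Module.Dual K X.carrier) :
    lin (braidEv X) (tensRep X.ρ (dualRep X) t (x ⊗ₜ φ)) =
      φ (X.ρ (antiLeft H.S (antiLeft H.S H.α (flip K A ↑H.R)) (flip K A t)) x) := by
  have h0 : ∀ (x : X.carrier) (φ : Module.Dual K X.carrier), lin (braidEv X) (x ⊗ₜ φ) =
      φ (X.ρ (antiLeft H.S H.α (flip K A ↑H.R)) x) := fun x φ =>
    (congrArg (evLin X) (comm_tensRep X.ρ (dualRep X) ↑H.R (x ⊗ₜ φ))).trans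
      (evLin_tensRep X _ φ x)
  induction t with
  | zero => simp
  | add s t hs ht => simp only [map_add, LinearMap.add_apply, hs, ht]
  | tmul a b =>
    rw [tensRep_tmul, TensorProduct.map_tmul, h0]
    simp [antiLeft, flip]

/-- The morphism to the double dual given by the braiding. -/
def toBidual (X : RepCat H) : X ⟶ dual (dual X) := mate (dual (dual X)) (braidEv X)

/-- The conceptual meaning of the formula for `u`: the braided pairing contributes `∑ S(b) α a` from
`R`, and passing to its mate contributes the legs of `Φ`. -/
theorem lin_toBidual (X : RepCat H) (x : X.carrier) (φ : Module.Dual K X.carrier) :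
    (lin (toBidual X) x : Module.Dual K (Module.Dual K X.carrier)) φ = φ (X.ρ H.u x) := by
  refine (lin_mate X (dual X) (braidEv X) x φ).trans ?_
  rw [lin_braidEv_tensRep]
  refine congrArg (fun a => φ (X.ρ a x)) ?_
  rw [QuasiTriangularQuasiHopfAlgebra.u]
  generalize (H.Φ : (A ⊗[K] A) ⊗[K] A) = t
  induction t using tensor₃_induction with
  | zero => simp only [map_zero]
  | add s t hs ht => simp only [map_add, hs, ht]
  | tmul a b c => simp [antiLeft, antiRight, flip, mul_assoc]

theorem toBidual_evaluation (X : RepCat H) :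
    toBidual X ▷ dual X ≫ ε_ (dual X) (dual (dual X)) = braidEv X :=
  mate_whiskerRight_evaluation _ _

/-- The pairing is the evaluation of `X*` after `toBidual`. That evaluation lets `α` act on the
functional, that is, by `S(α)` on the vector. -/
theorem lin_braidEv (X : RepCat H) (x : X.carrier) (φ : Module.Dual K X.carrier) :
    lin (braidEv X) (x ⊗ₜ φ) = φ (X.ρ (H.S H.α * H.u) x) := by
  rw [← toBidual_evaluation]
  change (lin (toBidual X) x : Module.Dual K (Module.Dual K X.carrier)) (dualRep X H.α φ) = _
  rw [lin_toBidual, map_mul]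
  rfl

/-- `toBidual` is an intertwiner and `A` acts on the double dual through `S²`. Functionals separate
points, so the identity follows in every finite-dimensional representation. -/
theorem u_mul (X : RepCat H) (a : A) : X.ρ (H.u * a) = X.ρ (H.S (H.S a) * H.u) := by
  ext x
  rw [← sub_eq_zero, ← Module.forall_dual_apply_eq_zero_iff K]
  intro φ
  have h := LinearMap.congr_fun (lin_ρ (toBidual X) a x) φ
  rw [map_sub, sub_eq_zero, map_mul, Module.End.mul_apply, map_mul, Module.End.mul_apply]
  refine (lin_toBidual X (X.ρ a x) φ).symm.trans (h.trans ?_)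
  exact lin_toBidual X x (φ ∘ₗ X.ρ (H.S (H.S a)))

/-- Naturality of the braiding moves `toBidual` to the other factor, which turns the pairing into
that of `X*` with `X**`. Two applications of `u` give `S(S(α) u) u = S(u) S²(α) u`, and `S²(α) u = u
α` in the representation by `u_mul`. -/
theorem lin_double_braiding (X : RepCat H) (x : X.carrier) (φ : Module.Dual K X.carrier) :
    lin ((β_ (dual X) X).hom ≫ braidEv X) (φ ⊗ₜ x) = φ (X.ρ (H.S H.u * H.u * H.α) x) := by
  have h : (β_ (dual X) X).hom ≫ braidEv X = dual X ◁ toBidual X ≫ braidEv (dual X) := by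
    rw [← toBidual_evaluation, braidEv, BraidedCategory.braiding_naturality_right_assoc]
  rw [h]
  refine (lin_braidEv (dual X) φ (lin (toBidual X) x)).trans ?_
  refine (lin_toBidual X x _).trans ?_
  change φ (X.ρ (H.S (H.S H.α * H.u)) (X.ρ H.u x)) = _
  rw [← Module.End.mul_apply, ← map_mul, H.S_mul, mul_assoc, mul_assoc (H.S H.u),
    map_mul X.ρ (H.S H.u) (H.S (H.S H.α) * H.u), ← u_mul, ← map_mul]

end Mates

section Nested

variable {K : Type v} [Field K] {A : Type u} [Ring A] [Algebra K A]
  {H : QuasiTriangularQuasiHopfAlgebra K A}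

/-- The product of two functionals. -/
def pairTmul {M N : Type*} [AddCommGroup M] [AddCommGroup N] [Module K M] [Module K N]
    (f : Module.Dual K M) (g : Module.Dual K N) : Module.Dual K (M ⊗[K] N) :=
  LinearMap.mul' K K ∘ₗ TensorProduct.map f g

@[simp]
theorem pairTmul_tmul {M N : Type*} [AddCommGroup M] [AddCommGroup N] [Module K M] [Module K N]
    (f : Module.Dual K M) (g : Module.Dual K N) (m : M) (n : N) :
    pairTmul f g (m ⊗ₜ n) = f m * g n := rfl

/-- `a ⊗ b ⊗ c ⊗ d ↦ S(b) α c ⊗ S(a) α d` -/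
def nestedElt (H : QuasiHopfAlgebra K A) :
    ((A ⊗[K] A) ⊗[K] A) ⊗[K] A →ₗ[K] A ⊗[K] A :=
  TensorProduct.map (antiLeft H.S H.α) (antiLeft H.S H.α) ∘ₗ
    (TensorProduct.assoc K (A ⊗[K] A) A A).toLinearMap ∘ₗ
    TensorProduct.map (TensorProduct.comm K A (A ⊗[K] A)).toLinearMap LinearMap.id ∘ₗ
    TensorProduct.map (TensorProduct.assoc K A A A).toLinearMap LinearMap.id

theorem tensor_evaluation_eq {C : Type u} [Category.{v} C] [MonoidalCategory C] {W V W' V' : C}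
    [ExactPairing W W'] [ExactPairing V V'] :
    ε_ (W ⊗ V) (V' ⊗ W') = (α_ (V' ⊗ W') W V).inv ≫ (α_ V' W' W).hom ▷ V ≫
      (V' ◁ ε_ W W') ▷ V ≫ (ρ_ V').hom ▷ V ≫ ε_ V V' := by
  rw [ExactPairing.tensor_evaluation]
  monoidal

theorem associator_left_inv_apply (W X Y Z : RepCat H)
    (x : (W.carrier ⊗[K] X.carrier) ⊗[K] (Y.carrier ⊗[K] Z.carrier)) :
    lin (α_ (W ⊗ X) Y Z).inv x = tensRep₄ W X Y Z (comul1_3 H.Δ ↑H.Φ)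
      ((TensorProduct.assoc K (W.carrier ⊗[K] X.carrier) Y.carrier Z.carrier).symm x) := by
  change tensRep (tensRep ((tensRep W.ρ X.ρ).comp H.Δ) Y.ρ) Z.ρ _ _ = _
  refine LinearMap.congr_fun ?_ _
  generalize (↑H.Φ : (A ⊗[K] A) ⊗[K] A) = t
  induction t using tensor₃_induction with
  | zero => simp only [map_zero]
  | add s t hs ht => simp only [map_add, hs, ht]
  | tmul a b c => simp [comul1_3, comul12]

/-- Reassociating the four factors for the nested evaluations lets `(Φ⁻¹ ⊗ 1)(Δ ⊗ 1 ⊗ 1)Φ` act. The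
inner evaluation contracts its middle legs, the outer one its first and last, which is the
definition of `γ`. -/
theorem lin_tensor_evaluation (W V : RepCat H) (φ : Module.Dual K V.carrier)
    (ψ : Module.Dual K W.carrier) (y : W.carrier ⊗[K] V.carrier) :
    lin (ε_ (W ⊗ V) (dual V ⊗ dual W)) ((φ ⊗ₜ[K] ψ) ⊗ₜ[K] y) =
      pairTmul ψ φ (tensRep W.ρ V.ρ H.gamma y) := by
  have h : ∀ (t : ((A ⊗[K] A) ⊗[K] A) ⊗[K] A) (w : W.carrier) (v : V.carrier),
      evLin V (TensorProduct.map (TensorProduct.rid K (Module.Dual K V.carrier)).toLinearMap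
        LinearMap.id (TensorProduct.map (TensorProduct.map LinearMap.id (evLin W)) LinearMap.id
          (TensorProduct.map (TensorProduct.assoc K (Module.Dual K V.carrier)
            (Module.Dual K W.carrier) W.carrier).toLinearMap LinearMap.id
              (tensRep₄ (dual V) (dual W) W V t (((φ ⊗ₜ ψ) ⊗ₜ w) ⊗ₜ v))))) =
        pairTmul ψ φ (tensRep W.ρ V.ρ (nestedElt H.toQuasiHopfAlgebra t) (w ⊗ₜ v)) := by
    intro t w v
    induction t with
    | zero => simp only [map_zero, LinearMap.zero_apply]
    | add s t hs ht => simp only [map_add, LinearMap.add_apply, hs, ht]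
    | tmul t d =>
      induction t using tensor₃_induction with
      | zero => simp only [TensorProduct.zero_tmul, map_zero, LinearMap.zero_apply]
      | add s t hs ht =>
        simp only [TensorProduct.add_tmul, map_add, LinearMap.add_apply, hs, ht]
      | tmul a b c => simp [nestedElt, antiLeft]
  induction y with
  | zero => simp
  | add x y hx hy => simp only [TensorProduct.tmul_add, map_add, hx, hy]
  | tmul w v =>
    refine Eq.trans ?_ (h _ w v)
    rw [map_mul, Module.End.mul_apply, tensor_evaluation_eq]
    refine (congrArg (fun z => evLin V (TensorProduct.map
      (TensorProduct.rid K (Module.Dual K V.carrier)).toLinearMap LinearMap.id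
        (TensorProduct.map (TensorProduct.map LinearMap.id (evLin W)) LinearMap.id
          (lin ((α_ (dual V) (dual W) W).hom ▷ V) z))))
      (associator_left_inv_apply (dual V) (dual W) W V ((φ ⊗ₜ ψ) ⊗ₜ (w ⊗ₜ v)))).trans ?_
    exact congrArg (fun z => evLin V (TensorProduct.map
      (TensorProduct.rid K (Module.Dual K V.carrier)).toLinearMap LinearMap.id
        (TensorProduct.map (TensorProduct.map LinearMap.id (evLin W)) LinearMap.id z)))
      (associator_whiskerRight_apply (dual V) (dual W) W V _)

/-- The morphism from the tensor product of the duals to the dual of the tensor product. -/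
def dualTensor (W V : RepCat H) : dual V ⊗ dual W ⟶ dual (tens W V) :=
  mate (Q := tens W V) (dual (tens W V)) (ε_ (W ⊗ V) (dual V ⊗ dual W))

/-- The twist appears as the mate of the nested evaluation: `γ` comes from the pairing, `(S ⊗
S)Δᵀ(X)` from the action on the two duals, and `Δ(Y β S(Z))` from `lin_mate`. -/
theorem lin_dualTensor (W V : RepCat H) (φ : Module.Dual K V.carrier)
    (ψ : Module.Dual K W.carrier) (y : W.carrier ⊗[K] V.carrier) :
    (lin (dualTensor W V) (φ ⊗ₜ ψ) : Module.Dual K (W.carrier ⊗[K] V.carrier)) y =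
      pairTmul ψ φ (tensRep W.ρ V.ρ H.drinfeldTwist y) := by
  refine (lin_mate (dual V ⊗ dual W) (tens W V) _ (φ ⊗ₜ ψ) y).trans ?_
  have h1 : ∀ (s r : A ⊗[K] A), lin (ε_ (W ⊗ V) (dual V ⊗ dual W))
      (tensRep (dualRep V) (dualRep W) s (φ ⊗ₜ[K] ψ) ⊗ₜ[K] tensRep W.ρ V.ρ r y) =
      pairTmul ψ φ (tensRep W.ρ V.ρ (TensorProduct.map H.S H.S (flip K A s) * H.gamma * r) y) := by
    intro s r
    induction s with
    | zero => simp
    | add s t hs ht =>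
      simp only [map_add, LinearMap.add_apply, TensorProduct.add_tmul, add_mul, hs, ht]
    | tmul a b =>
      refine (lin_tensor_evaluation W V (φ ∘ₗ V.ρ (H.S a)) (ψ ∘ₗ W.ρ (H.S b)) _).trans ?_
      rw [map_mul, map_mul, Module.End.mul_apply, Module.End.mul_apply]
      generalize tensRep W.ρ V.ρ H.gamma (tensRep W.ρ V.ρ r y) = z
      induction z with
      | zero => simp
      | add x y hx hy => simp only [map_add, hx, hy]
      | tmul w v => simp [flip]
  have h2 : ∀ t : (A ⊗[K] A) ⊗[K] A,
      lin (ε_ (W ⊗ V) (dual V ⊗ dual W))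
        (tensRep (dual V ⊗ dual W : RepCat H).ρ (tens W V).ρ (mateElt H t) ((φ ⊗ₜ ψ) ⊗ₜ y)) =
      pairTmul ψ φ (tensRep W.ρ V.ρ ((LinearMap.mul' K (A ⊗[K] A) ∘ₗ
        TensorProduct.map
          (LinearMap.mulRight K H.gamma ∘ₗ TensorProduct.map H.S H.S ∘ₗ
            (flip K A).toLinearMap ∘ₗ H.Δ.toLinearMap)
          (H.Δ.toLinearMap ∘ₗ antiRight H.S H.β) ∘ₗ
        (TensorProduct.assoc K A A A).toLinearMap) t) y) := by
    intro t
    induction t using tensor₃_induction with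
    | zero => simp only [map_zero, LinearMap.zero_apply]
    | add s t hs ht => simp only [map_add, LinearMap.add_apply, hs, ht]
    | tmul a b c =>
      refine (h1 (H.Δ a) (H.Δ (b * (H.β * H.S c)))).trans ?_
      simp [antiRight]
  exact h2 _

end Nested

end RepCat

end RibbonQuasi
end

/-! ### The pivot `u v⁻¹` and the quantum trace -/

noncomputable section

namespace RibbonQuasi

open CategoryTheory MonoidalCategory

universe u v w

namespace RepCat

section Ribbon

variable {K : Type v} [Field K] {A : Type u} [Ring A] [Algebra K A]
  {H : RibbonQuasiHopfAlgebra K A}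

local notation "Rep" => RepCat H.toQuasiTriangularQuasiHopfAlgebra

/-- The action of the inverse of the ribbon element. -/
def twistInv (X : Rep) : X ⟶ X :=
  ofLin (X.ρ ↑H.v⁻¹) fun a x => by
    have h : a * ↑H.v⁻¹ = ↑H.v⁻¹ * a := by
      rw [Units.mul_inv_eq_iff_eq_mul, mul_assoc, ← H.v_central, Units.inv_mul_cancel_left]
    rw [← Module.End.mul_apply, ← Module.End.mul_apply, ← map_mul, ← map_mul, h]

/-- The axiom gives the product in the order `u S(u)`. In the representation the factors can be
interchanged, because this product is the invertible central `v²` and the space is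
finite-dimensional. -/
theorem S_u_mul_u (X : Rep) : X.ρ (H.S H.u * H.u) = X.ρ ↑H.v ^ 2 := by
  have h1 : X.ρ H.u * X.ρ (H.S H.u) = X.ρ ↑H.v ^ 2 := by
    rw [← map_mul, ← H.v_sq, map_pow]
  have h2 : X.ρ H.u * (X.ρ (H.S H.u) * X.ρ ↑H.v⁻¹ ^ 2) = 1 := by
    rw [← mul_assoc, h1, ← map_pow, ← map_pow, ← map_mul, ← Units.val_pow_eq_pow_val,
      ← Units.val_pow_eq_pow_val, inv_pow, Units.mul_inv, map_one]
  -- A right inverse of an operator on a finite-dimensional space is also a left inverse.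
  have h3 := mul_eq_one_comm.1 h2
  have h4 : ∀ a : A, ↑H.v⁻¹ ^ 2 * a * (↑H.v : A) ^ 2 = a := by
    intro a
    rw [mul_assoc, ← (show Commute ((H.v : A) ^ 2) a from
      (show Commute (H.v : A) a from H.v_central a).pow_left 2).eq, ← mul_assoc,
      ← Units.val_pow_eq_pow_val, ← Units.val_pow_eq_pow_val, inv_pow, Units.inv_mul, one_mul]
  calc
    _ = X.ρ (H.S H.u) * X.ρ (↑H.v⁻¹ ^ 2 * H.u * (↑H.v : A) ^ 2) := by rw [h4, map_mul]
    _ = (X.ρ (H.S H.u) * X.ρ ↑H.v⁻¹ ^ 2 * X.ρ H.u) * X.ρ ↑H.v ^ 2 := by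
      simp only [map_mul, map_pow, mul_assoc]
    _ = _ := by rw [h3, one_mul]

theorem double_braiding (X : Rep) (z : K) (hz : X.ρ ↑H.v = z • 1) :
    (β_ (dual X) X).hom ≫ (β_ X (dual X)).hom ≫ ε_ X (dual X) = (z * z) • ε_ X (dual X) := by
  ext y
  induction y using TensorProduct.induction_on with
  | zero => simp only [map_zero]
  | add x y hx hy => simp only [map_add, hx, hy]
  | tmul φ x =>
    refine (lin_double_braiding X x φ).trans ?_
    rw [map_mul, S_u_mul_u, hz, smul_pow, one_pow]
    change φ ((z ^ 2) • X.ρ H.α x) = (z * z) * φ (X.ρ H.α x)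
    rw [map_smul, sq]
    rfl

/-- The pairing of `X` with its dual that closes a strand on its right. -/
def evRight (X : Rep) : X ⊗ dual X ⟶ 𝟙_ Rep := twistInv X ▷ dual X ≫ braidEv X

/-- The element `u v⁻¹`. -/
abbrev _root_.RibbonQuasi.RibbonQuasiHopfAlgebra.pivot (H : RibbonQuasiHopfAlgebra K A) : A :=
  H.u * ↑H.v⁻¹

theorem lin_evRight (X : Rep) (x : X.carrier) (φ : Module.Dual K X.carrier) :
    lin (evRight X) (x ⊗ₜ φ) = φ (X.ρ (H.S H.α * H.pivot) x) := by
  refine (lin_braidEv X (X.ρ ↑H.v⁻¹ x) φ).trans ?_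
  rw [← Module.End.mul_apply, ← map_mul, mul_assoc]

theorem evRight_eq_smul (X : Rep) (z : K) (hz : X.ρ ↑H.v⁻¹ = z • 1) :
    evRight X = z • braidEv X := by
  have h : twistInv X = z • 𝟙 X := by
    ext x
    exact LinearMap.congr_fun hz x
  rw [evRight, h, MonoidalLinear.smul_whiskerRight, Linear.smul_comp, id_whiskerRight,
    Category.id_comp]

/-- The morphism to the double dual given by `u v⁻¹`. -/
def pivotIso (X : Rep) : X ⟶ dual (dual X) := twistInv X ≫ toBidual X

theorem lin_pivotIso (X : Rep) (x : X.carrier) (φ : Module.Dual K X.carrier) :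
    (lin (pivotIso X) x : Module.Dual K (Module.Dual K X.carrier)) φ = φ (X.ρ H.pivot x) := by
  refine (lin_toBidual X (X.ρ ↑H.v⁻¹ x) φ).trans ?_
  rw [← Module.End.mul_apply, ← map_mul]

theorem pivotIso_evaluation (X : Rep) :
    pivotIso X ▷ dual X ≫ ε_ (dual X) (dual (dual X)) = evRight X := by
  rw [pivotIso, comp_whiskerRight, Category.assoc, toBidual_evaluation, evRight]

/-- This is the ribbon axiom for `Δ(u v⁻¹)` read on vectors. The factor `(S ⊗ S)𝓕₂₁` appears because
the twist on the left-hand side acts on dual representations, in the opposite order. -/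
theorem pivotIso_dualTensor (W V : Rep) (w : W.carrier) (v : V.carrier)
    (φ : Module.Dual K V.carrier) (ψ : Module.Dual K W.carrier) :
    (lin (dualTensor (dual V) (dual W)) (lin (pivotIso W) w ⊗ₜ lin (pivotIso V) v) :
      Module.Dual K (Module.Dual K V.carrier ⊗[K] Module.Dual K W.carrier)) (φ ⊗ₜ ψ) =
    (lin (dualTensor W V) (φ ⊗ₜ ψ) : Module.Dual K (W.carrier ⊗[K] V.carrier))
      ((tens W V).ρ H.pivot (w ⊗ₜ v)) := by
  refine (lin_dualTensor (dual V) (dual W) _ _ _).trans ?_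
  rw [lin_dualTensor, tens_ρ, ← Module.End.mul_apply, ← map_mul, H.comul_uv]
  generalize H.drinfeldTwist = t
  induction t with
  | zero => simp
  | add s t hs ht => simp only [map_add, LinearMap.add_apply, add_mul, hs, ht]
  | tmul a b =>
    rw [tensRep_tmul, TensorProduct.map_tmul, pairTmul_tmul, lin_pivotIso, lin_pivotIso, map_mul]
    simp [flip, mul_comm]

/-- Each `evRight` is an ordinary evaluation after a pivot. The pivots slide down by the exchange
law, and the remaining nested evaluations are those of a tensor product, which factor through
`dualTensor`. -/
theorem nested_evRight (W V : Rep) :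
    (𝟙 _ ⊗≫ (W ◁ evRight V) ▷ dual W ⊗≫ evRight W : (W ⊗ V) ⊗ (dual V ⊗ dual W) ⟶ 𝟙_ Rep) =
      ((pivotIso W ⊗ₘ pivotIso V) ≫ dualTensor (dual V) (dual W)) ▷ (dual V ⊗ dual W) ≫
        ε_ (tens (dual V) (dual W)) (dual (tens (dual V) (dual W))) := by
  have h : dualTensor (dual V) (dual W) ▷ (dual V ⊗ dual W) ≫
      ε_ (tens (dual V) (dual W)) (dual (tens (dual V) (dual W))) =
      ε_ (dual V ⊗ dual W) (dual (dual W) ⊗ dual (dual V)) :=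
    mate_whiskerRight_evaluation (Q := tens (dual V) (dual W)) (dual (tens (dual V) (dual W))) _
  rw [comp_whiskerRight, Category.assoc, h, ExactPairing.tensor_evaluation,
    ← pivotIso_evaluation, ← pivotIso_evaluation, MonoidalCategory.tensorHom_def]
  calc
    _ = 𝟙 _ ⊗≫ W ◁ (pivotIso V ▷ dual V ▷ dual W) ⊗≫
        (W ◁ (ε_ (dual V) (dual (dual V)) ▷ dual W) ≫ pivotIso W ▷ (𝟙_ Rep ⊗ dual W)) ⊗≫
        ε_ (dual W) (dual (dual W)) := by monoidal
    _ = 𝟙 _ ⊗≫ (W ◁ (pivotIso V ▷ (dual V ⊗ dual W)) ≫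
        pivotIso W ▷ (dual (dual V) ⊗ (dual V ⊗ dual W))) ⊗≫
        dual (dual W) ◁ (ε_ (dual V) (dual (dual V)) ▷ dual W) ⊗≫
        ε_ (dual W) (dual (dual W)) := by rw [whisker_exchange]; monoidal
    _ = _ := by rw [whisker_exchange]; monoidal

/-- By `nested_evRight` both sides are evaluations of explicit functionals, and these agree by the
compatibility of the pivot with tensor products. -/
theorem whiskerLeft_dualTensor_evRight (W V : Rep) :
    (W ⊗ V) ◁ dualTensor W V ≫ evRight (tens W V) =
      𝟙 _ ⊗≫ (W ◁ evRight V) ▷ dual W ⊗≫ evRight W := by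
  rw [nested_evRight]
  have h : ∀ (y : W.carrier ⊗[K] V.carrier)
      (ζ : Module.Dual K V.carrier ⊗[K] Module.Dual K W.carrier),
      (lin (dualTensor (dual V) (dual W)) (TensorProduct.map (lin (pivotIso W))
        (lin (pivotIso V)) y) :
        Module.Dual K (Module.Dual K V.carrier ⊗[K] Module.Dual K W.carrier)) ζ =
      (lin (dualTensor W V) ζ : Module.Dual K (W.carrier ⊗[K] V.carrier))
        ((tens W V).ρ H.pivot y) := by
    intro y ζ
    induction ζ with
    | zero => simp only [map_zero]; rfl
    | add s t hs ht => rw [map_add, hs, ht, map_add]; rfl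
    | tmul φ ψ =>
      induction y with
      | zero => simp only [map_zero]; rfl
      | add s t hs ht => rw [map_add, map_add, map_add, map_add, ← hs, ← ht]; rfl
      | tmul w v => exact pivotIso_dualTensor W V w v φ ψ
  ext z
  induction z using TensorProduct.induction_on with
  | zero => simp only [map_zero]
  | add x y hx hy => simp only [map_add, hx, hy]
  | tmul y ζ =>
    refine (lin_evRight (tens W V) y (lin (dualTensor W V) ζ)).trans ?_
    refine Eq.trans ?_ (h y ((tens (dual V) (dual W)).ρ H.α ζ)).symm
    rw [map_mul, Module.End.mul_apply]
    exact LinearMap.congr_fun (lin_ρ (dualTensor W V) H.α ζ).symm ((tens W V).ρ H.pivot y)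

/-- The quantum trace of an endomorphism. -/
def qtr (X : Rep) (f : X ⟶ X) : K :=
  lin (η_ X (dual X) ≫ f ▷ dual X ≫ evRight X) (1 : K)

/-- The coevaluation inserts `β` before `f`, and `evRight` inserts `S(α) u v⁻¹` after it. Cyclicity
of the trace collects both into one factor. -/
theorem qtr_eq_trace (X : Rep) (f : X ⟶ X) :
    qtr X f = LinearMap.trace K X.carrier (lin f ∘ₗ X.ρ (H.β * H.S H.α * H.u * ↑H.v⁻¹)) := by
  have h : qtr X f = LinearMap.trace K X.carrier (X.ρ (H.S H.α * H.pivot) ∘ₗ lin f ∘ₗ X.ρ H.β) := by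
    rw [LinearMap.trace_eq_matrix_trace K (Module.finBasis K X.carrier), Matrix.trace]
    change lin (evRight X) (TensorProduct.map (lin f) LinearMap.id ((1 : K) • coevElt X)) = _
    rw [one_smul, coevElt, map_sum, map_sum]
    refine Finset.sum_congr rfl fun i _ => ?_
    rw [TensorProduct.map_tmul, lin_evRight, Matrix.diag_apply, LinearMap.toMatrix_apply]
    rfl
  rw [h, ← LinearMap.comp_assoc]
  change LinearMap.trace K X.carrier (X.ρ (H.S H.α * H.pivot) * lin f * X.ρ H.β) =
    LinearMap.trace K X.carrier (lin f * _)
  rw [mul_assoc, LinearMap.trace_mul_comm, mul_assoc, ← map_mul]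
  simp only [mul_assoc]

/-- The comparison map `dualTensor` carries the nested coevaluation to the coevaluation of `W ⊗ V`,
and pulls `evRight` of `W ⊗ V` back to the nested one. It therefore cancels between the two ends of
the trace. -/
theorem qtr_tens (W V : Rep) (f : W ⊗ V ⟶ W ⊗ V) :
    qtr (tens W V) f = qtr W (partialTrace (η_ V (dual V)) (evRight V) f) := by
  refine congrArg (fun g : 𝟙_ Rep ⟶ 𝟙_ Rep => lin g (1 : K)) ?_
  rw [trace_partialTrace, ← whiskerLeft_dualTensor_evRight]
  have h := coevaluation_whiskerLeft (X := tens W V) (ExactPairing.tensor : ExactPairing (W ⊗ V) _)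
    (exactPairing (tens W V)) (dualTensor W V) (mate_whiskerRight_evaluation (Q := tens W V) _ _)
  change (η_ W (dual W) ⊗≫ (W ◁ η_ V (dual V)) ▷ dual W ⊗≫
    𝟙 ((W ⊗ V) ⊗ (dual V ⊗ dual W))) ≫ _ =
    η_ (tens W V) (dual (tens W V)) at h
  rw [← h, Category.assoc]
  exact congrArg _ (whisker_exchange_assoc _ _ _)

end Ribbon

end RepCat

end RibbonQuasi
end

/-! ### Diagrams of closed braids as iterated partial traces -/

noncomputable section

namespace RibbonQuasi

open CategoryTheory MonoidalCategory

universe u v w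

section Braids

variable {C : Type u} [Category.{v} C] [MonoidalCategory C]

/-- The object `((X ⊗ V) ⊗ V) ⊗ ⋯` with `k` factors `V`. -/
def tower (V X : C) : ℕ → C
  | 0 => X
  | k + 1 => tower V X k ⊗ V

/-- The endomorphism of `tower V X (n + 1)` that acts on the factors `i + 1` and `i + 2` by a
morphism given by its action to the right of an arbitrary object. -/
def atStrands {V : C} (X : C) (c : (Y : C) → ((Y ⊗ V) ⊗ V ⟶ (Y ⊗ V) ⊗ V)) :
    (n : ℕ) → Fin n → (tower V X (n + 1) ⟶ tower V X (n + 1))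
  | 0 => Fin.elim0
  | n + 1 => Fin.lastCases (c (tower V X n)) fun i => atStrands X c n i ▷ V

theorem atStrands_last {V : C} (X : C) (c : (Y : C) → ((Y ⊗ V) ⊗ V ⟶ (Y ⊗ V) ⊗ V)) (n : ℕ) :
    atStrands X c (n + 1) (Fin.last n) = c (tower V X n) :=
  Fin.lastCases_last (motive := fun _ => tower V X (n + 2) ⟶ tower V X (n + 2)) ..

theorem atStrands_castSucc {V : C} (X : C) (c : (Y : C) → ((Y ⊗ V) ⊗ V ⟶ (Y ⊗ V) ⊗ V)) (n : ℕ)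
    (i : Fin n) : atStrands X c (n + 1) i.castSucc = atStrands X c n i ▷ V :=
  Fin.lastCases_castSucc (motive := fun _ => tower V X (n + 2) ⟶ tower V X (n + 2)) ..

/-- The objects attached to lists such as `replicate k true ++ q` equal towers only propositionally,
so the morphisms of diagrams are compared by heterogeneous equality. -/
theorem comp_heq_comp {X X' Y Y' Z Z' : C} {f : X ⟶ Y} {f' : X' ⟶ Y'} {g : Y ⟶ Z} {g' : Y' ⟶ Z'}
    (hX : X = X') (hY : Y = Y') (hZ : Z = Z') (hf : f ≍ f') (hg : g ≍ g') :
    f ≫ g ≍ f' ≫ g' := by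
  subst hX hY hZ hf hg
  rfl

theorem whiskerRight_heq {X X' Y Y' : C} {f : X ⟶ Y} {f' : X' ⟶ Y'} (hX : X = X') (hY : Y = Y')
    (hf : f ≍ f') (Z : C) : f ▷ Z ≍ f' ▷ Z := by
  subst hX hY hf
  rfl

namespace TangleData

variable (T : TangleData C)

theorem act_append (X : C) (p q : List Bool) : T.act X (p ++ q) = T.act (T.act X p) q := by
  induction p generalizing X with
  | nil => rfl
  | cons b p ih => exact ih _

theorem actMap_append {X Y : C} (f : X ⟶ Y) (p q : List Bool) :
    T.actMap f (p ++ q) ≍ T.actMap (T.actMap f p) q := by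
  induction p generalizing X Y with
  | nil => rfl
  | cons b p ih => exact ih _

theorem actMap_heq {X X' Y Y' : C} {f : X ⟶ Y} {f' : X' ⟶ Y'} (hX : X = X') (hY : Y = Y')
    (hf : f ≍ f') (p : List Bool) : T.actMap f p ≍ T.actMap f' p := by
  subst hX hY hf
  rfl

theorem sliceOp_heq (X : C) (l : List Bool) (e : Piece) (r : List Bool) :
    T.sliceOp X l e r ≍ T.sliceOp (T.act X l) [] e r := by
  induction l generalizing X with
  | nil => rfl
  | cons b l ih => exact ih _

theorem op_singleton_heq (X : C) (x : Slice) {p q : List Bool} (h : IsTangle p [x] q) :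
    T.op X [x] p q h ≍ T.sliceMor X x := by
  obtain ⟨rfl, rfl⟩ := h
  simp [op]

open List in
theorem act_replicate (X : C) (k : ℕ) :
    T.act X (replicate k true) = tower (T.obj true) X k := by
  induction k with
  | zero => rfl
  | succ k ih => rw [replicate_succ', act_append, ih]; rfl

open List in
theorem act_replicate_append (X : C) (k : ℕ) (q : List Bool) :
    T.act X (replicate k true ++ q) = T.act (tower (T.obj true) X k) q := by
  rw [act_append, act_replicate]

open List in
/-- `k` nested minima. -/
def cupsMor (X : C) : (k : ℕ) → (X ⟶ T.act (tower (T.obj true) X k) (replicate k false))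
  | 0 => 𝟙 X
  | k + 1 => cupsMor X k ≫ T.actMap (T.cupAt (tower (T.obj true) X k) true false) (replicate k false)

open List in
/-- `k` nested maxima. -/
def capsMor (X : C) : (k : ℕ) → (T.act (tower (T.obj true) X k) (replicate k false) ⟶ X)
  | 0 => 𝟙 X
  | k + 1 => T.actMap (T.capAt (tower (T.obj true) X k) true false) (replicate k false) ≫ capsMor X k

/-- The iterated partial trace. -/
def iterTrace (X : C) : (k : ℕ) →
    (tower (T.obj true) X k ⟶ tower (T.obj true) X k) → (X ⟶ X)
  | 0, f => f
  | k + 1, f => iterTrace X k (partialTrace (T.cup true false) (T.cap true false) f)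

open List in
-- The last minimum and the first maximum are the innermost ones and close the last strand of `f`,
-- which is a partial trace. Induction closes the others.
theorem cupsMor_capsMor (X : C) (k : ℕ) (f : tower (T.obj true) X k ⟶ tower (T.obj true) X k) :
    T.cupsMor X k ≫ T.actMap f (replicate k false) ≫ T.capsMor X k = T.iterTrace X k f := by
  induction k with
  | zero => exact (Category.id_comp _).trans (Category.comp_id _)
  | succ k ih =>
    have h : ∀ (Y : C) (f : Y ⊗ T.obj true ⟶ Y ⊗ T.obj true),
        partialTrace (T.cup true false) (T.cap true false) f =
          T.cupAt Y true false ≫ f ▷ T.obj false ≫ T.capAt Y true false := by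
      intro Y f
      simp only [partialTrace, cupAt, capAt]
      monoidal
    rw [iterTrace, ← ih, h (tower (T.obj true) X k) f]
    refine Eq.trans ?_ (congrArg (fun g => T.cupsMor X k ≫ g ≫ T.capsMor X k)
      ((T.actMap_comp _ _ _).trans (congrArg (_ ≫ ·) (T.actMap_comp _ _ _)))).symm
    change (T.cupsMor X k ≫ T.actMap _ (replicate k false)) ≫
      T.actMap (f ▷ T.obj false) (replicate k false) ≫
        (T.actMap _ (replicate k false) ≫ T.capsMor X k) = _
    simp only [Category.assoc]
    rfl

open List in
theorem op_cups_heq (X : C) (k : ℕ) :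
    T.op X (cups k) [] _ (isTangle_cups k) ≍ T.cupsMor X k := by
  induction k with
  | zero => rfl
  | succ k ih =>
    have h : cups (k + 1) =
        cups k ++ [⟨replicate k true, .cup true, replicate k false⟩] := by
      simp [cups, range_succ]
    have hx : IsTangle (replicate k true ++ replicate k false)
        [⟨replicate k true, .cup true, replicate k false⟩]
        (replicate (k + 1) true ++ replicate (k + 1) false) := by
      refine ⟨by simp [Slice.src, Piece.src], ?_⟩
      simp [IsTangle, Slice.tgt, Piece.tgt, replicate_succ' (a := true),
        replicate_succ (a := false)]
    have h2 : T.op X (cups (k + 1)) [] _ (isTangle_cups (k + 1)) ≍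
      T.op X (cups k ++ [⟨replicate k true, .cup true, replicate k false⟩]) [] _
        ((isTangle_cups k).append hx) := by
      congr 1
    rw [T.op_append X (isTangle_cups k) hx] at h2
    refine h2.trans (comp_heq_comp rfl (T.act_replicate_append X k _)
      (T.act_replicate_append X (k + 1) _) ih ?_)
    refine (T.op_singleton_heq X _ hx).trans ((T.sliceOp_heq X _ _ _).trans ?_)
    rw [act_replicate]
    rfl

open List in
theorem op_caps_heq (X : C) (k : ℕ) :
    T.op X (caps k) _ [] (isTangle_caps k) ≍ T.capsMor X k := by
  induction k with
  | zero => rfl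
  | succ k ih =>
    have h : caps (k + 1) =
        [⟨replicate k true, .cap true, replicate k false⟩] ++ caps k := by
      simp [caps, range_succ]
    have hx : IsTangle (replicate (k + 1) true ++ replicate (k + 1) false)
        [⟨replicate k true, .cap true, replicate k false⟩]
        (replicate k true ++ replicate k false) := by
      refine ⟨?_, by simp [IsTangle, Slice.tgt, Piece.tgt]⟩
      simp [Slice.src, Piece.src, replicate_succ' (a := true), replicate_succ (a := false)]
    have h2 : T.op X (caps (k + 1)) _ [] (isTangle_caps (k + 1)) ≍
      T.op X ([⟨replicate k true, .cap true, replicate k false⟩] ++ caps k) _ []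
        (hx.append (isTangle_caps k)) := by
      congr 1
    rw [T.op_append X hx (isTangle_caps k)] at h2
    refine h2.trans (comp_heq_comp (T.act_replicate_append X (k + 1) _)
      (T.act_replicate_append X k _) rfl ?_ ih)
    refine (T.op_singleton_heq X _ hx).trans ((T.sliceOp_heq X _ _ _).trans ?_)
    rw [act_replicate]
    rfl

open List in
theorem act_tower_replicate (X : C) {n : ℕ} (i : Fin n) :
    T.act ((tower (T.obj true) X i ⊗ T.obj true) ⊗ T.obj true) (replicate (n - 1 - i) true) =
      tower (T.obj true) X (n + 1) := by
  have h : n + 1 = (i + 2) + (n - 1 - i) := by omega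
  rw [← T.act_replicate X (n + 1), h, replicate_add, act_append, T.act_replicate X (i + 2)]
  rfl

open List in
theorem actMap_crossAt_heq (X : C) (o : Bool) (n : ℕ) (i : Fin n) :
    T.actMap (T.crossAt (tower (T.obj true) X i) true true o) (replicate (n - 1 - i) true) ≍
      atStrands X (fun Y => T.crossAt Y true true o) n i := by
  induction n with
  | zero => exact i.elim0
  | succ n ih =>
    cases i using Fin.lastCases with
    | last =>
      rw [atStrands_last]
      have h : n + 1 - 1 - (Fin.last n : ℕ) = 0 := by simp
      rw [h]
      rfl
    | cast i =>
      rw [atStrands_castSucc]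
      have h : n + 1 - 1 - (i.castSucc : ℕ) = (n - 1 - i) + 1 := by
        rw [Fin.val_castSucc]; omega
      rw [h, replicate_succ']
      refine (T.actMap_append _ _ _).trans ?_
      exact whiskerRight_heq (T.act_tower_replicate X i)
        (T.act_tower_replicate X i) (ih i) _

theorem isTangle_letterSlice {n : ℕ} (x : Fin n × Bool) :
    IsTangle (List.replicate (n + 1) true ++ List.replicate (n + 1) false) [letterSlice x]
      (List.replicate (n + 1) true ++ List.replicate (n + 1) false) :=
  isTangle_letters [x]

open List in
theorem op_letterSlice_heq (X : C) {n : ℕ} (x : Fin n × Bool) :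
    T.op X [letterSlice x] _ _ (isTangle_letterSlice x) ≍
      T.actMap (atStrands X (fun Y => T.crossAt Y true true x.2) n x.1)
        (replicate (n + 1) false) := by
  have hobj := T.act_tower_replicate X x.1
  refine (T.op_singleton_heq X _ _).trans ((T.sliceOp_heq X _ _ _).trans ?_)
  refine HEq.trans ?_ (T.actMap_heq hobj hobj (T.actMap_crossAt_heq X x.2 n x.1) _)
  refine HEq.trans ?_ (T.actMap_append _ _ _)
  simp only [letterSlice]
  rw [act_replicate]
  rfl

/-- The morphism of a braid word. -/
def wordMor (X : C) {n : ℕ} : BraidWord n →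
    (tower (T.obj true) X (n + 1) ⟶ tower (T.obj true) X (n + 1))
  | [] => 𝟙 _
  | x :: Ψ => wordMor X Ψ ≫ atStrands X (fun Y => T.crossAt Y true true x.2) n x.1

open List in
theorem op_letters_heq (X : C) {n : ℕ} (Ψ : BraidWord n) :
    T.op X (Ψ.reverse.map letterSlice) _ _ (isTangle_letters Ψ.reverse) ≍
      T.actMap (T.wordMor X Ψ) (replicate (n + 1) false) := by
  have hobj := T.act_replicate_append X (n + 1) (replicate (n + 1) false)
  induction Ψ with
  | nil =>
    rw [wordMor, actMap_id]
    change eqToHom _ ≍ _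
    rw [← hobj]
    rfl
  | cons x Ψ ih =>
    have h : (x :: Ψ).reverse.map letterSlice = Ψ.reverse.map letterSlice ++ [letterSlice x] := by
      simp
    have h2 : T.op X ((x :: Ψ).reverse.map letterSlice) _ _ (isTangle_letters (x :: Ψ).reverse) ≍
        T.op X (Ψ.reverse.map letterSlice ++ [letterSlice x]) _ _
          ((isTangle_letters Ψ.reverse).append (isTangle_letterSlice x)) := by
      congr 1
    rw [T.op_append X (isTangle_letters Ψ.reverse) (isTangle_letterSlice x)] at h2
    rw [wordMor, actMap_comp]
    exact h2.trans (comp_heq_comp hobj hobj hobj ih (T.op_letterSlice_heq X x))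

theorem op_closure (X : C) {n : ℕ} (Ψ : BraidWord n) :
    T.op X (closure Ψ).1 [] [] (closure Ψ).2 = T.iterTrace X (n + 1) (T.wordMor X Ψ) := by
  have hobj := T.act_replicate_append X (n + 1) (List.replicate (n + 1) false)
  rw [← cupsMor_capsMor, ← Category.assoc]
  refine eq_of_heq ?_
  refine (heq_of_eq ((T.op_append X ((isTangle_cups (n + 1)).append
    (isTangle_letters Ψ.reverse)) (isTangle_caps (n + 1))).trans
      (congrArg (· ≫ _) (T.op_append X (isTangle_cups (n + 1)) (isTangle_letters Ψ.reverse))))).trans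
      ?_
  exact comp_heq_comp rfl hobj rfl
    (comp_heq_comp rfl hobj hobj (T.op_cups_heq X (n + 1)) (T.op_letters_heq X Ψ))
    (T.op_caps_heq X (n + 1))

end TangleData

end Braids

end RibbonQuasi
end

/-! ### Braid generators as automorphisms of towers -/

noncomputable section

namespace RibbonQuasi

open CategoryTheory MonoidalCategory

universe u v w

section BraidAut

variable {C : Type u} [Category.{v} C] [MonoidalCategory C] [BraidedCategory C]

/-- The crossing of the last two strands. -/
def crossIso (V Y : C) : (Y ⊗ V) ⊗ V ≅ (Y ⊗ V) ⊗ V :=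
  α_ Y V V ≪≫ whiskerLeftIso Y (β_ V V) ≪≫ (α_ Y V V).symm

theorem crossIso_hom (V Y : C) :
    (crossIso V Y).hom = (α_ Y V V).hom ≫ Y ◁ (β_ V V).hom ≫ (α_ Y V V).inv := rfl

theorem crossIso_inv (V Y : C) :
    (crossIso V Y).inv = (α_ Y V V).hom ≫ Y ◁ (β_ V V).inv ≫ (α_ Y V V).inv := by
  simp [crossIso]

theorem crossIso_naturality (V : C) {Y Z : C} (f : Y ⟶ Z) :
    (crossIso V Y).hom ≫ f ▷ V ▷ V = f ▷ V ▷ V ≫ (crossIso V Z).hom := by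
  calc
    _ = 𝟙 _ ⊗≫ (Y ◁ (β_ V V).hom ≫ f ▷ (V ⊗ V)) ⊗≫ 𝟙 _ := by
      rw [crossIso_hom]; monoidal
    _ = _ := by rw [whisker_exchange, crossIso_hom]; monoidal

theorem crossIso_yang_baxter (V Y : C) :
    (crossIso V Y).hom ▷ V ≫ (crossIso V (Y ⊗ V)).hom ≫ (crossIso V Y).hom ▷ V =
      (crossIso V (Y ⊗ V)).hom ≫ (crossIso V Y).hom ▷ V ≫ (crossIso V (Y ⊗ V)).hom := by
  simp only [crossIso_hom]
  calc
    _ = 𝟙 _ ⊗≫ Y ◁ ((β_ V V).hom ▷ V ⊗≫ V ◁ (β_ V V).hom ⊗≫ (β_ V V).hom ▷ V) ⊗≫ 𝟙 _ := by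
      monoidal
    _ = _ := by rw [braiding_yang_baxter]; monoidal

/-- The braid generators as automorphisms of `tower V X (n + 1)`. -/
def genAut (V X : C) : (n : ℕ) → Fin n → Aut (tower V X (n + 1))
  | 0 => Fin.elim0
  | n + 1 => Fin.lastCases (crossIso V (tower V X n)) fun i => whiskerRightIso (genAut V X n i) V

theorem genAut_last (V X : C) (n : ℕ) :
    genAut V X (n + 1) (Fin.last n) = crossIso V (tower V X n) :=
  Fin.lastCases_last (motive := fun _ => Aut (tower V X (n + 2))) ..

theorem genAut_castSucc (V X : C) (n : ℕ) (i : Fin n) :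
    genAut V X (n + 1) i.castSucc = whiskerRightIso (genAut V X n i) V :=
  Fin.lastCases_castSucc (motive := fun _ => Aut (tower V X (n + 2))) ..

theorem genAut_hom (V X : C) (n : ℕ) (i : Fin n) :
    (genAut V X n i).hom = atStrands X (fun Y => (crossIso V Y).hom) n i := by
  induction n with
  | zero => exact i.elim0
  | succ n ih =>
    cases i using Fin.lastCases with
    | last => rw [genAut_last, atStrands_last]
    | cast i => rw [genAut_castSucc, atStrands_castSucc, ← ih]; rfl

theorem genAut_inv (V X : C) (n : ℕ) (i : Fin n) :
    (genAut V X n i).inv = atStrands X (fun Y => (crossIso V Y).inv) n i := by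
  induction n with
  | zero => exact i.elim0
  | succ n ih =>
    cases i using Fin.lastCases with
    | last => rw [genAut_last, atStrands_last]
    | cast i => rw [genAut_castSucc, atStrands_castSucc, ← ih]; rfl

/-- Once the common strands on the right are removed, `σ_j` crosses the last two strands while `σ_i`
acts entirely to their left, so this is naturality of the crossing in the left object. -/
theorem genAut_comm (V X : C) (n : ℕ) (i j : Fin n) (h : (i : ℕ) + 1 < j) :
    genAut V X n i * genAut V X n j = genAut V X n j * genAut V X n i := by
  induction n with
  | zero => exact i.elim0
  | succ n ih =>
    have hi : (i : ℕ) < n := by omega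
    obtain ⟨i, rfl⟩ : ∃ k : Fin n, k.castSucc = i := ⟨⟨i, hi⟩, rfl⟩
    cases j using Fin.lastCases with
    | last =>
      cases n with
      | zero => exact i.elim0
      | succ n =>
        have hi : (i : ℕ) < n := by simpa using h
        obtain ⟨i, rfl⟩ : ∃ k : Fin n, k.castSucc = i := ⟨⟨i, hi⟩, rfl⟩
        rw [genAut_last, genAut_castSucc, genAut_castSucc]
        refine Iso.ext ?_
        exact crossIso_naturality V (genAut V X n i).hom
    | cast j =>
      rw [genAut_castSucc, genAut_castSucc]
      have := congrArg (fun a : Aut _ => a.hom ▷ V) (ih i j h)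
      refine Iso.ext ?_
      refine (comp_whiskerRight _ _ _).symm.trans (this.trans (comp_whiskerRight _ _ _))

/-- The same reduction leaves the Yang–Baxter equation on the last three strands. -/
theorem genAut_braid (V X : C) (n : ℕ) (i j : Fin n) (h : (i : ℕ) + 1 = j) :
    genAut V X n i * genAut V X n j * genAut V X n i =
      genAut V X n j * genAut V X n i * genAut V X n j := by
  induction n with
  | zero => exact i.elim0
  | succ n ih =>
    have hi : (i : ℕ) < n := by omega
    obtain ⟨i, rfl⟩ : ∃ k : Fin n, k.castSucc = i := ⟨⟨i, hi⟩, rfl⟩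
    cases j using Fin.lastCases with
    | last =>
      cases n with
      | zero => exact i.elim0
      | succ n =>
        obtain rfl : i = Fin.last n := by ext; simpa using h
        rw [genAut_last, genAut_castSucc, genAut_last]
        refine Iso.ext ?_
        exact crossIso_yang_baxter V (tower V X n)
    | cast j =>
      rw [genAut_castSucc, genAut_castSucc]
      have := congrArg (fun a : Aut _ => a.hom ▷ V) (ih i j h)
      refine Iso.ext ?_
      refine Eq.trans ?_ (this.trans ?_)
      · change _ ≫ _ ≫ _ = (_ ≫ _ ≫ _) ▷ V
        rw [comp_whiskerRight, comp_whiskerRight]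
        rfl
      · change (_ ≫ _ ≫ _) ▷ V = _ ≫ _ ≫ _
        rw [comp_whiskerRight, comp_whiskerRight]
        rfl

/-- The automorphism of a braid word. -/
def wordAut (V X : C) {n : ℕ} (Ψ : BraidWord n) : Aut (tower V X (n + 1)) :=
  FreeGroup.lift (genAut V X n) (FreeGroup.mk Ψ)

theorem wordAut_append (V X : C) {n : ℕ} (Ψ₁ Ψ₂ : BraidWord n) :
    wordAut V X (Ψ₁ ++ Ψ₂) = wordAut V X Ψ₁ * wordAut V X Ψ₂ := by
  rw [wordAut, ← FreeGroup.mul_mk, map_mul]; rfl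

theorem wordAut_nil (V X : C) (n : ℕ) : wordAut V X ([] : BraidWord n) = 1 :=
  map_one (FreeGroup.lift (genAut V X n))

theorem wordAut_singleton (V X : C) {n : ℕ} (x : Fin n × Bool) :
    wordAut V X [x] = cond x.2 (genAut V X n x.1) (genAut V X n x.1)⁻¹ := by
  simp [wordAut]

theorem wordAut_singleton_hom (V X : C) {n : ℕ} (i : Fin n) (b : Bool) :
    (wordAut V X [(i, b)]).hom =
      atStrands X (fun Y => cond b (crossIso V Y).hom (crossIso V Y).inv) n i := by
  rw [wordAut_singleton]
  cases b
  · exact genAut_inv V X n i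
  · exact genAut_hom V X n i

theorem wordAut_cons (V X : C) {n : ℕ} (x : Fin n × Bool) (Ψ : BraidWord n) :
    wordAut V X (x :: Ψ) = wordAut V X [x] * wordAut V X Ψ :=
  wordAut_append V X [x] Ψ

theorem wordAut_incl (V X : C) {n : ℕ} (Ψ : BraidWord n) :
    wordAut V X Ψ.incl = whiskerRightIso (wordAut V X Ψ) V := by
  induction Ψ with
  | nil =>
    rw [wordAut_nil]
    exact (wordAut_nil V X (n + 1)).trans (Iso.ext (id_whiskerRight _ _).symm)
  | cons x Ψ ih =>
    have h : wordAut V X [(x.1.castSucc, x.2)] = whiskerRightIso (wordAut V X [x]) V := by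
      refine Iso.ext ?_
      rw [wordAut_singleton_hom, atStrands_castSucc, ← wordAut_singleton_hom]
      rfl
    rw [wordAut_cons]
    refine (wordAut_cons V X (x.1.castSucc, x.2) (BraidWord.incl Ψ)).trans ?_
    rw [h, ih]
    exact Iso.ext (comp_whiskerRight _ _ _).symm

section Linear

variable {K : Type w} [Field K] [Preadditive C] [Linear K C] [MonoidalPreadditive C]
  [MonoidalLinear K C]

theorem atStrands_smul {V : C} (X : C) (c : (Y : C) → ((Y ⊗ V) ⊗ V ⟶ (Y ⊗ V) ⊗ V)) (a : K)
    (n : ℕ) (i : Fin n) : atStrands X (fun Y => a • c Y) n i = a • atStrands X c n i := by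
  induction n with
  | zero => exact i.elim0
  | succ n ih =>
    cases i using Fin.lastCases with
    | last => rw [atStrands_last, atStrands_last]; rfl
    | cast i =>
      rw [atStrands_castSucc, atStrands_castSucc, ih]
      exact MonoidalLinear.smul_whiskerRight _ _ _

/-- The iterated partial trace. -/
def closedTrace {V V' : C} (d : 𝟙_ C ⟶ V ⊗ V') (e : V ⊗ V' ⟶ 𝟙_ C) (X : C) : (k : ℕ) →
    (tower V X k ⟶ tower V X k) → (X ⟶ X)
  | 0, f => f
  | k + 1, f => closedTrace d e X k (partialTrace d e f)

theorem partialTrace_smul_right {W V V' : C} (d : 𝟙_ C ⟶ V ⊗ V') (e : V ⊗ V' ⟶ 𝟙_ C) (c : K)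
    (f : W ⊗ V ⟶ W ⊗ V) : partialTrace d e (c • f) = c • partialTrace d e f := by
  simp [partialTrace, smul_monoidalComp, monoidalComp_smul]

theorem partialTrace_smul_cup {W V V' : C} (d : 𝟙_ C ⟶ V ⊗ V') (e : V ⊗ V' ⟶ 𝟙_ C) (c : K)
    (f : W ⊗ V ⟶ W ⊗ V) : partialTrace (c • d) e f = c • partialTrace d e f := by
  simp [partialTrace, smul_monoidalComp, monoidalComp_smul]

theorem closedTrace_smul {V V' : C} (d : 𝟙_ C ⟶ V ⊗ V') (e : V ⊗ V' ⟶ 𝟙_ C) (X : C) (k : ℕ)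
    (c : K) (f : tower V X k ⟶ tower V X k) :
    closedTrace d e X k (c • f) = c • closedTrace d e X k f := by
  induction k with
  | zero => rfl
  | succ k ih =>
    refine Eq.trans ?_ (ih (partialTrace d e f))
    exact congrArg (closedTrace d e X k) (partialTrace_smul_right d e c f)

namespace RibbonScalar

variable {V V' : C} [ExactPairing V V'] (r : RibbonScalar K V V')

theorem crossAt_eq (Y : C) (o : Bool) : r.tangleData.crossAt Y true true o =
    r.weight true true o • cond o (crossIso V Y).hom (crossIso V Y).inv := by
  have h : ∀ (c : K) (f : V ⊗ V ⟶ V ⊗ V), (α_ Y V V).hom ≫ Y ◁ (c • f) ≫ (α_ Y V V).inv =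
      c • ((α_ Y V V).hom ≫ Y ◁ f ≫ (α_ Y V V).inv) := fun c f => by
    rw [MonoidalLinear.whiskerLeft_smul, Linear.smul_comp, Linear.comp_smul]
  refine (h _ (braid V V' true true o)).trans ?_
  cases o
  · exact congrArg _ (crossIso_inv V Y).symm
  · exact congrArg _ (crossIso_hom V Y).symm

/-- All strands of the braid point upwards, so a letter has weight `s k` and an inverse letter has
weight `s k' = (s k)⁻¹`. The weights multiply to the exponent sum. -/
theorem wordMor_eq (X : C) {n : ℕ} (Ψ : BraidWord n) :
    r.tangleData.wordMor X Ψ = ((r.s * r.k) ^ Ψ.exponentSum) • (wordAut V X Ψ).hom := by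
  have h1 : (r.s * r.k) * (r.s * r.k') = 1 := by
    have := r.mul_inv
    have := r.sign
    linear_combination r.k * r.k' * r.sign + r.mul_inv
  have hw : ∀ o, r.weight true true o = (r.s * r.k) ^ (if o then (1 : ℤ) else -1) := by
    intro o
    cases o
    · exact eq_comm.1 ((zpow_neg_one _).trans (inv_eq_of_mul_eq_one_right h1))
    · exact (zpow_one _).symm
  induction Ψ with
  | nil =>
    rw [wordAut_nil]
    have h : (r.s * r.k) ^ BraidWord.exponentSum ([] : BraidWord n) = 1 := zpow_zero _
    rw [h, one_smul]
    rfl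
  | cons x Ψ ih =>
    have h2 : atStrands X (fun Y => r.tangleData.crossAt Y true true x.2) n x.1 =
        (r.s * r.k) ^ (if x.2 then (1 : ℤ) else -1) • (wordAut V X [x]).hom := by
      rw [wordAut_singleton_hom, ← atStrands_smul, ← hw]
      exact congrArg (fun c => atStrands X c n x.1) (funext fun Y => r.crossAt_eq Y x.2)
    have h3 : (r.s * r.k) ^ (BraidWord.exponentSum (x :: Ψ)) =
        (r.s * r.k) ^ (BraidWord.exponentSum Ψ) * (r.s * r.k) ^ (if x.2 then (1 : ℤ) else -1) := by
      rw [← zpow_add₀ (left_ne_zero_of_mul_eq_one h1), add_comm]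
      rfl
    rw [TangleData.wordMor, ih, h2, h3, wordAut_cons V X x Ψ]
    refine (Linear.smul_comp (R := K) _ _ _ _ _ _).trans ?_
    refine (congrArg _ (Linear.comp_smul (R := K) _ _ _ _ _ _)).trans ?_
    rw [smul_smul]
    rfl

/-- Each of the `k` minima contributes one factor `s`. -/
theorem iterTrace_eq (X : C) (k : ℕ) (f : tower V X k ⟶ tower V X k) :
    r.tangleData.iterTrace X k f = r.s ^ k • closedTrace (η_ V V') r.closing X k f := by
  induction k with
  | zero => exact (congrArg (· • f) (pow_zero r.s)).trans (one_smul K f) |>.symm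
  | succ k ih =>
    refine (ih (partialTrace (r.s • η_ V V') r.closing f)).trans ?_
    refine (congrArg (fun g => r.s ^ k • closedTrace (η_ V V') r.closing X k g)
      (partialTrace_smul_cup (η_ V V') r.closing r.s f)).trans ?_
    refine (congrArg _ (closedTrace_smul _ _ X k r.s _)).trans ?_
    rw [smul_smul, ← pow_succ]
    rfl

theorem op_closure_eq (X : C) {n : ℕ} (Ψ : BraidWord n) :
    r.tangleData.op X (closure Ψ).1 [] [] (closure Ψ).2 =
      (r.s ^ (n + 1) * (r.s * r.k) ^ Ψ.exponentSum) •
        closedTrace (η_ V V') r.closing X (n + 1) (wordAut V X Ψ).hom := by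
  rw [TangleData.op_closure]
  refine (r.iterTrace_eq X (n + 1) _).trans ?_
  rw [wordMor_eq, closedTrace_smul, smul_smul]

end RibbonScalar

end Linear

end BraidAut

end RibbonQuasi
end

/-! ### Identification of towers with the tensor powers of `V` -/

noncomputable section

namespace RibbonQuasi

open CategoryTheory MonoidalCategory

universe u v w

section Link

variable {K : Type v} [Field K] {A : Type u} [Ring A] [Algebra K A]

/-- The definition expands the leftmost leg, whereas a tower splits off its rightmost factor. The
two recursions agree without coassociativity, since after the first co-product the last leg is never
touched again. -/
theorem iterComul_succ (Δ : A →ₐ[K] A ⊗[K] A) (n : ℕ) (a : A) :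
    iterComul Δ (n + 1) a =
      Algebra.TensorProduct.map (iterComul Δ n) (AlgHom.id K A) (Δ a) := by
  induction n generalizing a with
  | zero => exact (AlgHom.congr_fun (Algebra.TensorProduct.map_id) (Δ a)).symm
  | succ n ih =>
    refine (congrArg (comulL Δ (n + 1)) (ih a)).trans ?_
    change Algebra.TensorProduct.map (comulL Δ n) (AlgHom.id K A)
      (Algebra.TensorProduct.map (iterComul Δ n) (AlgHom.id K A) (Δ a)) = _
    generalize Δ a = t
    induction t with
    | zero => simp
    | add s t hs ht => rw [map_add, map_add, map_add, hs, ht]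
    | tmul a b => rfl

variable {H : QuasiTriangularQuasiHopfAlgebra K A} {V : Type w} [AddCommGroup V] [Module K V]
  [Module A V] [IsScalarTower K A V] {X : RepCat H} (ι : X.carrier ≃ₗ[K] V)

open RepCat

/-- The identification of a tower of representations with a tensor power. -/
def powEquiv : (n : ℕ) → ((tower X (𝟙_ (RepCat H)) (n + 1)).carrier ≃ₗ[K] modPow K V n)
  | 0 => (TensorProduct.lid K X.carrier).trans ι
  | n + 1 => TensorProduct.congr (powEquiv n) ι

variable (hι : ∀ a x, ι (X.ρ a x) = rep K A V a (ι x))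

include hι

theorem powEquiv_ρ (n : ℕ) (a : A) (x : (tower X (𝟙_ (RepCat H)) (n + 1)).carrier) :
    powEquiv ι n ((tower X (𝟙_ (RepCat H)) (n + 1)).ρ a x) =
      repPow K A V n (iterComul H.Δ n a) (powEquiv ι n x) := by
  induction n generalizing a with
  | zero => exact (congrArg ι (lin_ρ (λ_ X).hom a x)).trans (hι a _)
  | succ n ih =>
    rw [iterComul_succ]
    exact map_tensRep (ρ := (tower X (𝟙_ (RepCat H)) (n + 1)).ρ) (σ := X.ρ)
      (ρ' := repPow K A V n) (σ' := rep K A V) (powEquiv ι n).toLinearMap ι.toLinearMap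
      (iterComul H.Δ n) (AlgHom.id K A) (fun a x => ih a x) hι (H.Δ a) x

theorem congr_braiding (y : X.carrier ⊗[K] X.carrier) :
    TensorProduct.congr ι ι (lin (β_ X X).hom y) =
      (checkR H V : Module.End K (V ⊗[K] V)) (TensorProduct.congr ι ι y) := by
  have h1 := map_tensRep (ρ := X.ρ) (σ := X.ρ) (ρ' := rep K A V) (σ' := rep K A V) ι.toLinearMap
    ι.toLinearMap (AlgHom.id K A) (AlgHom.id K A) hι hι ↑H.R y
  rw [Algebra.TensorProduct.map_id] at h1
  change TensorProduct.map ι.toLinearMap ι.toLinearMap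
    (TensorProduct.comm K X.carrier X.carrier (tensRep X.ρ X.ρ ↑H.R y)) =
      TensorProduct.comm K V V (tensRep (rep K A V) (rep K A V) ↑H.R
        (TensorProduct.map ι.toLinearMap ι.toLinearMap y))
  refine Eq.trans ?_ (congrArg (TensorProduct.comm K V V) h1)
  exact (TensorProduct.map_comm _ _ _)

theorem congr_tensRep₃ (n : ℕ) (t : (A ⊗[K] A) ⊗[K] A)
    (y : ((tower X (𝟙_ (RepCat H)) (n + 1)).carrier ⊗[K] X.carrier) ⊗[K] X.carrier) :
    powEquiv ι (n + 2) (tensRep₃ (tower X (𝟙_ (RepCat H)) (n + 1)) X X t y) =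
      repPow K A V (n + 2) (show algPow K A (n + 2) from
        Algebra.TensorProduct.map (Algebra.TensorProduct.map (iterComul H.Δ n) (AlgHom.id K A))
        (AlgHom.id K A) t) (powEquiv ι (n + 2) y) :=
  map_tensRep (ρ' := repPow K A V (n + 1)) (σ' := rep K A V)
    (powEquiv ι (n + 1)).toLinearMap ι.toLinearMap _ (AlgHom.id K A)
    (map_tensRep (ρ' := repPow K A V n) (σ' := rep K A V)
      (powEquiv ι n).toLinearMap ι.toLinearMap _ (AlgHom.id K A) (powEquiv_ρ ι hι n) hι) hι t y

/-- For `n = 0` the object to the left is the unit, and coherence absorbs the associators, so no `Φ`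
appears. For `n = k + 1` the two associators act by `Φ_{k+2}` and its inverse, because `A` acts on
the tower through the iterated co-product. -/
theorem powEquiv_crossIso (n : ℕ) (y : (tower X (𝟙_ (RepCat H)) (n + 2)).carrier) :
    powEquiv ι (n + 1) (lin (crossIso X (tower X (𝟙_ (RepCat H)) n)).hom y) =
      (sigmaLast H V n : Module.End K (modPow K V (n + 1))) (powEquiv ι (n + 1) y) := by
  cases n with
  | zero =>
    have h : (crossIso X (𝟙_ (RepCat H))).hom ≫ (λ_ X).hom ▷ X =
        (λ_ X).hom ▷ X ≫ (β_ X X).hom := by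
      rw [crossIso_hom]; monoidal
    have h2 : ∀ z : (unitRep (H := H) ⊗ X : RepCat H).carrier ⊗[K] X.carrier, powEquiv ι 1 z =
        TensorProduct.congr ι ι (lin ((λ_ X).hom ▷ X) z) := by
      intro z
      exact LinearMap.congr_fun (TensorProduct.map_comp ι.toLinearMap ι.toLinearMap
        (TensorProduct.lid K X.carrier).toLinearMap LinearMap.id) z
    refine (h2 _).trans ?_
    refine Eq.trans ?_ (congrArg (checkR H V : Module.End K (V ⊗[K] V)) (h2 y)).symm
    rw [← congr_braiding ι hι]
    exact congrArg (TensorProduct.congr ι ι) (LinearMap.congr_fun (congrArg lin h) y)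
  | succ k =>
    have h1 : ∀ z : (tower X (𝟙_ (RepCat H)) (k + 1)).carrier ⊗[K] (X.carrier ⊗[K] X.carrier),
        powEquiv ι (k + 2) ((TensorProduct.assoc K _ X.carrier X.carrier).symm z) =
          (TensorProduct.assoc K (modPow K V k) V V).symm
            (TensorProduct.map (powEquiv ι k).toLinearMap
              (TensorProduct.map ι.toLinearMap ι.toLinearMap) z) := by
      intro z
      refine (LinearEquiv.eq_symm_apply _).2 ?_
      refine (assoc_map (powEquiv ι k).toLinearMap ι.toLinearMap ι.toLinearMap _).symm.trans ?_
      rw [LinearEquiv.apply_symm_apply]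
    have h2 : ∀ z : ((tower X (𝟙_ (RepCat H)) (k + 1)).carrier ⊗[K] X.carrier) ⊗[K] X.carrier,
        TensorProduct.map (powEquiv ι k).toLinearMap
          (TensorProduct.map ι.toLinearMap ι.toLinearMap)
            (TensorProduct.assoc K _ X.carrier X.carrier z) =
          TensorProduct.assoc K (modPow K V k) V V (powEquiv ι (k + 2) z) :=
      assoc_map (powEquiv ι k).toLinearMap ι.toLinearMap ι.toLinearMap
    have h3 : ∀ z : (tower X (𝟙_ (RepCat H)) (k + 1)).carrier ⊗[K] (X.carrier ⊗[K] X.carrier),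
        TensorProduct.map (powEquiv ι k).toLinearMap
          (TensorProduct.map ι.toLinearMap ι.toLinearMap)
            (TensorProduct.map LinearMap.id (lin (β_ X X).hom) z) =
          TensorProduct.map LinearMap.id (checkR H V : Module.End K (V ⊗[K] V))
            (TensorProduct.map (powEquiv ι k).toLinearMap
          (TensorProduct.map ι.toLinearMap ι.toLinearMap) z) := by
      intro z
      rw [← LinearMap.comp_apply, ← LinearMap.comp_apply, ← TensorProduct.map_comp,
        ← TensorProduct.map_comp]
      refine congrArg (fun g => TensorProduct.map _ g z) ?_
      exact LinearMap.ext (congr_braiding ι hι)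
    exact (congr_tensRep₃ ι hι k ↑H.Φ _).trans (congrArg (repPow K A V (k + 2) _) ((h1 _).trans
      (congrArg (TensorProduct.assoc K (modPow K V k) V V).symm ((h3 _).trans
        (congrArg (TensorProduct.map LinearMap.id (checkR H V : Module.End K (V ⊗[K] V)))
          ((h2 _).trans (congrArg (TensorProduct.assoc K (modPow K V k) V V)
            (congr_tensRep₃ ι hι k ↑H.Φ⁻¹ y))))))))

end Link

end RibbonQuasi
end

/-! ### The representations of the braid groups and the first Markov property -/

noncomputable section

namespace RibbonQuasi

open CategoryTheory MonoidalCategory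

universe u v w

namespace RepCat

variable {K : Type v} [Field K] {A : Type u} [Ring A] [Algebra K A]
  {H : QuasiTriangularQuasiHopfAlgebra K A}

/-- The operators underlying automorphisms. -/
def autEnd (Y : RepCat H) : Aut Y →* (Module.End K Y.carrier)ˣ where
  toFun f := ⟨lin f.hom, lin f.inv, congrArg lin f.inv_hom_id, congrArg lin f.hom_inv_id⟩
  map_one' := rfl
  map_mul' _ _ := rfl

section OfModule

variable (H) (V : Type w) [AddCommGroup V] [Module K V] [Module A V] [IsScalarTower K A V]
  [FiniteDimensional K V]

/-- A finite-dimensional module, as a representation on a space of coordinate vectors. -/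
def ofModule : RepCat H where
  -- Objects of `RepCat` lie in the universe of `K`, since the unit object is `K`. Coordinates move
  -- `V`, which lies in an arbitrary universe, there.
  carrier := Fin (Module.finrank K V) → K
  ρ := ((Module.finBasis K V).equivFun.conjAlgEquiv K).toAlgHom.comp (rep K A V)

/-- The identification of a module with its space of coordinate vectors. -/
def ofModuleEquiv : (ofModule H V).carrier ≃ₗ[K] V := (Module.finBasis K V).equivFun.symm

theorem ofModuleEquiv_ρ (a : A) (x : (ofModule H V).carrier) :
    ofModuleEquiv H V ((ofModule H V).ρ a x) = rep K A V a (ofModuleEquiv H V x) :=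
  LinearEquiv.symm_apply_apply _ _

end OfModule

end RepCat

theorem map_map_id_comm {K M M' N N' : Type*} [CommSemiring K] [AddCommMonoid M] [AddCommMonoid M']
    [AddCommMonoid N] [AddCommMonoid N'] [Module K M] [Module K M'] [Module K N] [Module K N']
    (f : M →ₗ[K] M') (g : N →ₗ[K] N') (a : M →ₗ[K] M) (a' : M' →ₗ[K] M')
    (h : ∀ x, f (a x) = a' (f x)) (x : M ⊗[K] N) :
    TensorProduct.map f g (TensorProduct.map a LinearMap.id x) =
      TensorProduct.map a' LinearMap.id (TensorProduct.map f g x) := by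
  induction x with
  | zero => simp only [map_zero]
  | add x y hx hy => simp only [map_add, hx, hy]
  | tmul m n => simp [h]

section Transport

open RepCat

variable {K : Type v} [Field K] {A : Type u} [Ring A] [Algebra K A]
  {H : QuasiTriangularQuasiHopfAlgebra K A} {V : Type w} [AddCommGroup V] [Module K V]
  [Module A V] [IsScalarTower K A V] {X : RepCat H} (ι : X.carrier ≃ₗ[K] V)

/-- The operators on the tensor powers given by automorphisms of towers. -/
def transport (n : ℕ) :
    Aut (tower X (𝟙_ (RepCat H)) (n + 1)) →* (Module.End K (modPow K V n))ˣ :=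
  (Units.map ((powEquiv ι n).conjAlgEquiv K).toAlgHom.toMonoidHom).comp (autEnd _)

theorem transport_apply (n : ℕ) (f : Aut (tower X (𝟙_ (RepCat H)) (n + 1))) :
    (transport ι n f : Module.End K (modPow K V n)) = (powEquiv ι n).conj (lin f.hom) := rfl

theorem transport_powEquiv (n : ℕ) (f : Aut (tower X (𝟙_ (RepCat H)) (n + 1)))
    (x : (tower X (𝟙_ (RepCat H)) (n + 1)).carrier) :
    (transport ι n f : Module.End K (modPow K V n)) (powEquiv ι n x) =
      powEquiv ι n (lin f.hom x) := by
  rw [transport_apply, LinearEquiv.conj_apply_apply, LinearEquiv.symm_apply_apply]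

variable (hι : ∀ a x, ι (X.ρ a x) = rep K A V a (ι x))

include hι

theorem transport_genAut (n : ℕ) (i : Fin n) :
    transport ι n (genAut X (𝟙_ (RepCat H)) n i) = sigma H V n i := by
  induction n with
  | zero => exact i.elim0
  | succ n ih =>
    refine Units.ext (LinearMap.ext fun y => ?_)
    obtain ⟨x, rfl⟩ := (powEquiv ι (n + 1)).surjective y
    rw [transport_powEquiv]
    cases i using Fin.lastCases with
    | last =>
      rw [genAut_last]
      have h : sigma H V (n + 1) (Fin.last n) = sigmaLast H V n :=
        Fin.lastCases_last (motive := fun _ => (Module.End K (modPow K V (n + 1)))ˣ) ..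
      rw [h]
      exact powEquiv_crossIso ι hι n x
    | cast i =>
      rw [genAut_castSucc]
      have h : sigma H V (n + 1) i.castSucc =
          Units.map (Module.End.rTensorAlgHom K (modPow K V n) V).toMonoidHom (sigma H V n i) :=
        Fin.lastCases_castSucc (motive := fun _ => (Module.End K (modPow K V (n + 1)))ˣ) ..
      rw [h, ← ih]
      exact map_map_id_comm (powEquiv ι n).toLinearMap ι.toLinearMap _ _
        (fun x => (transport_powEquiv ι n (genAut X (𝟙_ (RepCat H)) n i) x).symm) x

theorem exists_braidGroup_rep (n : ℕ) :
    ∃ ρ : BraidGroup n →* (Module.End K (modPow K V n))ˣ,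
      ∀ i, ρ (PresentedGroup.of i) = sigma H V n i := by
  have h : ∀ r ∈ braidRels n, FreeGroup.lift (sigma H V n) r = 1 := by
    rintro r (⟨i, j, hij, rfl⟩ | ⟨i, j, hij, rfl⟩)
    · simp only [map_mul, map_inv, FreeGroup.lift_apply_of, ← transport_genAut ι hι]
      rw [mul_inv_eq_one, ← map_mul, ← map_mul, genAut_comm X _ n i j hij]
    · simp only [map_mul, map_inv, FreeGroup.lift_apply_of, ← transport_genAut ι hι]
      rw [mul_inv_eq_one, ← map_mul, ← map_mul, ← map_mul, ← map_mul, genAut_braid X _ n i j hij]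
  exact ⟨PresentedGroup.toGroup h, fun i => PresentedGroup.toGroup.of h⟩

theorem transport_wordAut {n : ℕ} (Ψ : BraidWord n) :
    transport ι n (wordAut X (𝟙_ (RepCat H)) Ψ) = FreeGroup.lift (sigma H V n) (.mk Ψ) := by
  have h : FreeGroup.lift (sigma H V n) =
      (transport ι n).comp (FreeGroup.lift (genAut X (𝟙_ (RepCat H)) n)) := by
    refine FreeGroup.ext_hom _ _ fun i => ?_
    simp [transport_genAut ι hι]
  rw [h]
  rfl

end Transport

section Markov

open RepCat

variable {K : Type v} [Field K] {A : Type u} [Ring A] [Algebra K A]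
  {H : RibbonQuasiHopfAlgebra K A}

local notation "Rep" => RepCat H.toQuasiTriangularQuasiHopfAlgebra

namespace RepCat

/-- The trace is cyclic, and the element inserted in it acts through `A`, hence commutes with every
intertwiner. -/
theorem qtr_comm (Y : Rep) (f g : Y ⟶ Y) : qtr Y (f ≫ g) = qtr Y (g ≫ f) := by
  rw [qtr_eq_trace, qtr_eq_trace]
  generalize H.β * H.S H.α * H.u * ↑H.v⁻¹ = a
  have h : lin g ∘ₗ Y.ρ a = Y.ρ a ∘ₗ lin g := LinearMap.ext (lin_ρ g a)
  change LinearMap.trace K Y.carrier (lin g * (lin f * Y.ρ a)) = _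
  rw [LinearMap.trace_mul_comm, mul_assoc]
  change LinearMap.trace K Y.carrier (lin f ∘ₗ Y.ρ a ∘ₗ lin g) = _
  rw [← h]
  rfl

theorem qtr_smul (Y : Rep) (c : K) (f : Y ⟶ Y) : qtr Y (c • f) = c * qtr Y f := by
  rw [qtr_eq_trace, qtr_eq_trace, lin_smul, LinearMap.smul_comp, map_smul, smul_eq_mul]

theorem qtr_conj {Y Z : Rep} (i : Y ≅ Z) (f : Y ⟶ Y) : qtr Z (i.inv ≫ f ≫ i.hom) = qtr Y f := by
  rw [qtr_eq_trace, qtr_eq_trace, ← LinearMap.trace_conj' _ (linEquiv i)]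
  congr 1
  ext x
  rw [LinearEquiv.conj_apply_apply]
  change lin i.hom (lin f (lin i.inv (Z.ρ _ x))) = lin i.hom (lin f (Y.ρ _ (lin i.inv x)))
  rw [lin_ρ]

/-- Each strand closed is one application of `qtr_tens`. The last step compares `1 ⊗ X` with `X` by
the unitor. -/
theorem closedTrace_evRight (X : Rep) (n : ℕ)
    (f : tower X (𝟙_ Rep) (n + 1) ⟶ tower X (𝟙_ Rep) (n + 1)) :
    lin (closedTrace (η_ X (dual X)) (evRight X) (𝟙_ Rep) (n + 1) f) (1 : K) =
      qtr (tower X (𝟙_ Rep) (n + 1)) f := by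
  induction n with
  | zero =>
    refine Eq.trans ?_ (qtr_conj (λ_ X) f)
    refine congrArg (fun g : 𝟙_ Rep ⟶ 𝟙_ Rep => lin g (1 : K)) ?_
    have h : ∀ f : 𝟙_ Rep ⊗ X ⟶ 𝟙_ Rep ⊗ X, partialTrace (η_ X (dual X)) (evRight X) f =
        η_ X (dual X) ≫ ((λ_ X).inv ≫ f ≫ (λ_ X).hom) ▷ dual X ≫ evRight X := by
      intro f
      simp only [partialTrace]
      monoidal
    exact h f
  | succ n ih => exact (ih _).trans (qtr_tens _ X f).symm

end RepCat

variable {V : Type w} [AddCommGroup V] [Module K V]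
  [Module A V] [IsScalarTower K A V] {X : RepCat H.toQuasiTriangularQuasiHopfAlgebra}
  (ι : X.carrier ≃ₗ[K] V)
  (hι : ∀ a x, ι (X.ρ a x) = rep K A V a (ι x))

include hι

theorem theta_eq_qtr {n : ℕ} (Ψ : BraidWord n) :
    theta H V Ψ = qtr (tower X (𝟙_ Rep) (n + 1)) (wordAut X (𝟙_ Rep) Ψ).hom := by
  rw [qtr_eq_trace, ← LinearMap.trace_conj' _ (powEquiv ι n), theta, wordOp,
    ← transport_wordAut ι hι]
  refine congrArg (LinearMap.trace K (modPow K V n)) (LinearMap.ext fun y => ?_)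
  obtain ⟨x, rfl⟩ := (powEquiv ι n).surjective y
  rw [LinearEquiv.conj_apply_apply, LinearEquiv.symm_apply_apply, Module.End.mul_apply,
    ← powEquiv_ρ ι hι, transport_powEquiv]
  rfl

theorem theta_append_comm {n : ℕ} (Ψ₁ Ψ₂ : BraidWord n) :
    theta H V (Ψ₁ ++ Ψ₂) = theta H V (Ψ₂ ++ Ψ₁) := by
  rw [theta_eq_qtr ι hι, theta_eq_qtr ι hι, wordAut_append, wordAut_append]
  exact qtr_comm _ _ _

end Markov

end RibbonQuasi
end

/-! ### Central elements on simple modules and the second Markov property -/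

noncomputable section

namespace RibbonQuasi

open CategoryTheory MonoidalCategory

universe u v w

theorem BraidWord.exponentSum_append {n : ℕ} (Ψ₁ Ψ₂ : BraidWord n) :
    BraidWord.exponentSum (Ψ₁ ++ Ψ₂) = Ψ₁.exponentSum + Ψ₂.exponentSum := by
  simp [BraidWord.exponentSum]

theorem BraidWord.exponentSum_incl {n : ℕ} (Ψ : BraidWord n) :
    Ψ.incl.exponentSum = Ψ.exponentSum := by
  simp [BraidWord.exponentSum, BraidWord.incl, Function.comp_def]

section Simple

variable {K : Type v} [Field K] {A : Type u} [Ring A] [Algebra K A]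
  {V : Type w} [AddCommGroup V] [Module K V] [Module A V] [IsScalarTower K A V]
  [IsSimpleModule A V]

/-- On a simple module, a central element with an eigenvalue acts by a scalar. -/
theorem rep_eq_smul_of_hasEigenvalue {c : A} (hc : ∀ a, c * a = a * c) {z : K}
    (hz : (rep K A V c).HasEigenvalue z) : rep K A V c = z • 1 := by
  -- The eigenspace is an `A`-submodule because `c` is central. It is nonzero, hence everything by
  -- simplicity.
  let E : Submodule A V :=
    { carrier := {x | c • x = z • x}
      add_mem' := fun {x y} hx hy => by
        change c • (x + y) = z • (x + y)
        rw [smul_add, smul_add, hx, hy]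
      zero_mem' := by simp
      smul_mem' := fun a x hx => by
        change c • a • x = z • a • x
        rw [← mul_smul, hc, mul_smul, hx, ← algebraMap_smul A z x, ← algebraMap_smul A z (a • x),
          ← mul_smul, ← mul_smul, Algebra.commutes] }
  have hE : E = ⊤ := by
    refine (eq_bot_or_eq_top E).resolve_left fun h => ?_
    obtain ⟨x, hx⟩ := hz.exists_hasEigenvector
    have hxE : x ∈ E := hx.apply_eq_smul
    rw [h, Submodule.mem_bot] at hxE
    exact hx.2 hxE
  ext x
  have hx : x ∈ E := hE ▸ Submodule.mem_top
  exact hx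

variable [FiniteDimensional K V]

theorem existsUnique_hasEigenvalue [IsAlgClosed K] {c : A} (hc : ∀ a, c * a = a * c) :
    ∃! z : K, (rep K A V c).HasEigenvalue z := by
  have := IsSimpleModule.nontrivial A V
  obtain ⟨z, hz⟩ := Module.End.exists_eigenvalue (rep K A V c)
  refine ⟨z, hz, fun y hy => ?_⟩
  obtain ⟨x, hx⟩ := hy.exists_hasEigenvector
  have h := hx.apply_eq_smul
  rw [rep_eq_smul_of_hasEigenvalue hc hz] at h
  exact (smul_left_injective K hx.2 h).symm

end Simple

section Markov

open RepCat

variable {K : Type v} [Field K] {A : Type u} [Ring A] [Algebra K A]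
  {H : RibbonQuasiHopfAlgebra K A}

theorem RibbonQuasiHopfAlgebra.v_inv_central (a : A) : ↑H.v⁻¹ * a = a * ↑H.v⁻¹ := by
  rw [Units.inv_mul_eq_iff_eq_mul, ← mul_assoc, H.v_central, Units.mul_inv_cancel_right]

/-- The ribbon data of a representation on which the ribbon element acts by a scalar. -/
def ribbonScalar (X : RepCat H.toQuasiTriangularQuasiHopfAlgebra) {zp zm s : K}
    (hm : X.ρ ↑H.v = zm • 1) (hz : zp * zm = 1) (hs : s * s = 1) :
    RibbonScalar K X (dual X) where
  k := zm
  k' := zp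
  s := s
  mul_inv := by rw [mul_comm, hz]
  sign := hs
  double_braiding := double_braiding X zm hm

theorem ribbonScalar_closing (X : RepCat H.toQuasiTriangularQuasiHopfAlgebra) {zp zm s : K}
    (hp : X.ρ ↑H.v⁻¹ = zp • 1) (hm : X.ρ ↑H.v = zm • 1) (hz : zp * zm = 1) (hs : s * s = 1) :
    (ribbonScalar X hm hz hs).closing = evRight X :=
  (evRight_eq_smul X zp hp).symm

/-- By `qtr_tens` the last strand is closed first. The rest of the word does not involve it and
leaves the partial trace, so only the partial trace of the last crossing remains, which is `z⁺` or
`z⁻`. -/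
theorem qtr_wordAut_stabilize (X : RepCat H.toQuasiTriangularQuasiHopfAlgebra) {zp zm : K}
    (hp : X.ρ ↑H.v⁻¹ = zp • 1) (hm : X.ρ ↑H.v = zm • 1) (hz : zp * zm = 1) {n : ℕ}
    (Ψ : BraidWord n) (b : Bool) :
    qtr (tower X (𝟙_ _) (n + 2)) (wordAut X (𝟙_ _) (Ψ.incl ++ [(Fin.last n, b)])).hom =
      cond b zp zm * qtr (tower X (𝟙_ _) (n + 1)) (wordAut X (𝟙_ _) Ψ).hom := by
  -- The sign does not enter `closing`; the value `1` is a convenient choice.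
  set r := ribbonScalar X hm hz (s := 1) (one_mul 1)
  have hr : r.closing = evRight X := ribbonScalar_closing X hp hm hz (one_mul 1)
  have h1 : ∀ Y : RepCat H.toQuasiTriangularQuasiHopfAlgebra,
      partialTrace (η_ X (dual X)) (evRight X) (cond b (crossIso X Y).hom (crossIso X Y).inv) =
        cond b zp zm • 𝟙 (Y ⊗ X) := by
    intro Y
    rw [← hr]
    cases b
    · change partialTrace _ _ (crossIso X Y).inv = zm • 𝟙 _
      rw [crossIso_inv, partialTrace_conj, r.partialTrace_braiding_inv,
        MonoidalLinear.whiskerLeft_smul, whiskerLeft_id]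
      rfl
    · change partialTrace _ _ (crossIso X Y).hom = zp • 𝟙 _
      rw [crossIso_hom, partialTrace_conj, r.partialTrace_braiding_hom,
        MonoidalLinear.whiskerLeft_smul, whiskerLeft_id]
      rfl
  have h2 : (wordAut X (𝟙_ _) (Ψ.incl ++ [(Fin.last n, b)])).hom =
      cond b (crossIso X (tower X (𝟙_ _) n)).hom (crossIso X (tower X (𝟙_ _) n)).inv ≫
        (wordAut X (𝟙_ _) Ψ).hom ▷ X := by
    rw [wordAut_append, wordAut_incl]
    refine congrArg (· ≫ _) ((wordAut_singleton_hom _ _ _ _).trans ?_)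
    exact atStrands_last _ _ _
  rw [h2]
  refine (qtr_tens _ X _).trans ?_
  refine (congrArg (qtr _) (partialTrace_whiskerRight_comp _ _ _ _)).trans ?_
  refine (congrArg (fun f => qtr (tower X (𝟙_ _) (n + 1)) (f ≫ (wordAut X (𝟙_ _) Ψ).hom))
    (h1 (tower X (𝟙_ _) n))).trans ?_
  refine (congrArg (qtr _) (Linear.smul_comp (R := K) _ _ _ _ _ _)).trans ?_
  refine (qtr_smul _ _ _).trans ?_
  exact congrArg (fun f => cond b zp zm * qtr (tower X (𝟙_ _) (n + 1)) f) (Category.id_comp _)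

end Markov

end RibbonQuasi
end

/-! ### The Markov trace and the link invariant -/

theorem theorem6 {K : Type*} [Field K] {A : Type*} [Ring A] [Algebra K A]
    (H : RibbonQuasi.RibbonQuasiHopfAlgebra K A)
    (V : Type*) [AddCommGroup V] [Module K V] [Module A V] [IsScalarTower K A V]
    [FiniteDimensional K V] [IsSimpleModule A V] :
    -- the words in the braid generators represent the braid groups
    (∀ n : ℕ, ∃ ρ : RibbonQuasi.BraidGroup n →* (Module.End K (RibbonQuasi.modPow K V n))ˣ,
      ∀ i, ρ (PresentedGroup.of i) =
        RibbonQuasi.sigma H.toQuasiTriangularQuasiHopfAlgebra V n i) ∧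
    -- first Markov property
    (∀ (n : ℕ) (Ψ₁ Ψ₂ : RibbonQuasi.BraidWord n),
      RibbonQuasi.theta H V (Ψ₁ ++ Ψ₂) = RibbonQuasi.theta H V (Ψ₂ ++ Ψ₁)) ∧
    -- over an algebraically closed field, `v⁻¹` and `v` have exactly one eigenvalue each on `V`
    (IsAlgClosed K →
      (∃! z : K, (RibbonQuasi.rep K A V ↑H.v⁻¹).HasEigenvalue z) ∧
      (∃! z : K, (RibbonQuasi.rep K A V ↑H.v).HasEigenvalue z)) ∧
    ∀ zp zm : K, (RibbonQuasi.rep K A V ↑H.v⁻¹).HasEigenvalue zp →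
      (RibbonQuasi.rep K A V ↑H.v).HasEigenvalue zm →
      -- second Markov property
      (∀ (n : ℕ) (Ψ : RibbonQuasi.BraidWord n),
        RibbonQuasi.theta H V (Ψ.incl ++ [(Fin.last n, true)]) = zp * RibbonQuasi.theta H V Ψ ∧
        RibbonQuasi.theta H V (Ψ.incl ++ [(Fin.last n, false)]) = zm * RibbonQuasi.theta H V Ψ) ∧
      -- the link invariant; `s` and `t` are `(z⁺z⁻)^{1/2}` and `(z⁻/z⁺)^{1/2}`
      ∀ s t : K, s ^ 2 = zp * zm → t ^ 2 = zm / zp → s * t = zm →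
        (∀ (n : ℕ) (Ψ₁ Ψ₂ : RibbonQuasi.BraidWord n),
          RibbonQuasi.linkPoly H V s t (Ψ₁ ++ Ψ₂) = RibbonQuasi.linkPoly H V s t (Ψ₂ ++ Ψ₁)) ∧
        (∀ (n : ℕ) (Ψ : RibbonQuasi.BraidWord n) (b : Bool),
          RibbonQuasi.linkPoly H V s t (Ψ.incl ++ [(Fin.last n, b)]) =
            RibbonQuasi.linkPoly H V s t Ψ) ∧
        ∃ L : RibbonQuasi.LinkDiagram → K,
          (∀ D D' : RibbonQuasi.LinkDiagram, D.AmbientIsotopic D' → L D = L D') ∧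
          ∀ (n : ℕ) (Ψ : RibbonQuasi.BraidWord n),
            L (RibbonQuasi.closure Ψ) = RibbonQuasi.linkPoly H V s t Ψ := by
  open RibbonQuasi RibbonQuasi.RepCat CategoryTheory MonoidalCategory in
  let X := ofModule H.toQuasiTriangularQuasiHopfAlgebra V
  let ι := ofModuleEquiv H.toQuasiTriangularQuasiHopfAlgebra V
  have hι : ∀ a x, ι (X.ρ a x) = rep K A V a (ι x) := ofModuleEquiv_ρ _ V
  have htheta : ∀ (n : ℕ) (Ψ₁ Ψ₂ : BraidWord n), theta H V (Ψ₁ ++ Ψ₂) = theta H V (Ψ₂ ++ Ψ₁) :=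
    fun n Ψ₁ Ψ₂ => theta_append_comm ι hι Ψ₁ Ψ₂
  refine ⟨exists_braidGroup_rep ι hι, htheta, fun _ =>
    ⟨existsUnique_hasEigenvalue H.v_inv_central, existsUnique_hasEigenvalue H.v_central⟩,
    fun zp zm hzp hzm => ?_⟩
  have hp := rep_eq_smul_of_hasEigenvalue H.v_inv_central hzp
  have hm := rep_eq_smul_of_hasEigenvalue H.v_central hzm
  have hscalar : ∀ (a : A) (z : K), rep K A V a = z • 1 → X.ρ a = z • 1 := by
    intro a z h
    ext x : 1
    refine ι.injective ?_
    rw [hι, h]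
    exact (map_smul ι z x).symm
  have hz : zp * zm = 1 := by
    obtain ⟨x, hx⟩ := hzp.exists_hasEigenvector
    have h : rep K A V ↑H.v⁻¹ * rep K A V ↑H.v = 1 := by rw [← map_mul, Units.inv_mul, map_one]
    rw [hp, hm, smul_mul_smul_comm, mul_one] at h
    have h2 : (zp * zm) • x = (1 : K) • x := by
      rw [one_smul]; exact LinearMap.congr_fun h x
    exact smul_left_injective K hx.2 h2
  have hmarkov : ∀ (n : ℕ) (Ψ : BraidWord n) (b : Bool),
      theta H V (Ψ.incl ++ [(Fin.last n, b)]) = cond b zp zm * theta H V Ψ := by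
    intro n Ψ b
    rw [theta_eq_qtr ι hι, theta_eq_qtr ι hι]
    exact qtr_wordAut_stabilize X (hscalar _ _ hp) (hscalar _ _ hm) hz Ψ b
  refine ⟨fun n Ψ => ⟨hmarkov n Ψ true, hmarkov n Ψ false⟩, fun s t hs ht hst => ?_⟩
  have hs2 : s * s = 1 := by rw [← sq, hs, hz]
  -- As `s² = 1`, the condition on the square roots forces `t = s z⁻`, which is the weight `s k` of
  -- a positive crossing in `tangleData`.
  have htz : t = s * zm := by rw [← hst, ← mul_assoc, hs2, one_mul]
  have ht0 : t ≠ 0 := by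
    rintro rfl
    rw [mul_zero] at hst
    rw [← hst, mul_zero] at hz
    exact zero_ne_one hz
  refine ⟨fun n Ψ₁ Ψ₂ => ?_, fun n Ψ b => ?_, ?_⟩
  · rw [linkPoly, linkPoly, htheta, BraidWord.exponentSum_append, BraidWord.exponentSum_append,
      add_comm]
  · have h : s * t ^ (BraidWord.exponentSum [(Fin.last n, b)]) * cond b zp zm = 1 := by
      cases b
      · have h1 : BraidWord.exponentSum [(Fin.last n, false)] = -1 := rfl
        have h2 : t⁻¹ = s * zp := inv_eq_of_mul_eq_one_right (by
          rw [htz]; linear_combination zm * zp * hs2 + hz)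
        rw [h1, zpow_neg_one, h2]
        change s * (s * zp) * zm = 1
        linear_combination zm * zp * hs2 + hz
      · have h1 : BraidWord.exponentSum [(Fin.last n, true)] = 1 := rfl
        rw [h1, zpow_one, hst, mul_comm]
        exact hz
    rw [linkPoly, linkPoly, hmarkov, BraidWord.exponentSum_append, BraidWord.exponentSum_incl,
      zpow_add₀ ht0]
    linear_combination s ^ n * t ^ Ψ.exponentSum * theta H V Ψ * h
  · let r := ribbonScalar X (hscalar _ _ hm) hz hs2
    have hr : r.closing = evRight X := ribbonScalar_closing X (hscalar _ _ hp) _ hz hs2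
    -- A closed braid on `n + 1` strands has `n + 1` minima of weight `s`. The extra factor `s`
    -- turns `s^(n+1)` into `s^n`, again because `s² = 1`.
    let L (D : LinkDiagram) : K := s * lin (X := 𝟙_ (RepCat H.toQuasiTriangularQuasiHopfAlgebra))
      (Y := 𝟙_ (RepCat H.toQuasiTriangularQuasiHopfAlgebra))
      (r.tangleData.op (𝟙_ _) D.1 [] [] D.2) (1 : K)
    refine ⟨L, fun D D' h => ?_, fun n Ψ => ?_⟩
    · exact congrArg (fun f : 𝟙_ (RepCat H.toQuasiTriangularQuasiHopfAlgebra) ⟶ 𝟙_ _ =>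
        s * lin f (1 : K)) (r.tangleData.op_eq_of_ambientIsotopic (𝟙_ _) h)
    · refine (congrArg (fun f : 𝟙_ (RepCat H.toQuasiTriangularQuasiHopfAlgebra) ⟶ 𝟙_ _ =>
        s * lin f (1 : K)) (r.op_closure_eq (𝟙_ _) Ψ)).trans ?_
      rw [lin_smul, hr]
      refine (congrArg (fun z => s * ((s ^ (n + 1) * (s * zm) ^ Ψ.exponentSum) * z))
        (closedTrace_evRight X n _)).trans ?_
      rw [← theta_eq_qtr ι hι, linkPoly, htz]
      linear_combination s ^ n * (s * zm) ^ Ψ.exponentSum * theta H V Ψ * hs2
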